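/- Let $H$ be a separable complex Hilbert space. Let $S(H)$ be the set of selfadjoint (possibly unbounded) operators on $H$, and let $SF(H)\subset S(H)$ be the set of those $D$ that are Fredholm, i.e. whose bounded transform $D(1+D^2)^{-1/2}$ is a bounded Fredholm operator. Fix an even function $\phi\in C_c^\infty(\mathbb R)$ with $\operatorname{supp}\phi=[-1,1]$ and $\phi'>0$ on $(-1,0)$, and put $\phi_n(x)=\phi(nx)$ for $n\ge 1$. Let $\mathfrak S_n(H)$ be $S(H)$ with the weakest topology for which the maps $D\mapsto (D\pm i)^{-1}x\in H$, for all $x\in H$, and the map $D\mapsto\phi_n(D)\in B(H)$ (with the norm topology) are continuous. Let $\mathfrak{SF}_n(H)$ be $\{D\in SF(H):\phi_n(D)\text{ is compact}\}$ with the subspace topology of $\mathfrak S_n(H)$, and let $\mathfrak{SF}(H)$ be $SF(H)$ with the inductive limit topology of the spaces $\mathfrak{SF}_n(H)$. An operator is called invertible if it is a bijection from its domain onto $H$ with bounded inverse. **Spectral flow.** For a continuous path $(D_t)_{t\in[a,b]}$ in $\mathfrak{SF}(H)$ choose a subdivision $a=s_0\le s_1\le\dots\le s_N=b$ and numbers $\mu_j>0$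 such that, for each $j$ and all $t\in[s_j,s_{j+1}]$, the points $\pm\mu_j$ lie in the resolvent set of $D_t$, and $1_{[-\mu_j,\mu_j]}(D_t)$ has finite-dimensional range and is norm continuous in $t\in[s_j,s_{j+1}]$. Then $$\operatorname{spfl}\big((D_t)_{t\in[a,b]}\big)=\sum_{j=0}^{N-1}\Big(\dim\operatorname{Ran}1_{[0,\mu_j]}(D_{s_{j+1}})-\dim\operatorname{Ran}1_{[0,\mu_j]}(D_{s_j})\Big).$$ **Index of a pair.** For orthogonal projections $P,Q$ with $P-Q$ compact, $\operatorname{ind}(P,Q)$ is the Fredholm index of $QP:P(H)\to Q(H)$. **Proposition.** Let $a\le b$ and let $(D_t)_{t\in[a,b]}$ be a continuous path in $\mathfrak{SF}(H)$ such that $D_a$ and $D_b$ are invertible. Let $(K_t)_{t\in[a,b]}$ be symmetric operators with $\operatorname{dom}D_t\subset\operatorname{dom}K_t$ for all $t$, such that $K_t(D_t+i)^{-1}$ is compact for each $t$ and norm continuous in $t$, and such that $D_t+K_t$ is invertible for each $t\in[a,b]$. Then each $D_t+K_t$ is selfadjoint; for $t=a$ and $t=b$ the operator $1_{\ge0}(D_t)-1_{\ge0}(D_t+K_t)$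 is compact and $1_{\ge0}(D_t+K_t)\,1_{\ge0}(D_t):\operatorname{Ran}1_{\ge0}(D_t)\to\operatorname{Ran}1_{\ge0}(D_t+K_t)$ is Fredholm; the spectral flow of $(D_t)_{t\in[a,b]}$ is well defined (an admissible subdivision exists and all of them give the same integer); and $$\operatorname{spfl}\big((D_t)_{t\in[a,b]}\big)=\operatorname{ind}\big(1_{\ge0}(D_b),1_{\ge0}(D_b+K_b)\big)-\operatorname{ind}\big(1_{\ge0}(D_a),1_{\ge0}(D_a+K_a)\big).$$ -/

import Mathlib

open Set Topology

noncomputable section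

namespace SpectralFlow

variable {H : Type*} [NormedAddCommGroup H] [InnerProductSpace ℂ H]

/-! ### Unbounded operators: inverses, resolvents -/

/-- `S` is an everywhere defined bounded inverse of the unbounded operator `T`. -/
def IsBoundedInverse (T : H →ₗ.[ℂ] H) (S : H →L[ℂ] H) : Prop :=
  (∀ x : T.domain, S (T x) = x) ∧ ∀ y : H, ∃ h : S y ∈ T.domain, T ⟨S y, h⟩ = y

/-- The unbounded operator `T` is invertible: it is a bijection from its domain onto `H` with a
bounded inverse. -/
def IsInvertible (T : H →ₗ.[ℂ] H) : Prop := ∃ S : H →L[ℂ] H, IsBoundedInverse T S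

open Classical in
/-- The bounded inverse of an invertible operator (and `0` for an operator that is not
invertible). -/
def boundedInv (T : H →ₗ.[ℂ] H) : H →L[ℂ] H :=
  if h : IsInvertible T then h.choose else 0

/-- The operator `D + z`, with the domain of `D`. -/
def shift (D : H →ₗ.[ℂ] H) (z : ℂ) : H →ₗ.[ℂ] H :=
  (z • (LinearMap.id : H →ₗ[ℂ] H)) +ᵥ D

/-- The real number `μ` belongs to the resolvent set of `D`. -/
def InResolventSet (D : H →ₗ.[ℂ] H) (μ : ℝ) : Prop := IsInvertible (shift D (-(μ : ℂ)))

/-- The bounded operator `(D + z)⁻¹`. -/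
def resolv (D : H →ₗ.[ℂ] H) (z : ℂ) : H →L[ℂ] H := boundedInv (shift D z)

/-- `C` is the composition `T S` of the unbounded operator `T` with the bounded operator `S`,
where `S` maps `H` into the domain of `T`. -/
def IsComposition (T : H →ₗ.[ℂ] H) (S C : H →L[ℂ] H) : Prop :=
  ∀ y : H, ∃ h : S y ∈ T.domain, C y = T ⟨S y, h⟩

open Classical in
/-- The composition `T S` of an unbounded operator `T` with a bounded operator `S`, if it is an
everywhere defined bounded operator (and `0` otherwise). -/
def boundedComp (T : H →ₗ.[ℂ] H) (S : H →L[ℂ] H) : H →L[ℂ] H :=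
  if h : ∃ C : H →L[ℂ] H, IsComposition T S C then h.choose else 0

/-! ### Functional calculus of a selfadjoint operator -/

section

variable [CompleteSpace H]

open Classical in
/-- The operator `f(D)` for a selfadjoint operator `D` and a continuous function `f` on the real
line that vanishes at infinity. It is the continuous functional calculus of the bounded normal
operator `R = (D + i)⁻¹`: a real number `x` in the spectrum of `D` corresponds to the point
`z = (x + i)⁻¹` of the spectrum of `R`, so that `x = z⁻¹ - i`, and `z = 0` to the point at
infinity. -/
def funcCalc (D : H →ₗ.[ℂ] H) (f : ℝ → ℝ) : H →L[ℂ] H :=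
  cfc (fun z : ℂ => if z = 0 then 0 else ((f (z⁻¹ - Complex.I).re : ℝ) : ℂ)) (resolv D Complex.I)

/-- The range of the spectral projection `1_S(D)` for a selfadjoint operator `D` and a closed set
`S ⊆ ℝ`. Since `1 - 1_S = 1_{ℝ∖S}` is the supremum of the functions `0 ≤ f ≤ 1` in `C_c(ℝ)` that
vanish on `S`, this range is the set of all vectors killed by `f(D)` for each `f ∈ C_c(ℝ)`
vanishing on `S`. -/
def spectralSubspace (D : H →ₗ.[ℂ] H) (S : Set ℝ) : Submodule ℂ H :=
  ⨅ (f : ℝ → ℝ) (_ : Continuous f ∧ HasCompactSupport f ∧ ∀ x ∈ S, f x = 0),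
    LinearMap.ker (funcCalc D f : H →ₗ[ℂ] H)

theorem isClosed_spectralSubspace (D : H →ₗ.[ℂ] H) (S : Set ℝ) :
    IsClosed (spectralSubspace D S : Set H) := by
  unfold spectralSubspace
  simp only [Submodule.coe_iInf]
  exact isClosed_iInter fun f => isClosed_iInter fun _ => (funcCalc D f).isClosed_ker

instance (D : H →ₗ.[ℂ] H) (S : Set ℝ) : CompleteSpace (spectralSubspace D S) :=
  (isClosed_spectralSubspace D S).completeSpace_coe

/-- The spectral projection `1_S(D)` of a selfadjoint operator `D`, for a closed set `S ⊆ ℝ`. -/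
def spectralProj (D : H →ₗ.[ℂ] H) (S : Set ℝ) : H →L[ℂ] H :=
  (spectralSubspace D S).starProjection

/-- The bounded transform `D (1 + D²)^{-1/2}` of a selfadjoint operator `D`. -/
def boundedTransform (D : H →ₗ.[ℂ] H) : H →L[ℂ] H :=
  boundedComp D (funcCalc D fun x => (Real.sqrt (1 + x ^ 2))⁻¹)

end

/-! ### The space of selfadjoint Fredholm operators -/

section

variable (H) [CompleteSpace H]

/-- The set `S(H)` of selfadjoint operators on `H`. -/
abbrev SelfAdjointOp : Type _ := {D : H →ₗ.[ℂ] H // IsSelfAdjoint D}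

/-- The set `SF(H)` of selfadjoint Fredholm operators on `H`: those whose bounded transform is a
bounded Fredholm operator. -/
abbrev SF : Type _ := {D : SelfAdjointOp H // (boundedTransform D.1).IsFredholm}

end

/-- An even function `φ ∈ C_c^∞(ℝ)` with support `[-1, 1]` and `φ' > 0` on `(-1, 0)`. -/
structure IsCutoff (φ : ℝ → ℝ) : Prop where
  smooth : ContDiff ℝ (⊤ : ℕ∞) φ
  even : ∀ x, φ (-x) = φ x
  support : tsupport φ = Icc (-1) 1
  deriv_pos : ∀ x ∈ Ioo (-1 : ℝ) 0, 0 < deriv φ x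

section

variable [CompleteSpace H]

/-- The operator `φ_n(D)`, where `φ_n(x) = φ(n x)`. -/
def cutoffOp (φ : ℝ → ℝ) (n : ℕ+) (D : H →ₗ.[ℂ] H) : H →L[ℂ] H :=
  funcCalc D fun x => φ ((n : ℕ) * x)

/-- The topology of `𝔖_n(H)`: the weakest topology on `S(H)` for which the maps
`D ↦ (D + i)⁻¹ x` and `D ↦ (D - i)⁻¹ x` into `H`, for all `x ∈ H`, and the map `D ↦ φ_n(D)` into
the bounded operators with the norm topology are continuous. -/
@[reducible] def stageTopology (φ : ℝ → ℝ) (n : ℕ+) : TopologicalSpace (SelfAdjointOp H) :=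
  (⨅ x : H, TopologicalSpace.induced (fun D => resolv D.1 Complex.I x) inferInstance) ⊓
  (⨅ x : H, TopologicalSpace.induced (fun D => resolv D.1 (-Complex.I) x) inferInstance) ⊓
  TopologicalSpace.induced (fun D => cutoffOp φ n D.1) inferInstance

/-- The set `SF_n(H)` of those `D ∈ SF(H)` for which `φ_n(D)` is compact. -/
def SFStage (φ : ℝ → ℝ) (n : ℕ+) : Set (SF H) :=
  {D | IsCompactOperator (cutoffOp φ n D.1.1)}

/-- The topology of `𝔖𝔉(H)`: the inductive limit of the spaces `𝔖𝔉_n(H)`, which are the sets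
`SF_n(H)` with the subspace topology of `𝔖_n(H)`. -/
@[reducible] def limitTopology (φ : ℝ → ℝ) : TopologicalSpace (SF H) :=
  ⨆ n : ℕ+, TopologicalSpace.coinduced (fun D : SFStage (H := H) φ n => D.1)
    (TopologicalSpace.induced (fun D : SFStage (H := H) φ n => D.1.1) (stageTopology φ n))

/-! ### Spectral flow -/

/-- On the interval `[s, t]` the path `D` admits the cut-off level `μ > 0`: the points `±μ` are in
the resolvent set of `D_r` for all `r ∈ [s, t]`, and `1_{[-μ, μ]}(D_r)` has finite-dimensional range
and is norm continuous in `r ∈ [s, t]`. -/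
structure IsLevel (D : ℝ → H →ₗ.[ℂ] H) (s t μ : ℝ) : Prop where
  pos : 0 < μ
  pos_mem : ∀ r ∈ Icc s t, InResolventSet (D r) μ
  neg_mem : ∀ r ∈ Icc s t, InResolventSet (D r) (-μ)
  finite : ∀ r ∈ Icc s t,
    FiniteDimensional ℂ (LinearMap.range (spectralProj (D r) (Icc (-μ) μ) : H →ₗ[ℂ] H))
  cont : ContinuousOn (fun r => spectralProj (D r) (Icc (-μ) μ)) (Icc s t)

/-- The number `dim Ran 1_{[0, μ]}(D)`. -/
def levelDim (D : H →ₗ.[ℂ] H) (μ : ℝ) : ℕ :=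
  Module.finrank ℂ (LinearMap.range (spectralProj D (Icc 0 μ) : H →ₗ[ℂ] H))

/-- `m` is a value of the spectral flow of `(D_t)` over `[a, b]`: there is a subdivision
`a = s_0 ≤ s_1 ≤ ⋯ ≤ s_N = b` with a level `μ_j` on each piece `[s_j, s_{j+1}]`, such that `m` is
the sum of the contributions
`dim Ran 1_{[0, μ_j]}(D_{s_{j+1}}) - dim Ran 1_{[0, μ_j]}(D_{s_j})`. -/
def HasSpectralFlow (D : ℝ → H →ₗ.[ℂ] H) (a b : ℝ) (m : ℤ) : Prop :=
  ∃ (N : ℕ) (s μ : ℕ → ℝ), s 0 = a ∧ s N = b ∧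
    (∀ j < N, s j ≤ s (j + 1) ∧ IsLevel D (s j) (s (j + 1)) (μ j)) ∧
    m = ∑ j ∈ Finset.range N,
      ((levelDim (D (s (j + 1))) (μ j) : ℤ) - (levelDim (D (s j)) (μ j) : ℤ))

open Classical in
/-- The spectral flow of the path `(D_t)` over `[a, b]`. -/
def spfl (D : ℝ → H →ₗ.[ℂ] H) (a b : ℝ) : ℤ :=
  if h : ∃ m : ℤ, HasSpectralFlow D a b m then h.choose else 0

end

/-! ### Index of a pair of projections -/

/-- The operator `Q P : P(H) → Q(H)`. -/
def pairMap (P Q : H →L[ℂ] H) :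
    LinearMap.range (P : H →ₗ[ℂ] H) →L[ℂ] LinearMap.range (Q : H →ₗ[ℂ] H) :=
  ((Q ∘L P) ∘L (LinearMap.range (P : H →ₗ[ℂ] H)).subtypeL).codRestrict
    (LinearMap.range (Q : H →ₗ[ℂ] H)) fun x => ⟨P x, rfl⟩

/-- The index `ind(P, Q) = dim Ker - dim Coker` of the operator `Q P : P(H) → Q(H)`. -/
def pairIndex (P Q : H →L[ℂ] H) : ℤ :=
  (Module.finrank ℂ (LinearMap.ker (pairMap P Q).toLinearMap) : ℤ) -
    (Module.finrank ℂ
      (LinearMap.range (Q : H →ₗ[ℂ] H) ⧸ LinearMap.range (pairMap P Q).toLinearMap) : ℤ)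

/-- `ind(P, Q)` is well defined: `P - Q` is compact and `Q P : P(H) → Q(H)` is Fredholm. -/
def IsIndexPair (P Q : H →L[ℂ] H) : Prop :=
  IsCompactOperator (P - Q) ∧ (pairMap P Q).IsFredholm

/-- The spectral projection `1_{≥ 0}(D)`. -/
def nonnegProj [CompleteSpace H] (D : H →ₗ.[ℂ] H) : H →L[ℂ] H := spectralProj D (Ici 0)

end SpectralFlow

end

set_option linter.unusedSectionVars false

/-! On a piece of the path with level `μ`, put `P = 1_{≥0}(D)`, `E = 1_{[-μ,μ]}(D)` and `Q =
1_{≥0}(D + K)`. Eigenvalues that cross `0` make `P` jump, but they do not affect `P' = P + (1 - P)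
E`, which is `1_{≥-μ}(D)`. Both `P'` and `Q` are strongly continuous, and `P' - Q` is compact and
norm continuous, so `ind(P', Q)` is constant on the piece (`pairIndex_eq_of_compactCont`). Since
`ind(P', Q) = ind(P, Q) + rk E - dim Ran 1_{[0,μ]}(D)` and `rk E` is constant, `dim Ran
1_{[0,μ]}(D)` changes by as much as `ind(P, Q)` does (`isIndexPair_and_levelDim_sub`). The sum over
the pieces telescopes for every admissible subdivision, which also shows that the spectral flow does
not depend on the subdivision.

Compactness of `P' - Q`: let `L` be the inverse of `D` off `Ran E`, extended by the identity on `Ran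
E`, and let `S = (D + K)⁻¹`. Then `S (1 - Y) = L` with `Y` compact, and `S - L` has the two forms `S
Y` and `Z L` with `Y`, `Z` compact. For `X = (1 - Q) P'` this gives a Sylvester equation `|S| X + X
|L| = |S| Y' = Z' |L|`, and similarly for `Q (1 - P')`. Neither `|S|` nor `|L|` need be bounded
below. Where `|S|` is bounded away from `0`, the solution is compact by polynomial approximation;
the remainder is controlled by the estimate `‖X‖ ≤ √(‖Z'‖ ‖Y'‖) / 2` (`norm_le_of_sylvester`,
`CompactCont.of_sylvester`).

Existence of levels: a Fredholm `D_{t₀}` has a gap around `0` and a finite-dimensional kernel. If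
`φ_n(D)` is norm close to `φ_n(D_{t₀})`, then the kernel projection of `D_{t₀}` is injective on the
spectral subspace of `D` for a small interval `[-ε, ε]`, which bounds its dimension. A sequence
argument transfers this from the stages to the inductive limit (`eventually_nearKer`). Strong
continuity bounds the dimension from below already for `[-ε/2, ε/2]`, so `ε/2 < |x| < ε` is free of
spectrum and contains the level. -/

namespace SpectralFlow

open Filter

/-! ### Compact operators: adjoints and strong limits. -/

section CompactOperators

variable {H : Type*} [NormedAddCommGroup H] [InnerProductSpace ℂ H] [CompleteSpace H]

theorem isCompactOperator_of_totallyBounded {A : H →L[ℂ] H}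
    (h : ∀ ε > 0, ∃ F : Set H, F.Finite ∧ ∀ x : H, ‖x‖ ≤ 1 → ∃ y ∈ F, ‖A x - y‖ < ε) :
    IsCompactOperator A := by
  refine (isCompactOperator_iff_isCompact_closure_image_closedBall (A : H →ₗ[ℂ] H)
    zero_lt_one).2 ?_
  refine (TotallyBounded.closure ?_).isCompact_of_isClosed isClosed_closure
  rw [Metric.totallyBounded_iff]
  intro ε hε
  obtain ⟨F, hF, hA⟩ := h ε hε
  refine ⟨F, hF, ?_⟩
  rintro _ ⟨x, hx, rfl⟩
  obtain ⟨y, hy, hxy⟩ := hA x (by simpa using hx)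
  exact mem_iUnion₂.2 ⟨y, hy, by simpa [dist_eq_norm] using hxy⟩

theorem IsCompactOperator.exists_finite_net {A : H →L[ℂ] H} (hA : IsCompactOperator A)
    {ε : ℝ} (hε : 0 < ε) :
    ∃ F : Set H, F.Finite ∧ (∀ y ∈ F, ‖y‖ ≤ 1) ∧ ∀ x : H, ‖x‖ ≤ 1 → ∃ y ∈ F, ‖A x - A y‖ < ε := by
  have h1 := (isCompactOperator_iff_isCompact_closure_image_closedBall
    (A : H →ₗ[ℂ] H) zero_lt_one).1 hA
  have h2 : TotallyBounded ((A : H →ₗ[ℂ] H) '' Metric.closedBall 0 1) :=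
    h1.totallyBounded.subset subset_closure
  obtain ⟨t, ht, htf, hcov⟩ := Metric.finite_approx_of_totallyBounded h2 ε hε
  obtain ⟨F, hFs, hFf, rfl⟩ := Set.exists_subset_image_finite_and.1 ⟨t, ht, htf, rfl⟩
  refine ⟨F, hFf, fun y hy => by simpa using hFs hy, fun x hx => ?_⟩
  have := hcov ⟨x, by simpa using hx, rfl⟩
  simp only [mem_iUnion, Metric.mem_ball, mem_image, exists_prop] at this
  obtain ⟨_, ⟨y, hy, rfl⟩, hxy⟩ := this
  exact ⟨y, hy, by simpa [dist_eq_norm] using hxy⟩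

/-- A finite net for `A* A` serves for `A`, because `‖A (x - y)‖² ≤ ‖A* A (x - y)‖ ‖x - y‖`. -/
theorem isCompactOperator_of_star_mul_self {A : H →L[ℂ] H}
    (h : IsCompactOperator (star A * A : H →L[ℂ] H)) : IsCompactOperator A := by
  refine isCompactOperator_of_totallyBounded fun ε hε => ?_
  -- The denominator `2` compensates for `‖x - y‖ ≤ 2` in the unit ball.
  obtain ⟨F, hF, hF1, hF2⟩ := IsCompactOperator.exists_finite_net h (ε := ε ^ 2 / 2) (by positivity)
  refine ⟨A '' F, hF.image _, fun x hx => ?_⟩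
  obtain ⟨y, hy, hxy⟩ := hF2 x hx
  refine ⟨A y, ⟨y, hy, rfl⟩, ?_⟩
  have h1 : ‖A x - A y‖ ^ 2 ≤ ‖(star A * A) x - (star A * A) y‖ * ‖x - y‖ := by
    rw [← map_sub, ← map_sub]
    have : ((‖A (x - y)‖ ^ 2 : ℝ) : ℂ) = inner ℂ ((star A * A) (x - y)) (x - y) := by
      rw [mul_apply_eq_comp, ContinuousLinearMap.star_eq_adjoint,
        ContinuousLinearMap.adjoint_inner_left, inner_self_eq_norm_sq_to_K]
      norm_cast
    have h2 : ‖A (x - y)‖ ^ 2 = ‖inner ℂ ((star A * A) (x - y)) (x - y)‖ := by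
      rw [← this]; simp
    rw [h2]
    exact norm_inner_le_norm _ _
  have h2 : ‖x - y‖ ≤ 2 := (norm_sub_le _ _).trans (by linarith [hF1 y hy])
  have h3 : ‖A x - A y‖ ^ 2 < ε ^ 2 := by
    calc _ ≤ _ := h1
      _ ≤ ‖(star A * A) x - (star A * A) y‖ * 2 := by gcongr
      _ < ε ^ 2 / 2 * 2 := by gcongr
      _ = ε ^ 2 := by ring
  exact lt_of_pow_lt_pow_left₀ 2 hε.le h3

theorem IsCompactOperator.mul_left {A : H →L[ℂ] H} (hA : IsCompactOperator A) (M : H →L[ℂ] H) :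
    IsCompactOperator (M * A : H →L[ℂ] H) := hA.clm_comp M

theorem IsCompactOperator.mul_right {A : H →L[ℂ] H} (hA : IsCompactOperator A) (M : H →L[ℂ] H) :
    IsCompactOperator (A * M : H →L[ℂ] H) := hA.comp_clm M

theorem IsCompactOperator.star {A : H →L[ℂ] H} (hA : IsCompactOperator A) :
    IsCompactOperator (star A : H →L[ℂ] H) := by
  apply isCompactOperator_of_star_mul_self
  rw [star_star]
  exact IsCompactOperator.mul_right hA _

/-- A bounded strongly convergent family converges uniformly on totally bounded sets, here on the
image of the unit ball under `A`. This is how strong continuity becomes norm continuity below. -/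
theorem tendsto_mul_of_isCompactOperator {ι : Type*} {l : Filter ι} {M : ι → H →L[ℂ] H}
    {M₀ A : H →L[ℂ] H} {C : ℝ} (hC : ∀ i, ‖M i‖ ≤ C)
    (hM : ∀ x, Tendsto (fun i => M i x) l (𝓝 (M₀ x))) (hA : IsCompactOperator A) :
    Tendsto (fun i => M i * A) l (𝓝 (M₀ * A)) := by
  rw [tendsto_iff_norm_sub_tendsto_zero, Metric.tendsto_nhds]
  intro ε hε
  set K := |C| + ‖M₀‖ + 1 with hK
  have hK0 : 0 < K := by positivity
  obtain ⟨F, hF, hF1, hF2⟩ := IsCompactOperator.exists_finite_net hA (ε := ε / (4 * K))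
    (by positivity)
  have h1 : ∀ᶠ i in l, ∀ y ∈ F, ‖M i (A y) - M₀ (A y)‖ < ε / 4 := by
    rw [Filter.eventually_all_finite hF]
    intro y _
    have := (tendsto_iff_norm_sub_tendsto_zero.1 (hM (A y)))
    exact this.eventually (gt_mem_nhds (by positivity))
  filter_upwards [h1] with i hi
  have h2 : ‖M i * A - M₀ * A‖ ≤ ε / 2 := by
    refine ContinuousLinearMap.opNorm_le_of_unit_norm (by positivity) fun x hx => ?_
    obtain ⟨y, hy, hxy⟩ := hF2 x hx.le
    have e : (M i * A - M₀ * A) x = (M i - M₀) (A x - A y) + (M i (A y) - M₀ (A y)) := by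
      simp; abel
    rw [e]
    have h3 : ‖M i - M₀‖ ≤ K := (norm_sub_le _ _).trans (by linarith [hC i, le_abs_self C])
    calc _ ≤ ‖(M i - M₀) (A x - A y)‖ + ‖M i (A y) - M₀ (A y)‖ := norm_add_le _ _
      _ ≤ ‖M i - M₀‖ * ‖A x - A y‖ + ε / 4 := by
        gcongr
        · exact ContinuousLinearMap.le_opNorm _ _
        · exact (hi y hy).le
      _ ≤ K * (ε / (4 * K)) + ε / 4 := by gcongr
      _ = ε / 2 := by field_simp; ring
  rw [Real.dist_eq, sub_zero, abs_of_nonneg (norm_nonneg _)]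
  linarith

end CompactOperators

/-! ### Strongly continuous families and norm continuous families of compact operators. -/

section Families

variable {H : Type*} [NormedAddCommGroup H] [InnerProductSpace ℂ H] [CompleteSpace H]
  {T : Type*} [TopologicalSpace T]

/-- A bounded family of operators that is, with its adjoints, strongly continuous. -/
structure StrongCont (M : T → H →L[ℂ] H) : Prop where
  bound : ∃ C, ∀ t, ‖M t‖ ≤ C
  cont : ∀ x, Continuous fun t => M t x
  cont_star : ∀ x, Continuous fun t => star (M t) x

/-- A norm continuous family of compact operators. -/
structure CompactCont (M : T → H →L[ℂ] H) : Prop where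
  cont : Continuous M
  compact : ∀ t, IsCompactOperator (M t)

theorem continuous_apply_of_bound {M : T → H →L[ℂ] H} {v : T → H} {C : ℝ} (hC : ∀ t, ‖M t‖ ≤ C)
    (hM : ∀ x, Continuous fun t => M t x) (hv : Continuous v) : Continuous fun t => M t (v t) := by
  rw [continuous_iff_continuousAt]
  intro t₀
  have h1 : Tendsto (fun t => M t (v t - v t₀)) (𝓝 t₀) (𝓝 0) := by
    rw [tendsto_zero_iff_norm_tendsto_zero]
    have h2 : Tendsto (fun t => |C| * ‖v t - v t₀‖) (𝓝 t₀) (𝓝 0) := by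
      have := tendsto_iff_norm_sub_tendsto_zero.1 (hv.tendsto t₀)
      simpa using this.const_mul |C|
    refine squeeze_zero (fun _ => norm_nonneg _) (fun t => ?_) h2
    refine (ContinuousLinearMap.le_opNorm _ _).trans ?_
    gcongr
    exact (hC t).trans (le_abs_self C)
  have h3 := h1.add ((hM (v t₀)).tendsto t₀)
  rw [zero_add] at h3
  refine h3.congr fun t => ?_
  simp

namespace StrongCont

variable {M N : T → H →L[ℂ] H}

theorem of_isSelfAdjoint {C : ℝ} (hC : ∀ t, ‖M t‖ ≤ C) (hM : ∀ x, Continuous fun t => M t x)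
    (h : ∀ t, IsSelfAdjoint (M t)) : StrongCont M :=
  ⟨⟨C, hC⟩, hM, fun x => by simpa only [(h _).star_eq] using hM x⟩

theorem const (A : H →L[ℂ] H) : StrongCont (fun _ : T => A) :=
  ⟨⟨‖A‖, fun _ => le_rfl⟩, fun _ => continuous_const, fun _ => continuous_const⟩

theorem star (hM : StrongCont M) : StrongCont (fun t => star (M t)) :=
  ⟨by simpa only [norm_star] using hM.bound, hM.cont_star, by simpa only [star_star] using hM.cont⟩

theorem add (hM : StrongCont M) (hN : StrongCont N) : StrongCont (fun t => M t + N t) := by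
  obtain ⟨C, hC⟩ := hM.bound
  obtain ⟨C', hC'⟩ := hN.bound
  refine ⟨⟨C + C', fun t => (norm_add_le _ _).trans (add_le_add (hC t) (hC' t))⟩, fun x => ?_,
    fun x => ?_⟩
  · exact (hM.cont x).add (hN.cont x)
  · simp only [star_add]
    exact (hM.cont_star x).add (hN.cont_star x)

theorem smul (hM : StrongCont M) (c : ℂ) : StrongCont (fun t => c • M t) := by
  obtain ⟨C, hC⟩ := hM.bound
  refine ⟨⟨‖c‖ * C, fun t => ?_⟩, fun x => ?_, fun x => ?_⟩
  · rw [norm_smul]; exact mul_le_mul_of_nonneg_left (hC t) (norm_nonneg c)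
  · exact (hM.cont x).const_smul c
  · simp only [star_smul]
    exact (hM.cont_star x).const_smul (Star.star c)

theorem neg (hM : StrongCont M) : StrongCont (fun t => - M t) := by
  simpa using hM.smul (-1)

theorem sub (hM : StrongCont M) (hN : StrongCont N) : StrongCont (fun t => M t - N t) := by
  simpa [sub_eq_add_neg] using hM.add hN.neg

theorem mul (hM : StrongCont M) (hN : StrongCont N) : StrongCont (fun t => M t * N t) := by
  obtain ⟨C, hC⟩ := hM.bound
  obtain ⟨C', hC'⟩ := hN.bound
  refine ⟨⟨C * C', fun t => (norm_mul_le _ _).trans ?_⟩, fun x => ?_, fun x => ?_⟩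
  · exact mul_le_mul (hC t) (hC' t) (norm_nonneg _) ((norm_nonneg _).trans (hC t))
  · exact continuous_apply_of_bound (M := M) hC hM.cont (hN.cont x)
  · simp only [star_mul]
    exact continuous_apply_of_bound (M := fun t => Star.star (N t)) (C := C')
      (fun t => by simpa using hC' t) hN.cont_star (hM.cont_star x)

theorem one : StrongCont (fun _ : T => (1 : H →L[ℂ] H)) := const 1

end StrongCont

namespace CompactCont

variable {M N : T → H →L[ℂ] H}

theorem zero : CompactCont (fun _ : T => (0 : H →L[ℂ] H)) :=
  ⟨continuous_const, fun _ => isCompactOperator_zero⟩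

theorem star (hM : CompactCont M) : CompactCont (fun t => star (M t)) :=
  ⟨hM.cont.star, fun t => IsCompactOperator.star (hM.compact t)⟩

theorem add (hM : CompactCont M) (hN : CompactCont N) : CompactCont (fun t => M t + N t) :=
  ⟨hM.cont.add hN.cont, fun t => (hM.compact t).add (hN.compact t)⟩

theorem neg (hM : CompactCont M) : CompactCont (fun t => - M t) :=
  ⟨hM.cont.neg, fun t => (hM.compact t).neg⟩

theorem sub (hM : CompactCont M) (hN : CompactCont N) : CompactCont (fun t => M t - N t) :=
  ⟨hM.cont.sub hN.cont, fun t => (hM.compact t).sub (hN.compact t)⟩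

theorem smul (hM : CompactCont M) (c : ℂ) : CompactCont (fun t => c • M t) :=
  ⟨hM.cont.const_smul c, fun t => (hM.compact t).smul c⟩

/-- Split `M_t N_t - M_{t₀} N_{t₀}` into `M_t (N_t - N_{t₀})`, small by boundedness of `M`, and
`(M_t - M_{t₀}) N_{t₀}`, small by compactness of `N_{t₀}`. -/
theorem mul_left (hN : CompactCont N) (hM : StrongCont M) : CompactCont (fun t => M t * N t) := by
  refine ⟨?_, fun t => IsCompactOperator.mul_left (hN.compact t) _⟩
  obtain ⟨C, hC⟩ := hM.bound
  rw [continuous_iff_continuousAt]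
  intro t₀
  have h1 : Tendsto (fun t => M t * (N t - N t₀)) (𝓝 t₀) (𝓝 0) := by
    rw [tendsto_zero_iff_norm_tendsto_zero]
    have h2 : Tendsto (fun t => C * ‖N t - N t₀‖) (𝓝 t₀) (𝓝 0) := by
      have := tendsto_iff_norm_sub_tendsto_zero.1 (hN.cont.tendsto t₀)
      simpa using this.const_mul C
    refine squeeze_zero (fun _ => norm_nonneg _) (fun t => ?_) h2
    refine (norm_mul_le _ _).trans ?_
    gcongr
    exact hC t
  have h3 := h1.add (tendsto_mul_of_isCompactOperator hC (fun x => (hM.cont x).tendsto t₀)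
    (hN.compact t₀))
  rw [zero_add] at h3
  refine h3.congr fun t => ?_
  rw [mul_sub, sub_add_cancel]

/-- Pass to adjoints; this is why `StrongCont` includes strong continuity of the adjoints. -/
theorem mul_right (hN : CompactCont N) (hM : StrongCont M) :
    CompactCont (fun t => N t * M t) := by
  simpa using (hN.star.mul_left hM.star).star

/-- The approximating family may depend on `t₀` and need only be close near `t₀`;
`CompactCont.of_sylvester` relies on this. -/
theorem of_approx (h : ∀ t₀, ∀ ε > 0, ∃ N : T → H →L[ℂ] H, CompactCont N ∧
    ∀ᶠ t in 𝓝 t₀, ‖M t - N t‖ ≤ ε) : CompactCont M := by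
  refine ⟨?_, fun t => ?_⟩
  · rw [continuous_iff_continuousAt]
    intro t₀
    rw [ContinuousAt, Metric.tendsto_nhds]
    intro ε hε
    obtain ⟨N, hN, hMN⟩ := h t₀ (ε / 4) (by positivity)
    have h1 := Metric.tendsto_nhds.1 (hN.cont.tendsto t₀) (ε / 4) (by positivity)
    have h2 := hMN.self_of_nhds
    filter_upwards [hMN, h1] with t ht ht'
    rw [dist_eq_norm] at ht' ⊢
    calc ‖M t - M t₀‖ = ‖(M t - N t) + (N t - N t₀) - (M t₀ - N t₀)‖ := by congr 1; abel
      _ ≤ ‖M t - N t‖ + ‖N t - N t₀‖ + ‖M t₀ - N t₀‖ :=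
        (norm_sub_le _ _).trans (by gcongr; exact norm_add_le _ _)
      _ < ε := by linarith
  · have hcl : IsClosed {f : H →L[ℂ] H | IsCompactOperator f} := isClosed_setOfPred_isCompactOperator
    have : M t ∈ closure {f : H →L[ℂ] H | IsCompactOperator f} := by
      rw [Metric.mem_closure_iff]
      intro ε hε
      obtain ⟨N, hN, hMN⟩ := h t (ε / 2) (by positivity)
      refine ⟨N t, hN.compact t, ?_⟩
      rw [dist_eq_norm]
      linarith [hMN.self_of_nhds]
    rwa [hcl.closure_eq] at this

end CompactCont

end Families

/-! ### Norm estimate for the Sylvester equation `p X + X q = p Y = Z q`. -/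

section Sylvester

variable {H : Type*} [NormedAddCommGroup H] [InnerProductSpace ℂ H] [CompleteSpace H]

theorem inner_apply_of_isSelfAdjoint {s : H →L[ℂ] H} (hs : IsSelfAdjoint s) (x y : H) :
    inner ℂ (s x) y = inner ℂ x (s y) := by
  conv_lhs => rw [← hs.star_eq, ContinuousLinearMap.star_eq_adjoint,
    ContinuousLinearMap.adjoint_inner_left]

theorem inner_star_left (A : H →L[ℂ] H) (x y : H) :
    inner ℂ (star A x) y = inner ℂ x (A y) := by
  rw [ContinuousLinearMap.star_eq_adjoint, ContinuousLinearMap.adjoint_inner_left]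

theorem inner_star_right (A : H →L[ℂ] H) (x y : H) :
    inner ℂ x (star A y) = inner ℂ (A x) y := by
  rw [ContinuousLinearMap.star_eq_adjoint, ContinuousLinearMap.adjoint_inner_right]

theorem le_of_forall_pow_two_pow_le {a b K : ℝ} (hb : 0 ≤ b)
    (h : ∀ n : ℕ, a ^ (2 ^ n) ≤ K * b ^ (2 ^ n)) : a ≤ b := by
  by_contra! hab
  rcases hb.eq_or_lt with rfl | hb
  · have := h 0
    simp at this
    linarith
  have h1 : 1 < a / b := (one_lt_div hb).2 hab
  obtain ⟨n, hn⟩ := pow_unbounded_of_one_lt K h1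
  have h2 : (a / b) ^ n ≤ (a / b) ^ (2 ^ n) :=
    pow_le_pow_right₀ h1.le (Nat.lt_two_pow_self).le
  have h3 : (a / b) ^ (2 ^ n) ≤ K := by
    rw [div_pow, div_le_iff₀ (by positivity)]
    exact h n
  linarith

/-- An operator that is symmetric for the form `⟨s x, s y⟩` is bounded for this form. -/
theorem norm_apply_le_of_symmetrizable {s Y : H →L[ℂ] H} (hs : IsSelfAdjoint s)
    (hY : IsSelfAdjoint (s * s * Y)) (x : H) : ‖s (Y x)‖ ≤ ‖Y‖ * ‖s x‖ := by
  have hcomm : star Y * (s * s) = s * s * Y := by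
    have := hY.star_eq
    rwa [star_mul, star_mul, hs.star_eq] at this
  have key : ∀ n : ℕ, star (Y ^ n) * (s * s) = s * s * Y ^ n := by
    intro n
    induction n with
    | zero => simp
    | succ n ih =>
      rw [pow_succ, star_mul, mul_assoc, ih, ← mul_assoc, hcomm, mul_assoc, ← pow_succ',
        ← pow_succ]
  -- Cauchy–Schwarz for the form `⟨s x, s y⟩`, for which `Y` is symmetric. Repeated doubling bounds
  -- `(‖s Y x‖ / ‖s x‖)^(2^n)` by a constant times `‖Y‖^(2^n)`, and the constant disappears after
  -- taking roots.
  have step : ∀ n : ℕ, ‖s ((Y ^ n) x)‖ ^ 2 ≤ ‖s x‖ * ‖s ((Y ^ (2 * n)) x)‖ := by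
    intro n
    have h1 : ((‖s ((Y ^ n) x)‖ ^ 2 : ℝ) : ℂ) = inner ℂ (s x) (s ((Y ^ (2 * n)) x)) := by
      have : (inner ℂ (s ((Y ^ n) x)) (s ((Y ^ n) x)) : ℂ) = ((‖s ((Y ^ n) x)‖ ^ 2 : ℝ) : ℂ) := by
        rw [inner_self_eq_norm_sq_to_K]; norm_cast
      rw [← this, ← inner_apply_of_isSelfAdjoint hs, inner_apply_of_isSelfAdjoint hs x,
        ← mul_apply_eq_comp s s]
      have h2 : (s * s) ((Y ^ n) x) = star (Y ^ n) ((s * s) x) := by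
        rw [← mul_apply_eq_comp, ← key, mul_apply_eq_comp]
      have h3 : s (s ((Y ^ (2 * n)) x)) = star (Y ^ n) ((s * s) ((Y ^ n) x)) := by
        rw [← mul_apply_eq_comp (star (Y ^ n)), key, two_mul, pow_add]
        simp [mul_apply_eq_comp]
      rw [h3, inner_star_right, inner_apply_of_isSelfAdjoint (s := s * s)]
      rw [isSelfAdjoint_iff, star_mul, hs.star_eq]
    have h4 : ‖s ((Y ^ n) x)‖ ^ 2 = ‖inner ℂ (s x) (s ((Y ^ (2 * n)) x))‖ := by
      rw [← h1]; simp
    rw [h4]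
    exact norm_inner_le_norm _ _
  rcases (norm_nonneg (s x)).eq_or_lt with h0 | h0
  · have := step 1
    rw [← h0, zero_mul] at this
    rw [← h0, mul_zero]
    simp only [pow_one] at this
    nlinarith [norm_nonneg (s (Y x))]
  rw [← div_le_iff₀ h0]
  refine le_of_forall_pow_two_pow_le (K := ‖s‖ * ‖x‖ / ‖s x‖) (norm_nonneg _) fun n => ?_
  have h5 : (‖s (Y x)‖ / ‖s x‖) ^ (2 ^ n) ≤ ‖s ((Y ^ (2 ^ n)) x)‖ / ‖s x‖ := by
    induction n with
    | zero => simp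
    | succ n ih =>
      rw [pow_succ 2 n, pow_mul]
      refine (pow_le_pow_left₀ (by positivity) ih 2).trans ?_
      rw [div_pow, div_le_div_iff₀ (by positivity) h0, mul_comm (2 ^ n) 2]
      have := step (2 ^ n)
      calc _ ≤ ‖s x‖ * ‖s ((Y ^ (2 * 2 ^ n)) x)‖ * ‖s x‖ := by gcongr
        _ = _ := by ring
  refine h5.trans ?_
  rw [div_mul_eq_mul_div]
  gcongr
  calc _ ≤ ‖s‖ * (‖Y ^ (2 ^ n)‖ * ‖x‖) :=
        (s.le_opNorm _).trans (by gcongr; exact ContinuousLinearMap.le_opNorm _ _)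
    _ ≤ ‖s‖ * (‖Y‖ ^ (2 ^ n) * ‖x‖) := by
      gcongr
      exact norm_pow_le' Y (by positivity)
    _ = _ := by ring

/-- An interpolation bound for the operator that is formally `s Y u⁻¹ = s⁻¹ Z u`. One has `‖s Y x‖²
= ⟨u x, u Z* Y x⟩`, and `Z* Y` is symmetric for the form of `u` because `u² Z* Y = Y* s² Y`. -/
theorem norm_apply_le_of_mul_eq_mul {s u Y Z : H →L[ℂ] H} (hs : IsSelfAdjoint s)
    (hu : IsSelfAdjoint u) (h : s * s * Y = Z * (u * u)) (x : H) :
    ‖s (Y x)‖ ≤ √(‖Z‖ * ‖Y‖) * ‖u x‖ := by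
  have hss : IsSelfAdjoint (s * s) := by rw [isSelfAdjoint_iff, star_mul, hs.star_eq]
  have h1 : ‖s (Y x)‖ ^ 2 ≤ ‖u x‖ * ‖u ((star Z * Y) x)‖ := by
    have h2 : ((‖s (Y x)‖ ^ 2 : ℝ) : ℂ) = inner ℂ (u x) (u ((star Z * Y) x)) := by
      have : (inner ℂ (s (Y x)) (s (Y x)) : ℂ) = ((‖s (Y x)‖ ^ 2 : ℝ) : ℂ) := by
        rw [inner_self_eq_norm_sq_to_K]; norm_cast
      rw [← this, ← inner_apply_of_isSelfAdjoint hs, ← inner_apply_of_isSelfAdjoint hu,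
        mul_apply_eq_comp, inner_star_right]
      congr 1
      exact congr($h x)
    have h4 : ‖s (Y x)‖ ^ 2 = ‖inner ℂ (u x) (u ((star Z * Y) x))‖ := by
      rw [← h2]; simp
    rw [h4]
    exact norm_inner_le_norm _ _
  have h3 : IsSelfAdjoint (u * u * (star Z * Y)) := by
    have e : u * u * (star Z * Y) = star Y * (s * s) * Y := by
      have h5 : star Y * (s * s) = u * u * star Z := by
        have := congr(star $h)
        rwa [star_mul, star_mul, star_mul, hs.star_eq, star_mul, hu.star_eq] at this
      rw [h5]; noncomm_ring
    rw [e]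
    exact hss.conjugate' Y
  have h4 := norm_apply_le_of_symmetrizable hu h3 x
  have h5 : ‖star Z * Y‖ ≤ ‖Z‖ * ‖Y‖ := (norm_mul_le _ _).trans (by rw [norm_star])
  have h6 : ‖s (Y x)‖ ^ 2 ≤ (√(‖Z‖ * ‖Y‖) * ‖u x‖) ^ 2 := by
    rw [mul_pow, Real.sq_sqrt (by positivity)]
    calc _ ≤ _ := h1
      _ ≤ ‖u x‖ * (‖Z‖ * ‖Y‖ * ‖u x‖) := by
        gcongr
        exact h4.trans (by gcongr)
      _ = _ := by ring
  exact (pow_le_pow_iff_left₀ (norm_nonneg _) (by positivity) two_ne_zero).1 h6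

/-- A unit vector that almost attains the norm is almost an eigenvector of `X* X` for `‖X‖²`, as one
sees by expanding the square of the defect. -/
theorem exists_near_norming (X : H →L[ℂ] H) (hX : 0 < ‖X‖) {η : ℝ} (hη : 0 < η) :
    ∃ x : H, ‖x‖ = 1 ∧ ‖star X (X x) - ((‖X‖ ^ 2 : ℝ) : ℂ) • x‖ ≤ η := by
  set σ := ‖X‖ with hσ
  -- With this threshold the squared defect, at most `σ⁴ - σ² ‖X z‖²`, is at most `η² / 2`.
  have hlt : √(max 0 (σ ^ 2 - η ^ 2 / (2 * σ ^ 2))) < σ := by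
    rw [Real.sqrt_lt' hX, max_lt_iff]
    exact ⟨by positivity, by have : 0 < η ^ 2 / (2 * σ ^ 2) := by positivity
                             linarith⟩
  obtain ⟨x, hx1, hx2⟩ := ContinuousLinearMap.exists_lt_apply_of_lt_opNorm X hlt
  have hx0 : 0 < ‖x‖ := by
    rw [norm_pos_iff]
    rintro rfl
    rw [map_zero, norm_zero] at hx2
    exact absurd (Real.sqrt_nonneg _) (not_le.2 hx2)
  set z : H := ((‖x‖⁻¹ : ℝ) : ℂ) • x with hz
  have hz1 : ‖z‖ = 1 := by
    rw [hz, norm_smul, Complex.norm_real, norm_inv, norm_norm, inv_mul_cancel₀ hx0.ne']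
  have hz2 : σ ^ 2 - η ^ 2 / (2 * σ ^ 2) ≤ ‖X z‖ ^ 2 := by
    have h1 : ‖X x‖ ≤ ‖X z‖ := by
      rw [hz, map_smul, norm_smul, Complex.norm_real, norm_inv, norm_norm]
      exact le_mul_of_one_le_left (norm_nonneg _) ((one_le_inv₀ hx0).2 hx1.le)
    calc _ ≤ max 0 (σ ^ 2 - η ^ 2 / (2 * σ ^ 2)) := le_max_right _ _
      _ = √(max 0 (σ ^ 2 - η ^ 2 / (2 * σ ^ 2))) ^ 2 := (Real.sq_sqrt (le_max_left _ _)).symm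
      _ ≤ ‖X z‖ ^ 2 := pow_le_pow_left₀ (Real.sqrt_nonneg _) (hx2.le.trans h1) 2
  refine ⟨z, hz1, ?_⟩
  have h2 : ‖star X (X z) - ((σ ^ 2 : ℝ) : ℂ) • z‖ ^ 2
      = ‖star X (X z)‖ ^ 2 - 2 * σ ^ 2 * ‖X z‖ ^ 2 + σ ^ 4 := by
    rw [@norm_sub_sq ℂ, inner_smul_right, inner_star_left, inner_self_eq_norm_sq_to_K, norm_smul,
      hz1, Complex.norm_real]
    have : RCLike.re ((((σ ^ 2 : ℝ) : ℂ) * (RCLike.ofReal ‖X z‖ : ℂ) ^ 2)) = σ ^ 2 * ‖X z‖ ^ 2 := by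
      simp only [RCLike.re_eq_complex_re, Complex.coe_algebraMap]
      norm_cast
    rw [this]
    rw [Real.norm_of_nonneg (by positivity)]
    ring
  have h3 : ‖star X (X z)‖ ≤ σ * ‖X z‖ := by
    refine (ContinuousLinearMap.le_opNorm _ _).trans ?_
    rw [norm_star]
  have h4 : ‖star X (X z) - ((σ ^ 2 : ℝ) : ℂ) • z‖ ^ 2 ≤ η ^ 2 := by
    rw [h2]
    have h5 : ‖star X (X z)‖ ^ 2 ≤ σ ^ 2 * ‖X z‖ ^ 2 := by
      rw [← mul_pow]; exact pow_le_pow_left₀ (norm_nonneg _) h3 2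
    have h6 : σ ^ 2 * (σ ^ 2 - η ^ 2 / (2 * σ ^ 2)) = σ ^ 4 - η ^ 2 / 2 := by
      field_simp
    nlinarith [mul_le_mul_of_nonneg_left hz2 (sq_nonneg σ), sq_nonneg η]
  exact (pow_le_pow_iff_left₀ (norm_nonneg _) hη.le two_ne_zero).1 h4

/-- A norm estimate for the solution of a Sylvester equation. -/
theorem norm_le_of_sylvester_of_bddBelow {s u X Y Z : H →L[ℂ] H} (hs : IsSelfAdjoint s)
    (hu : IsSelfAdjoint u) (h : s * s * X + X * (u * u) = s * s * Y) (h' : s * s * Y = Z * (u * u))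
    {c : ℝ} (hc : 0 < c) (hcu : ∀ x, c * ‖x‖ ≤ ‖u x‖) :
    ‖X‖ ≤ √(‖Z‖ * ‖Y‖) / 2 := by
  set κ := √(‖Z‖ * ‖Y‖) with hκ
  have hκ0 : 0 ≤ κ := Real.sqrt_nonneg _
  by_contra! hlt
  have hσ : 0 < ‖X‖ := by linarith
  set σ := ‖X‖ with hσd
  have hgap : 0 < (σ - κ / 2) * c ^ 2 := mul_pos (by linarith) (by positivity)
  -- The error `‖u‖² η / σ` from an inexact singular vector must stay below the slack `(σ - κ/2)
  -- c²`, where `c² ≤ ‖u x‖²`.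
  obtain ⟨η, hη, hηlt⟩ : ∃ η : ℝ, 0 < η ∧ ‖u‖ ^ 2 * η / σ < (σ - κ / 2) * c ^ 2 := by
    refine ⟨(σ - κ / 2) * c ^ 2 * σ / (‖u‖ ^ 2 + 1), by positivity, ?_⟩
    rw [div_lt_iff₀ hσ, mul_div_assoc', div_lt_iff₀ (by positivity)]
    nlinarith [mul_pos hgap hσ]
  obtain ⟨x, hx, hxη⟩ := exists_near_norming X hσ hη
  set y : H := ((σ⁻¹ : ℝ) : ℂ) • X x with hy
  have hXx : X x = (σ : ℂ) • y := by
    rw [hy, smul_smul, ← Complex.ofReal_mul, mul_inv_cancel₀ hσ.ne']; simp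
  set v : H := star X y - (σ : ℂ) • x with hv
  have hvn : ‖v‖ ≤ η / σ := by
    have : v = ((σ⁻¹ : ℝ) : ℂ) • (star X (X x) - ((σ ^ 2 : ℝ) : ℂ) • x) := by
      rw [hv, hy, map_smul, smul_sub, smul_smul, ← Complex.ofReal_mul]
      congr 3
      field_simp
    rw [this, norm_smul, Complex.norm_real, norm_inv, Real.norm_of_nonneg hσ.le, inv_mul_eq_div]
    gcongr
  -- Test the equation on the approximate singular pair `x`, `y = X x / σ`: up to the error `v`, the
  -- left side becomes `σ (‖s y‖² + ‖u x‖²)`.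
  have e1 : (inner ℂ ((s * s * X + X * (u * u)) x) y : ℂ)
      = (σ : ℂ) * ((‖s y‖ ^ 2 : ℝ) : ℂ) + (σ : ℂ) * ((‖u x‖ ^ 2 : ℝ) : ℂ)
        + inner ℂ ((u * u) x) v := by
    have i1 : (inner ℂ ((s * s * X) x) y : ℂ) = (σ : ℂ) * ((‖s y‖ ^ 2 : ℝ) : ℂ) := by
      rw [mul_apply_eq_comp, hXx, map_smul, inner_smul_left, mul_apply_eq_comp,
        inner_apply_of_isSelfAdjoint hs, inner_self_eq_norm_sq_to_K, Complex.conj_ofReal]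
      simp
    have i2 : (inner ℂ ((X * (u * u)) x) y : ℂ) =
        (σ : ℂ) * ((‖u x‖ ^ 2 : ℝ) : ℂ) + inner ℂ ((u * u) x) v := by
      have : star X y = (σ : ℂ) • x + v := by rw [hv]; abel
      rw [mul_apply_eq_comp, ← inner_star_right, this, inner_add_right, inner_smul_right]
      congr 2
      rw [mul_apply_eq_comp, inner_apply_of_isSelfAdjoint hu, inner_self_eq_norm_sq_to_K]
      norm_cast
    rw [add_apply, inner_add_left, i1, i2]
    ring
  have e2 : ‖(inner ℂ ((s * s * X + X * (u * u)) x) y : ℂ)‖ ≤ κ * ‖u x‖ * ‖s y‖ := by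
    rw [h, mul_assoc, mul_apply_eq_comp, mul_apply_eq_comp, inner_apply_of_isSelfAdjoint hs]
    refine (norm_inner_le_norm _ _).trans ?_
    gcongr
    exact norm_apply_le_of_mul_eq_mul hs hu h' x
  have e3 : σ * ‖s y‖ ^ 2 + σ * ‖u x‖ ^ 2 ≤ κ * ‖u x‖ * ‖s y‖ + ‖u‖ ^ 2 * η / σ := by
    have i3 : ‖(inner ℂ ((u * u) x) v : ℂ)‖ ≤ ‖u‖ ^ 2 * η / σ := by
      refine (norm_inner_le_norm _ _).trans ?_
      have : ‖(u * u) x‖ ≤ ‖u‖ ^ 2 := by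
        refine (ContinuousLinearMap.le_opNorm _ _).trans ?_
        rw [hx, mul_one, sq]
        exact norm_mul_le _ _
      rw [mul_div_assoc]
      gcongr
    have i4 : ((σ * ‖s y‖ ^ 2 + σ * ‖u x‖ ^ 2 : ℝ) : ℂ)
        = (inner ℂ ((s * s * X + X * (u * u)) x) y : ℂ) - inner ℂ ((u * u) x) v := by
      rw [e1]; push_cast; ring
    have i5 : σ * ‖s y‖ ^ 2 + σ * ‖u x‖ ^ 2
        = ‖((σ * ‖s y‖ ^ 2 + σ * ‖u x‖ ^ 2 : ℝ) : ℂ)‖ := by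
      rw [Complex.norm_real, Real.norm_of_nonneg (by positivity)]
    rw [i5, i4]
    exact (norm_sub_le _ _).trans (add_le_add e2 i3)
  have e4 : c ^ 2 ≤ ‖u x‖ ^ 2 := by
    have := hcu x
    rw [hx, mul_one] at this
    exact pow_le_pow_left₀ hc.le this 2
  -- By `2 ‖u x‖ ‖s y‖ ≤ ‖u x‖² + ‖s y‖²`, the quantity `(σ - κ/2) ‖u x‖²` is at most the error,
  -- contrary to the choice of `η`.
  nlinarith [mul_nonneg hκ0 (sq_nonneg (‖u x‖ - ‖s y‖)), sq_nonneg ‖s y‖,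
    mul_nonneg (sub_nonneg.2 hlt.le) (sq_nonneg ‖s y‖),
    mul_le_mul_of_nonneg_left e4 (sub_nonneg.2 hlt.le)]

end Sylvester

/-! ### Functional calculus of families and compactness of solutions of Sylvester equations. -/

section Approximation

variable {H : Type*} [NormedAddCommGroup H] [InnerProductSpace ℂ H] [CompleteSpace H]

theorem tendsto_apply_of_denseRange {ι : Type*} {l : Filter ι} {M : ι → H →L[ℂ] H}
    {M₀ A : H →L[ℂ] H} {C : ℝ} (hC : ∀ i, ‖M i‖ ≤ C) (hA : DenseRange A)
    (hM : ∀ x, Tendsto (fun i => M i (A x)) l (𝓝 (M₀ (A x)))) (y : H) :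
    Tendsto (fun i => M i y) l (𝓝 (M₀ y)) := by
  rw [Metric.tendsto_nhds]
  intro ε hε
  set K := |C| + ‖M₀‖ + 1 with hK
  have hK0 : 0 < K := by positivity
  obtain ⟨x, hx⟩ := hA.exists_dist_lt y (ε := ε / (2 * K)) (by positivity)
  filter_upwards [Metric.tendsto_nhds.1 (hM x) (ε / 2) (by positivity)] with i hi
  rw [dist_eq_norm] at *
  have e : M i y - M₀ y = (M i - M₀) (y - A x) + (M i (A x) - M₀ (A x)) := by simp; abel
  have h3 : ‖M i - M₀‖ ≤ K := (norm_sub_le _ _).trans (by linarith [hC i, le_abs_self C])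
  rw [e]
  calc _ ≤ ‖(M i - M₀) (y - A x)‖ + ‖M i (A x) - M₀ (A x)‖ := norm_add_le _ _
    _ ≤ K * ‖y - A x‖ + ‖M i (A x) - M₀ (A x)‖ := by
      gcongr
      exact ContinuousLinearMap.le_of_opNorm_le _ h3 _
    _ < K * (ε / (2 * K)) + ε / 2 := by gcongr
    _ = ε := by field_simp; ring

theorem denseRange_of_isSelfAdjoint {A : H →L[ℂ] H} (hA : IsSelfAdjoint A)
    (hinj : Function.Injective A) : DenseRange A := by
  have h1 : (LinearMap.range (A : H →ₗ[ℂ] H))ᗮ = ⊥ := by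
    rw [Submodule.eq_bot_iff]
    intro x hx
    apply hinj
    rw [map_zero]
    have := (Submodule.mem_orthogonal _ _).1 hx (A (A x)) ⟨A x, rfl⟩
    rw [inner_apply_of_isSelfAdjoint hA] at this
    exact inner_self_eq_zero.1 this
  rw [← Submodule.topologicalClosure_eq_top_iff, ← Submodule.dense_iff_topologicalClosure_eq_top]
    at h1
  exact h1

theorem abs_le_of_mem_spectrum {A : H →L[ℂ] H} {C : ℝ} (hC : ‖A‖ ≤ C) {x : ℝ}
    (hx : x ∈ spectrum ℝ A) : x ∈ Icc (-C) C := by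
  have h1 := spectrum.norm_le_norm_mul_of_mem hx
  have h2 : ‖(1 : H →L[ℂ] H)‖ ≤ 1 := ContinuousLinearMap.norm_id_le
  have h3 : |x| ≤ C := by
    rw [← Real.norm_eq_abs]
    calc _ ≤ _ := h1
      _ ≤ ‖A‖ * 1 := by gcongr
      _ ≤ C := by linarith
  exact abs_le.1 h3

/-- Weierstrass approximation on `[-C, C]`; the point is that one polynomial serves every operator
of norm at most `C`, hence a whole bounded family. -/
theorem exists_polynomial_norm_cfc_sub_le {g : ℝ → ℝ} (hg : Continuous g) (C : ℝ) {ε : ℝ}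
    (hε : 0 < ε) : ∃ G : Polynomial ℝ, ∀ A : H →L[ℂ] H, IsSelfAdjoint A → ‖A‖ ≤ C →
      ‖cfc g A - Polynomial.aeval A G‖ ≤ ε := by
  obtain ⟨G, hG⟩ := exists_polynomial_near_of_continuousOn (-C) C g hg.continuousOn ε hε
  refine ⟨G, fun A hA hAC => ?_⟩
  rw [← cfc_polynomial G A, ← cfc_sub g (fun x => Polynomial.eval x G) A]
  refine norm_cfc_le hε.le fun x hx => ?_
  rw [Real.norm_eq_abs, abs_sub_comm]
  exact (hG x (abs_le_of_mem_spectrum hAC hx)).le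

variable {T : Type*} [TopologicalSpace T]

namespace StrongCont

theorem real_smul {M : T → H →L[ℂ] H} (hM : StrongCont M) (c : ℝ) :
    StrongCont (fun t => c • M t) := by
  simpa using hM.smul (c : ℂ)

theorem aeval {M : T → H →L[ℂ] H} (hM : StrongCont M) (G : Polynomial ℝ) :
    StrongCont (fun t => Polynomial.aeval (M t) G) := by
  induction G using Polynomial.induction_on' with
  | add p q hp hq => simpa using hp.add hq
  | monomial n a =>
    simp only [Polynomial.aeval_monomial, Algebra.algebraMap_eq_smul_one, smul_mul_assoc, one_mul]
    refine StrongCont.real_smul ?_ a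
    induction n with
    | zero => simpa using StrongCont.one
    | succ n ih => simpa [pow_succ] using ih.mul hM

theorem of_approx {M : T → H →L[ℂ] H} (h : ∀ ε > 0, ∃ N : T → H →L[ℂ] H, StrongCont N ∧
    ∀ t, ‖M t - N t‖ ≤ ε) : StrongCont M := by
  have key : ∀ M : T → H →L[ℂ] H, (∀ ε > 0, ∃ N : T → H →L[ℂ] H, StrongCont N ∧
      ∀ t, ‖M t - N t‖ ≤ ε) → ∀ x, Continuous fun t => M t x := by
    intro M h x
    refine continuous_of_uniform_approx_of_continuous fun u hu => ?_
    obtain ⟨ε, hε, hεu⟩ := Metric.mem_uniformity_dist.1 hu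
    obtain ⟨N, hN, hMN⟩ := h (ε / (‖x‖ + 1)) (by positivity)
    refine ⟨fun t => N t x, hN.cont x, fun t => hεu ?_⟩
    rw [dist_eq_norm, ← sub_apply]
    refine (ContinuousLinearMap.le_of_opNorm_le _ (hMN t) _).trans_lt ?_
    rw [div_mul_eq_mul_div, div_lt_iff₀ (by positivity)]
    nlinarith [norm_nonneg x]
  refine ⟨?_, key M h, ?_⟩
  · obtain ⟨N, hN, hMN⟩ := h 1 one_pos
    obtain ⟨C, hC⟩ := hN.bound
    refine ⟨1 + C, fun t => ?_⟩
    calc ‖M t‖ = ‖(M t - N t) + N t‖ := by rw [sub_add_cancel]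
      _ ≤ 1 + C := (norm_add_le _ _).trans (add_le_add (hMN t) (hC t))
  · refine key _ fun ε hε => ?_
    obtain ⟨N, hN, hMN⟩ := h ε hε
    exact ⟨fun t => Star.star (N t), hN.star, fun t => by rw [← star_sub, norm_star]; exact hMN t⟩

theorem cfc {M : T → H →L[ℂ] H} (hM : StrongCont M) (h : ∀ t, IsSelfAdjoint (M t)) {g : ℝ → ℝ}
    (hg : Continuous g) : StrongCont (fun t => cfc g (M t)) := by
  obtain ⟨C, hC⟩ := hM.bound
  refine of_approx fun ε hε => ?_
  obtain ⟨G, hG⟩ := exists_polynomial_norm_cfc_sub_le (H := H) hg C hε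
  exact ⟨_, hM.aeval G, fun t => hG _ (h t) (hC t)⟩

end StrongCont

/-- A continuous function that vanishes on `(-∞, δ]` and is equal to `1` on `[2δ, ∞)`. -/
noncomputable def cutoff (δ x : ℝ) : ℝ := max 0 (min 1 (x / δ - 1))

theorem continuous_cutoff (δ : ℝ) : Continuous (cutoff δ) := by
  unfold cutoff; fun_prop

theorem cutoff_nonneg (δ x : ℝ) : 0 ≤ cutoff δ x := le_max_left _ _

theorem cutoff_le_one (δ x : ℝ) : cutoff δ x ≤ 1 := max_le zero_le_one (min_le_left _ _)

theorem cutoff_eq_zero {δ x : ℝ} (hδ : 0 < δ) (hx : x ≤ δ) : cutoff δ x = 0 := by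
  refine max_eq_left ((min_le_right _ _).trans ?_)
  rw [sub_nonpos, div_le_one hδ]
  exact hx

theorem cutoff_eq_one {δ x : ℝ} (hδ : 0 < δ) (hx : 2 * δ ≤ x) : cutoff δ x = 1 := by
  have : 1 ≤ x / δ - 1 := by
    rw [le_sub_iff_add_le, le_div_iff₀ hδ]; linarith
  rw [cutoff, min_eq_left this]
  simp

theorem norm_cfc_cutoff_le (δ : ℝ) (A : H →L[ℂ] H) : ‖cfc (cutoff δ) A‖ ≤ 1 :=
  norm_cfc_le zero_le_one fun x _ => by
    rw [Real.norm_of_nonneg (cutoff_nonneg _ _)]; exact cutoff_le_one _ _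

/-- On the range of `q` the error is at most `2 δ ‖x‖`, and that range is dense because `q` is
selfadjoint and injective. -/
theorem tendsto_cutoff {q : H →L[ℂ] H} (hq : 0 ≤ q) (hinj : Function.Injective q) (y : H) :
    Tendsto (fun n : ℕ => cfc (cutoff (1 / ((n : ℝ) + 1))) q y) atTop (𝓝 y) := by
  have hsa : IsSelfAdjoint q := .of_nonneg hq
  refine tendsto_apply_of_denseRange (M := fun n : ℕ => cfc (cutoff (1 / ((n : ℝ) + 1))) q)
    (M₀ := 1) (C := 1) (fun n => norm_cfc_cutoff_le _ q)
    (denseRange_of_isSelfAdjoint hsa hinj) (fun x => ?_) y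
  rw [tendsto_iff_norm_sub_tendsto_zero]
  have h1 : Tendsto (fun n : ℕ => 2 * (1 / ((n : ℝ) + 1)) * ‖x‖) atTop (𝓝 0) := by
    simpa using (tendsto_one_div_add_atTop_nhds_zero_nat.const_mul 2).mul_const ‖x‖
  refine squeeze_zero (fun _ => norm_nonneg _) (fun n => ?_) h1
  set δ : ℝ := 1 / ((n : ℝ) + 1) with hδd
  have hδ : 0 < δ := by positivity
  have e : cfc (cutoff δ) q (q x) - (1 : H →L[ℂ] H) (q x)
      = (cfc (fun y => cutoff δ y * y - y) q) x := by
    rw [cfc_sub _ _ q (by have := continuous_cutoff δ; fun_prop) (by fun_prop),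
      cfc_mul _ _ q (continuous_cutoff δ).continuousOn (by fun_prop), cfc_id' ℝ q]
    simp [mul_apply_eq_comp]
  rw [e]
  refine ContinuousLinearMap.le_of_opNorm_le _ (norm_cfc_le (by positivity) fun y hy => ?_) _
  have hy0 : 0 ≤ y := spectrum_nonneg_of_nonneg hq hy
  rw [Real.norm_eq_abs]
  rcases le_total (2 * δ) y with h | h
  · rw [cutoff_eq_one hδ h]; simp; positivity
  · rw [abs_le]
    constructor <;> nlinarith [cutoff_nonneg δ y, cutoff_le_one δ y]

/-- Removes the lower bound on `q`: after multiplication by `cutoff δ` of `q` on the right, `q` may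
be replaced by `max q δ`. The bound does not depend on `δ`, and the cut-offs tend strongly to `1`.
-/
theorem norm_le_of_sylvester {p q X Y Z : H →L[ℂ] H} (hp : 0 ≤ p) (hq : 0 ≤ q)
    (hinj : Function.Injective q) (h : p * X + X * q = p * Y) (h' : p * Y = Z * q) :
    ‖X‖ ≤ √(‖Z‖ * ‖Y‖) / 2 := by
  have hsa : IsSelfAdjoint q := .of_nonneg hq
  set s := CFC.sqrt p with hs
  have hss : s * s = p := CFC.sqrt_mul_sqrt_self p hp
  have key : ∀ δ > 0, ‖X * cfc (cutoff δ) q‖ ≤ √(‖Z‖ * ‖Y‖) / 2 := by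
    intro δ hδ
    set e := cfc (cutoff δ) q with he
    set u := cfc (fun x => √(max x δ)) q with hu
    have hcont : Continuous fun x : ℝ => √(max x δ) := by fun_prop
    have hpos : ∀ x : ℝ, 0 < √(max x δ) := fun x => Real.sqrt_pos.2 (lt_max_of_lt_right hδ)
    have hcu := (continuous_cutoff δ)
    have huu : e * (u * u) = e * q := by
      conv_rhs => rw [← cfc_id' ℝ q]
      rw [he, hu, ← cfc_mul _ _ q, ← cfc_mul _ _ q, ← cfc_mul _ _ q]
      refine cfc_congr fun x _ => ?_
      rw [Real.mul_self_sqrt (le_max_of_le_right hδ.le)]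
      rcases le_total x δ with hx | hx
      · rw [cutoff_eq_zero hδ hx]; simp
      · rw [max_eq_left hx]
    have hqe : q * e = e * q := (IsSelfAdjoint.commute_cfc hsa (Commute.refl q) _).eq.symm
    have hbdd : ∃ c : ℝ, 0 < c ∧ ∀ x, c * ‖x‖ ≤ ‖u x‖ := by
      set v := cfc (fun x => (√(max x δ))⁻¹) q with hv
      have hvu : v * u = 1 := by
        rw [hv, hu, ← cfc_mul _ _ q (by
          exact (hcont.inv₀ fun x => (hpos x).ne').continuousOn), ← cfc_one ℝ q]
        refine cfc_congr fun x _ => ?_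
        simp [(hpos x).ne']
      refine ⟨(‖v‖ + 1)⁻¹, by positivity, fun x => ?_⟩
      rw [inv_mul_le_iff₀ (by positivity)]
      calc ‖x‖ = ‖(v * u) x‖ := by rw [hvu]; simp
        _ ≤ ‖v‖ * ‖u x‖ := v.le_opNorm _
        _ ≤ (‖v‖ + 1) * ‖u x‖ := by gcongr; linarith
    obtain ⟨c, hc, hcu⟩ := hbdd
    have e1 : s * s * (X * e) + X * e * (u * u) = s * s * (Y * e) := by
      rw [hss, mul_assoc X, huu, ← hqe, ← mul_assoc, ← mul_assoc, ← mul_assoc, ← add_mul, h]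
    have e2 : s * s * (Y * e) = Z * e * (u * u) := by
      rw [hss, mul_assoc Z, huu, ← hqe, ← mul_assoc, ← mul_assoc, h']
    have := norm_le_of_sylvester_of_bddBelow (IsSelfAdjoint.of_nonneg (CFC.sqrt_nonneg p))
      (cfc_predicate _ q) e1 e2 hc hcu
    refine this.trans ?_
    have he1 : ‖e‖ ≤ 1 := norm_cfc_cutoff_le _ q
    have hle : ∀ A : H →L[ℂ] H, ‖A * e‖ ≤ ‖A‖ := fun A =>
      (norm_mul_le _ _).trans (mul_le_of_le_one_right (norm_nonneg _) he1)
    gcongr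
    · exact hle Z
    · exact hle Y
  refine ContinuousLinearMap.opNorm_le_bound _ (by positivity) fun x => ?_
  have h1 := ((X.continuous.tendsto x).comp (tendsto_cutoff hq hinj x)).norm
  refine le_of_tendsto h1 (Eventually.of_forall fun n => ?_)
  exact ContinuousLinearMap.le_of_opNorm_le _ (key _ (by positivity)) x

/-- If `p X + X q` is compact, then so is `X g(q)`, for functions `g` that vanish on the spectrum
of `- p`. -/
theorem CompactCont.mul_cfc {p q X : T → H →L[ℂ] H} (hp : StrongCont p) (hq : StrongCont q)
    (hX : StrongCont X) (hp0 : ∀ t, 0 ≤ p t) (hq0 : ∀ t, 0 ≤ q t)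
    (h : CompactCont fun t => p t * X t + X t * q t) {g : ℝ → ℝ} (hg : Continuous g)
    (hg0 : ∀ x ≤ 0, g x = 0) : CompactCont fun t => X t * cfc g (q t) := by
  have hqs : ∀ t, IsSelfAdjoint (q t) := fun t => .of_nonneg (hq0 t)
  have hps : ∀ t, IsSelfAdjoint (p t) := fun t => .of_nonneg (hp0 t)
  -- Modulo compact families `X q = - p X`, hence `X G(q) = G(-p) X` for polynomials `G`, and in the
  -- limit for `g`. But `g(-p) = 0`, since the spectrum of `-p` lies in `(-∞, 0]`.
  have hpow : ∀ n : ℕ, CompactCont fun t => X t * q t ^ n - (-p t) ^ n * X t := by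
    intro n
    induction n with
    | zero => simpa using CompactCont.zero
    | succ n ih =>
      have hn : StrongCont fun t => (-p t) ^ n := by
        simpa using hp.neg.aeval (Polynomial.X ^ n)
      convert (ih.mul_right hq).add (h.mul_left hn) using 2 with t
      rw [pow_succ, pow_succ]
      noncomm_ring
  have hpoly : ∀ G : Polynomial ℝ, CompactCont fun t =>
      X t * Polynomial.aeval (q t) G - Polynomial.aeval (-p t) G * X t := by
    intro G
    induction G using Polynomial.induction_on' with
    | add a b ha hb =>
      convert ha.add hb using 2 with t
      simp only [map_add]
      noncomm_ring
    | monomial n a =>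
      convert (hpow n).smul (a : ℂ) using 2 with t
      simp only [Polynomial.aeval_monomial, Algebra.algebraMap_eq_smul_one, smul_mul_assoc, one_mul,
        mul_smul_comm, smul_sub]
      norm_cast
  obtain ⟨C, hC⟩ := hq.bound
  obtain ⟨C', hC'⟩ := hp.bound
  obtain ⟨L, hL⟩ := hX.bound
  refine CompactCont.of_approx fun t₀ ε hε => ?_
  have hL0 : 0 ≤ L := (norm_nonneg _).trans (hL t₀)
  obtain ⟨G, hG⟩ := exists_polynomial_norm_cfc_sub_le (H := H) hg (max C C')
    (ε := ε / (2 * (L + 1))) (by positivity)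
  refine ⟨_, hpoly G, Eventually.of_forall fun t => ?_⟩
  have h0 : cfc g (-p t) = 0 := by
    rw [← cfc_zero ℝ (-p t)]
    refine cfc_congr fun x hx => hg0 x ?_
    rw [← spectrum.neg_eq, Set.mem_neg] at hx
    have := spectrum_nonneg_of_nonneg (hp0 t) hx
    linarith
  have e : X t * cfc g (q t) - (X t * Polynomial.aeval (q t) G - Polynomial.aeval (-p t) G * X t)
      = X t * (cfc g (q t) - Polynomial.aeval (q t) G)
        - (cfc g (-p t) - Polynomial.aeval (-p t) G) * X t := by
    rw [h0]; noncomm_ring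
  have h1 := hG (q t) (hqs t) ((hC t).trans (le_max_left _ _))
  have h2 := hG (-p t) (hps t).neg (by rw [norm_neg]; exact (hC' t).trans (le_max_right _ _))
  rw [e]
  calc _ ≤ ‖X t‖ * ‖cfc g (q t) - Polynomial.aeval (q t) G‖ +
        ‖cfc g (-p t) - Polynomial.aeval (-p t) G‖ * ‖X t‖ :=
        (norm_sub_le _ _).trans (add_le_add (norm_mul_le _ _) (norm_mul_le _ _))
    _ ≤ L * (ε / (2 * (L + 1))) + (ε / (2 * (L + 1))) * L := by
      gcongr
      · exact hL t
      · exact hL t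
    _ = ε * (L / (L + 1)) := by field_simp; ring
    _ ≤ ε := mul_le_of_le_one_right hε.le (by rw [div_le_one (by positivity)]; linarith)

/-- The part of `X` where `p` is bounded away from `0` is compact by `CompactCont.mul_cfc`. The
complementary cut-off `f` commutes with `p`, so `f X` solves the equation with data `f Y`, `f Z`.
Since `f → 0` strongly and `Y` is compact, `f Y` becomes small in norm, and `norm_le_of_sylvester`
makes `f X` small. -/
theorem CompactCont.of_sylvester {p q X Y Z : T → H →L[ℂ] H} (hp : StrongCont p)
    (hq : StrongCont q) (hX : StrongCont X) (hY : CompactCont Y) (hZ : CompactCont Z)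
    (hp0 : ∀ t, 0 ≤ p t) (hq0 : ∀ t, 0 ≤ q t) (hpi : ∀ t, Function.Injective (p t))
    (hqi : ∀ t, Function.Injective (q t)) (h : ∀ t, p t * X t + X t * q t = p t * Y t)
    (h' : ∀ t, p t * Y t = Z t * q t) : CompactCont X := by
  have hqs : ∀ t, IsSelfAdjoint (q t) := fun t => .of_nonneg (hq0 t)
  have hps : ∀ t, IsSelfAdjoint (p t) := fun t => .of_nonneg (hp0 t)
  -- Taking adjoints exchanges the roles of `p` and `q`, so that the cut-off can be put on the side
  -- of `p`.
  have hW : CompactCont fun t => q t * Star.star (X t) + Star.star (X t) * p t := by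
    convert (hY.mul_left hp).star using 2 with t
    rw [← h, star_add, star_mul, star_mul, (hps t).star_eq, (hqs t).star_eq, add_comm]
  have hE : ∀ δ > 0, CompactCont fun t => cfc (cutoff δ) (p t) * X t := by
    intro δ hδ
    convert (CompactCont.mul_cfc hq hp hX.star hq0 hp0 hW (continuous_cutoff δ)
      fun x hx => cutoff_eq_zero hδ (hx.trans hδ.le)).star using 2 with t
    rw [star_mul, star_star, (cfc_predicate (cutoff δ) (p t) : IsSelfAdjoint _).star_eq]
  refine CompactCont.of_approx fun t₀ ε hε => ?_
  set L := ‖Z t₀‖ + 1 with hL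
  have hL0 : 0 < L := by positivity
  have h1 : Tendsto (fun n : ℕ => (1 - cfc (cutoff (1 / ((n : ℝ) + 1))) (p t₀)) * Y t₀) atTop
      (𝓝 (0 * Y t₀)) := by
    refine tendsto_mul_of_isCompactOperator (C := 2) (fun n => ?_) (fun x => ?_) (hY.compact t₀)
    · have h2 : ‖(1 : H →L[ℂ] H)‖ ≤ 1 := ContinuousLinearMap.norm_id_le
      exact (norm_sub_le _ _).trans (by linarith [norm_cfc_cutoff_le (1 / ((n : ℝ) + 1)) (p t₀)])
    · simpa using (tendsto_const_nhds (x := x)).sub (tendsto_cutoff (hp0 t₀) (hpi t₀) x)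
  rw [zero_mul, tendsto_zero_iff_norm_tendsto_zero] at h1
  have hb : 0 < ε ^ 2 / L := by positivity
  obtain ⟨n, hn⟩ := (h1.eventually (gt_mem_nhds hb)).exists
  set δ : ℝ := 1 / ((n : ℝ) + 1) with hδd
  have hδ : 0 < δ := by positivity
  refine ⟨_, hE δ hδ, ?_⟩
  have hF : StrongCont fun t => 1 - cfc (cutoff δ) (p t) :=
    StrongCont.one.sub (hp.cfc hps (continuous_cutoff δ))
  have hFY := ((hY.mul_left hF).cont.norm.tendsto t₀).eventually (gt_mem_nhds hn)
  have hZ0 : ‖Z t₀‖ < L := by rw [hL]; linarith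
  have hZL := (hZ.cont.norm.tendsto t₀).eventually (gt_mem_nhds hZ0)
  filter_upwards [hFY, hZL] with t ht ht'
  set f := 1 - cfc (cutoff δ) (p t) with hf
  have hfp : f * p t = p t * f := by
    rw [hf, sub_mul, mul_sub, one_mul, mul_one,
      (IsSelfAdjoint.commute_cfc (hps t) (Commute.refl (p t)) _).eq]
  have hf1 : ‖f‖ ≤ 1 := by
    have : f = cfc (fun x => 1 - cutoff δ x) (p t) := by
      rw [cfc_sub _ _ (p t) (by fun_prop) (continuous_cutoff δ).continuousOn, cfc_const_one ℝ (p t)]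
    rw [this]
    refine norm_cfc_le zero_le_one fun x _ => ?_
    rw [Real.norm_eq_abs, abs_le]
    constructor <;> linarith [cutoff_nonneg δ x, cutoff_le_one δ x]
  have e : X t - cfc (cutoff δ) (p t) * X t = f * X t := by rw [hf]; noncomm_ring
  rw [e]
  have e1 : p t * (f * X t) + f * X t * q t = p t * (f * Y t) := by
    rw [← mul_assoc, ← hfp, mul_assoc, mul_assoc, ← mul_add, h, ← mul_assoc, hfp, mul_assoc]
  have e2 : p t * (f * Y t) = f * Z t * q t := by
    rw [← mul_assoc, ← hfp, mul_assoc, mul_assoc, h']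
  refine (norm_le_of_sylvester (hp0 t) (hq0 t) (hqi t) e1 e2).trans ?_
  have h3 : ‖f * Z t‖ * ‖f * Y t‖ ≤ ε ^ 2 := by
    calc _ ≤ L * (ε ^ 2 / L) := by
          gcongr
          refine (norm_mul_le _ _).trans ?_
          nlinarith [norm_nonneg (Z t), norm_nonneg f]
      _ = ε ^ 2 := by field_simp
  have h4 : √(‖f * Z t‖ * ‖f * Y t‖) ≤ ε := by
    rw [← Real.sqrt_sq hε.le]; exact Real.sqrt_le_sqrt h3
  linarith

end Approximation

/-! ### Positive projections of bounded selfadjoint operators. -/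

section PositiveProjection

variable {H : Type*} [NormedAddCommGroup H] [InnerProductSpace ℂ H] [CompleteSpace H]

/-- `P` is an orthogonal projection onto an invariant subspace of `R` on which `R` is nonnegative,
and `R` is nonpositive on the complement. -/
structure IsPosProj (R P : H →L[ℂ] H) : Prop where
  proj : IsStarProjection P
  comm : Commute P R
  nonneg : 0 ≤ P * R
  nonpos : 0 ≤ (P - 1) * R

namespace IsPosProj

variable {R P : H →L[ℂ] H}

theorem nonneg_abs (h : IsPosProj R P) : 0 ≤ R * (2 * P - 1) := by
  have := add_nonneg h.nonneg h.nonpos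
  have e : P * R + (P - 1) * R = R * (2 * P - 1) := by
    rw [sub_mul, h.comm.eq, two_mul, mul_sub, mul_add, one_mul, mul_one]; abel
  rwa [e] at this

theorem abs_eq (h : IsPosProj R P) (hR : IsSelfAdjoint R) :
    R * (2 * P - 1) = cfc (fun x : ℝ => ‖x‖) R := by
  rw [← CFC.abs_eq_cfc_norm R hR, CFC.abs]
  refine (CFC.sqrt_unique ?_ h.nonneg_abs).symm
  have h1 : R * (2 * P - 1) = (2 * P - 1) * R := by
    rw [mul_sub, sub_mul, two_mul, mul_add, add_mul, h.comm.eq]; simp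
  have h2 : (2 * P - 1) * (2 * P - 1) = 1 := by
    have := h.proj.isIdempotentElem.eq
    have e : (2 * P - 1) * (2 * P - 1) = 4 * (P * P) - 4 * P + 1 := by noncomm_ring
    rw [e, this]; noncomm_ring
  rw [hR.star_eq]
  calc R * (2 * P - 1) * (R * (2 * P - 1)) = R * ((2 * P - 1) * R) * (2 * P - 1) := by noncomm_ring
    _ = R * R * ((2 * P - 1) * (2 * P - 1)) := by rw [← h1]; noncomm_ring
    _ = R * R := by rw [h2, mul_one]

/-- `P` need not be a continuous function of `R`, but `P R` is its positive part `(R + |R|) / 2`, to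
which the continuous functional calculus applies. -/
theorem mul_eq (h : IsPosProj R P) (hR : IsSelfAdjoint R) :
    P * R = (1 / 2 : ℝ) • (R + cfc (fun x : ℝ => ‖x‖) R) := by
  rw [← h.abs_eq hR, h.comm.eq]
  have : R + R * (2 * P - 1) = (2 : ℝ) • (R * P) := by
    rw [two_smul, two_mul, mul_sub, mul_add, mul_one]; abel
  rw [this, smul_smul]; norm_num

theorem injective_abs (h : IsPosProj R P) (hi : Function.Injective R) :
    Function.Injective (R * (2 * P - 1) : H →L[ℂ] H) := by
  have h2 : (2 * P - 1) * (2 * P - 1) = 1 := by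
    have := h.proj.isIdempotentElem.eq
    have e : (2 * P - 1) * (2 * P - 1) = 4 * (P * P) - 4 * P + 1 := by noncomm_ring
    rw [e, this]; noncomm_ring
  intro x y hxy
  rw [mul_apply_eq_comp, mul_apply_eq_comp] at hxy
  have := congr((2 * P - 1) $(hi hxy))
  rw [← mul_apply_eq_comp, ← mul_apply_eq_comp, h2] at this
  simpa using this

variable {T : Type*} [TopologicalSpace T] {R P S Q Y Z : T → H →L[ℂ] H}

theorem _root_.IsStarProjection.norm_le_one {P : H →L[ℂ] H} (h : IsStarProjection P) :
    ‖P‖ ≤ 1 := by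
  have h1 : ‖P‖ * ‖P‖ = ‖P‖ := by
    rw [← CStarRing.norm_star_mul_self, h.isSelfAdjoint.star_eq, h.isIdempotentElem.eq]
  nlinarith [norm_nonneg P]

/-- `P_t R_t` is strongly continuous as a continuous function of `R_t`. Replacing `R_t` by `R_{t₀}`
costs `‖R_t x - R_{t₀} x‖`, and `R_{t₀}` has dense range. -/
theorem strongCont (h : ∀ t, IsPosProj (R t) (P t)) (hR : StrongCont R)
    (hRs : ∀ t, IsSelfAdjoint (R t)) (hi : ∀ t, Function.Injective (R t)) : StrongCont P := by
  have hPR : StrongCont fun t => P t * R t := by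
    simp only [fun t => (h t).mul_eq (hRs t)]
    exact (hR.add (hR.cfc hRs continuous_norm)).real_smul _
  refine StrongCont.of_isSelfAdjoint (fun t => (h t).proj.norm_le_one) (fun x => ?_)
    fun t => (h t).proj.isSelfAdjoint
  rw [continuous_iff_continuousAt]
  intro t₀
  refine tendsto_apply_of_denseRange (fun t => (h t).proj.norm_le_one)
    (denseRange_of_isSelfAdjoint (hRs t₀) (hi t₀)) (fun x => ?_) x
  have h1 : Tendsto (fun t => P t (R t x - R t₀ x)) (𝓝 t₀) (𝓝 0) := by
    rw [tendsto_zero_iff_norm_tendsto_zero]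
    refine squeeze_zero (fun _ => norm_nonneg _) (fun t => ?_)
      (tendsto_iff_norm_sub_tendsto_zero.1 ((hR.cont x).tendsto t₀))
    simpa using ContinuousLinearMap.le_of_opNorm_le _ (h t).proj.norm_le_one (R t x - R t₀ x)
  have h2 := ((hPR.cont x).tendsto t₀).sub h1
  simpa [mul_apply_eq_comp] using h2

/-- Write `P - Q = (1 - Q) P - Q (1 - P)`. As `Q` commutes with `S` and `P` with `R`, the term `X =
(1 - Q) P` satisfies `|S| X + X |R| = -(1 - Q) (S - R) P`, and `X = Q (1 - P)` satisfies `|S| X + X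
|R| = Q (S - R) (1 - P)`. The two factorisations of `S - R` supply the two forms of the right side
that `CompactCont.of_sylvester` needs. -/
theorem compactCont_sub (hP : ∀ t, IsPosProj (R t) (P t)) (hQ : ∀ t, IsPosProj (S t) (Q t))
    (hR : StrongCont R) (hS : StrongCont S) (hRs : ∀ t, IsSelfAdjoint (R t))
    (hSs : ∀ t, IsSelfAdjoint (S t)) (hRi : ∀ t, Function.Injective (R t))
    (hSi : ∀ t, Function.Injective (S t)) (hY : CompactCont Y) (hZ : CompactCont Z)
    (h : ∀ t, S t - R t = S t * Y t) (h' : ∀ t, S t - R t = Z t * R t) :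
    CompactCont fun t => P t - Q t := by
  have cP := strongCont hP hR hRs hRi
  have cQ := strongCont hQ hS hSs hSi
  have cP' : StrongCont fun t => 1 - P t := StrongCont.one.sub cP
  have cQ' : StrongCont fun t => 1 - Q t := StrongCont.one.sub cQ
  have cp : StrongCont fun t => S t * (2 * Q t - 1) := by
    simp only [fun t => (hQ t).abs_eq (hSs t)]
    exact hS.cfc hSs continuous_norm
  have cq : StrongCont fun t => R t * (2 * P t - 1) := by
    simp only [fun t => (hP t).abs_eq (hRs t)]
    exact hR.cfc hRs continuous_norm
  have hPP : ∀ t, P t * P t = P t := fun t => (hP t).proj.isIdempotentElem.eq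
  have hQQ : ∀ t, Q t * Q t = Q t := fun t => (hQ t).proj.isIdempotentElem.eq
  have hPR : ∀ t, P t * R t = R t * P t := fun t => (hP t).comm.eq
  have p1 : ∀ t, S t * (2 * Q t - 1) * (1 - Q t) = - (S t * (1 - Q t)) := fun t => by
    have : S t * (2 * Q t - 1) * (1 - Q t) = S t * (3 * Q t - 2 * (Q t * Q t) - 1) := by
      noncomm_ring
    rw [this, hQQ]; noncomm_ring
  have p2 : ∀ t, S t * (2 * Q t - 1) * Q t = S t * Q t := fun t => by
    have : S t * (2 * Q t - 1) * Q t = S t * (2 * (Q t * Q t) - Q t) := by noncomm_ring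
    rw [this, hQQ]; noncomm_ring
  have q1 : ∀ t, P t * (R t * (2 * P t - 1)) = R t * P t := fun t => by
    have : R t * P t * (2 * P t - 1) = R t * (2 * (P t * P t) - P t) := by noncomm_ring
    rw [← mul_assoc, hPR, this, hPP]; noncomm_ring
  have q2 : ∀ t, (1 - P t) * (R t * (2 * P t - 1)) = - (R t * (1 - P t)) := fun t => by
    rw [sub_mul, q1]; noncomm_ring
  have hQS : ∀ t, Q t * S t = S t * Q t := fun t => (hQ t).comm.eq
  have X1 : CompactCont fun t => (1 - Q t) * P t := by
    refine CompactCont.of_sylvester cp cq (cQ'.mul cP)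
      (Y := fun t => (1 - Q t) * Y t * P t) (Z := fun t => - ((1 - Q t) * Z t * P t))
      ((hY.mul_left cQ').mul_right cP) ((hZ.mul_left cQ').mul_right cP).neg
      (fun t => (hQ t).nonneg_abs) (fun t => (hP t).nonneg_abs)
      (fun t => (hQ t).injective_abs (hSi t)) (fun t => (hP t).injective_abs (hRi t))
      (fun t => ?_) fun t => ?_
    · have e1 : S t * (2 * Q t - 1) * ((1 - Q t) * Y t * P t)
          = S t * (2 * Q t - 1) * (1 - Q t) * Y t * P t := by noncomm_ring
      have e2 : - (S t * (1 - Q t)) * Y t * P t = - ((1 - Q t) * (S t * Y t) * P t) := by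
        rw [mul_sub, ← hQS]; noncomm_ring
      rw [← mul_assoc, p1, mul_assoc (1 - Q t), q1, e1, p1, e2, ← h t]
      rw [mul_sub, ← hQS]
      have : (1 - Q t) * (S t - R t) * P t
        = S t * P t - Q t * S t * P t - (1 - Q t) * (R t * P t) := by noncomm_ring
      rw [this]; noncomm_ring
    · have e1 : S t * (2 * Q t - 1) * ((1 - Q t) * Y t * P t)
          = S t * (2 * Q t - 1) * (1 - Q t) * Y t * P t := by noncomm_ring
      have e2 : - (S t * (1 - Q t)) * Y t * P t = - ((1 - Q t) * (S t * Y t) * P t) := by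
        rw [mul_sub, ← hQS]; noncomm_ring
      rw [e1, p1, e2, ← h, h', neg_mul, mul_assoc _ (P t), q1, ← mul_assoc, mul_assoc _ (R t),
        ← hPR]
  have X2 : CompactCont fun t => Q t * (1 - P t) := by
    refine CompactCont.of_sylvester cp cq (cQ.mul cP')
      (Y := fun t => Q t * Y t * (1 - P t)) (Z := fun t => - (Q t * Z t * (1 - P t)))
      ((hY.mul_left cQ).mul_right cP') ((hZ.mul_left cQ).mul_right cP').neg
      (fun t => (hQ t).nonneg_abs) (fun t => (hP t).nonneg_abs)
      (fun t => (hQ t).injective_abs (hSi t)) (fun t => (hP t).injective_abs (hRi t))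
      (fun t => ?_) fun t => ?_
    · have e1 : S t * (2 * Q t - 1) * (Q t * Y t * (1 - P t))
          = S t * (2 * Q t - 1) * Q t * Y t * (1 - P t) := by noncomm_ring
      have e2 : S t * Q t * Y t * (1 - P t) = Q t * (S t * Y t) * (1 - P t) := by
        rw [← hQS]; noncomm_ring
      rw [← mul_assoc, p2, mul_assoc (Q t), q2, e1, p2, e2, ← h t, ← hQS]
      noncomm_ring
    · have e1 : S t * (2 * Q t - 1) * (Q t * Y t * (1 - P t))
          = S t * (2 * Q t - 1) * Q t * Y t * (1 - P t) := by noncomm_ring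
      have e2 : S t * Q t * Y t * (1 - P t) = Q t * (S t * Y t) * (1 - P t) := by
        rw [← hQS]; noncomm_ring
      rw [e1, p2, e2, ← h, h', neg_mul, mul_assoc _ (1 - P t), q2]
      noncomm_ring
  convert X1.sub X2 using 2 with t
  noncomm_ring

end IsPosProj

end PositiveProjection

/-! ### An index formula in linear algebra. -/

section LinearAlgebra

variable {𝕜 M N N₁ : Type*} [Field 𝕜] [AddCommGroup M] [Module 𝕜 M] [AddCommGroup N] [Module 𝕜 N]
  [AddCommGroup N₁] [Module 𝕜 N₁]

/-- The index of a linear map `f` that has a bijective compression with finite defects. -/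
theorem finrank_ker_sub_finrank_coker (f : M →ₗ[𝕜] N) (p : N →ₗ[𝕜] N₁) {M₁ M₀ : Submodule 𝕜 M}
    (hM : IsCompl M₁ M₀) [FiniteDimensional 𝕜 M₀] [FiniteDimensional 𝕜 (LinearMap.ker p)]
    (hbij : Function.Bijective fun x : M₁ => p (f x)) :
    (Module.finrank 𝕜 (LinearMap.ker f) : ℤ) - Module.finrank 𝕜 (N ⧸ LinearMap.range f)
      = Module.finrank 𝕜 M₀ - Module.finrank 𝕜 (LinearMap.ker p) := by
  set G := LinearMap.ker (p ∘ₗ f) with hG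
  have hMG : IsCompl M₁ G := by
    constructor
    · rw [Submodule.disjoint_def]
      intro x hx hxG
      have : (⟨x, hx⟩ : M₁) = 0 := by
        apply hbij.1
        simpa [hG] using hxG
      exact congrArg Subtype.val this
    · rw [codisjoint_iff, eq_top_iff]
      intro x _
      obtain ⟨y, hy⟩ := hbij.2 (p (f x))
      refine Submodule.mem_sup.2 ⟨y, y.2, x - y, ?_, by abel⟩
      simp only at hy
      rw [hG, LinearMap.mem_ker, LinearMap.comp_apply, map_sub, map_sub, hy, sub_self]
  -- `M₀` and `G` are both complements of `M₁`, hence both isomorphic to the quotient by `M₁`.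
  let e : M₀ ≃ₗ[𝕜] G := (Submodule.quotientEquivOfIsCompl M₁ M₀ hM).symm.trans
    (Submodule.quotientEquivOfIsCompl M₁ G hMG)
  have : FiniteDimensional 𝕜 G := e.finiteDimensional
  have hfG : ∀ x ∈ G, f x ∈ LinearMap.ker p := fun x hx => hx
  -- The restriction `g` of `f` has the same kernel and cokernel as `f` but acts between
  -- finite-dimensional spaces, so its index is the difference of their dimensions.
  let g : G →ₗ[𝕜] LinearMap.ker p := f.restrict hfG
  have h1 : Module.finrank 𝕜 (LinearMap.ker g) = Module.finrank 𝕜 (LinearMap.ker f) := by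
    have hle : LinearMap.ker f ≤ G := by
      intro x hx
      rw [LinearMap.mem_ker] at hx
      rw [hG, LinearMap.mem_ker, LinearMap.comp_apply, hx, map_zero]
    have : LinearMap.ker g = (LinearMap.ker f).comap G.subtype := by
      ext x
      simp [g, Subtype.ext_iff]
    rw [this]
    exact (Submodule.comapSubtypeEquivOfLe hle).finrank_eq
  let π : LinearMap.ker p →ₗ[𝕜] N ⧸ LinearMap.range f :=
    (LinearMap.range f).mkQ ∘ₗ (LinearMap.ker p).subtype
  have hπ : LinearMap.range π = ⊤ := by
    rw [LinearMap.range_eq_top]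
    intro y
    obtain ⟨n, rfl⟩ := Submodule.mkQ_surjective _ y
    obtain ⟨x, hx⟩ := hbij.2 (p n)
    simp only at hx
    refine ⟨⟨n - f x, by rw [LinearMap.mem_ker, map_sub, hx, sub_self]⟩, ?_⟩
    simp only [π, LinearMap.comp_apply, Submodule.subtype_apply, map_sub]
    rw [sub_eq_self, Submodule.mkQ_apply, Submodule.Quotient.mk_eq_zero]
    exact ⟨x, rfl⟩
  have hker : LinearMap.ker π = LinearMap.range g := by
    ext y
    simp only [π, LinearMap.mem_ker, LinearMap.comp_apply, Submodule.subtype_apply,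
      Submodule.mkQ_apply, Submodule.Quotient.mk_eq_zero, LinearMap.mem_range]
    constructor
    · rintro ⟨x, hx⟩
      have : x ∈ G := by
        rw [hG, LinearMap.mem_ker, LinearMap.comp_apply, hx]; exact y.2
      exact ⟨⟨x, this⟩, Subtype.ext hx⟩
    · rintro ⟨x, rfl⟩
      exact ⟨x, rfl⟩
  have r1 := LinearMap.finrank_range_add_finrank_ker π
  have r2 := LinearMap.finrank_range_add_finrank_ker g
  rw [hπ, finrank_top, hker] at r1
  rw [h1] at r2
  have r3 := e.finrank_eq
  omega

theorem hasNoetherianRange_of_forall_mem {S : Submodule 𝕜 N} (f : M →ₗ[𝕜] S) (W : Submodule 𝕜 N)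
    [FiniteDimensional 𝕜 W] (h : ∀ x, (f x : N) ∈ W) : f.HasNoetherianRange := by
  have hle : Submodule.map S.subtype (LinearMap.range f) ≤ W := by
    rintro _ ⟨_, ⟨x, rfl⟩, rfl⟩
    exact h x
  have : FiniteDimensional 𝕜 (Submodule.map S.subtype (LinearMap.range f)) :=
    Submodule.finiteDimensional_of_le hle
  exact isNoetherian_of_linearEquiv
    (Submodule.equivMapOfInjective S.subtype S.injective_subtype (LinearMap.range f)).symm

end LinearAlgebra

/-! ### Pairs of projections with finite rank defects. -/

section PairIndex

variable {H : Type*} [NormedAddCommGroup H] [InnerProductSpace ℂ H] [CompleteSpace H]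

/-- The dimension of the range of an operator. -/
noncomputable def rk (A : H →L[ℂ] H) : ℕ := Module.finrank ℂ (LinearMap.range (A : H →ₗ[ℂ] H))

/-- The range of the operator is finite-dimensional. -/
def FiniteRank (A : H →L[ℂ] H) : Prop := FiniteDimensional ℂ (LinearMap.range (A : H →ₗ[ℂ] H))

theorem mem_range_iff_of_isStarProjection {P : H →L[ℂ] H} (hP : IsStarProjection P) {x : H} :
    x ∈ LinearMap.range (P : H →ₗ[ℂ] H) ↔ P x = x := by
  constructor
  · rintro ⟨y, rfl⟩
    exact congr($(hP.isIdempotentElem.eq) y)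
  · intro h
    exact ⟨x, h⟩

@[simp]
theorem pairMap_coe (P Q : H →L[ℂ] H) (x : LinearMap.range (P : H →ₗ[ℂ] H)) :
    (pairMap P Q x : H) = Q (P x) := rfl

/-- Finite rank projections `U ≤ P` and `V ≤ Q` after the removal of which the projections `P` and
`Q` have distance less than one. -/
structure IsDefectPair (P Q U V : H →L[ℂ] H) : Prop where
  left : IsStarProjection P
  right : IsStarProjection Q
  projU : IsStarProjection U
  projV : IsStarProjection V
  mulU : P * U = U
  mulV : Q * V = V
  finU : FiniteRank U
  finV : FiniteRank V
  norm_lt : ‖(P - U) - (Q - V)‖ < 1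

/-- An approximate inverse of `Q P`, for projections of distance less than one. -/
theorem exists_inverse_of_norm_sub_lt_one {P Q : H →L[ℂ] H} (hP : IsStarProjection P)
    (hQ : IsStarProjection Q) (h : ‖P - Q‖ < 1) :
    ∃ A : H →L[ℂ] H, P * A = A ∧ A * Q = A ∧ Q * A = Q ∧ A * Q * P = P := by
  have hPP := hP.isIdempotentElem.eq
  have hQQ := hQ.isIdempotentElem.eq
  have h1 : ‖Q * (Q - P) * Q‖ < 1 := by
    refine lt_of_le_of_lt ?_ h
    rw [norm_sub_rev P Q]
    calc _ ≤ ‖Q‖ * ‖Q - P‖ * ‖Q‖ :=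
          (norm_mul_le _ _).trans (by gcongr; exact norm_mul_le _ _)
      _ ≤ 1 * ‖Q - P‖ * 1 := by
          gcongr
          · exact hQ.norm_le_one
          · exact hQ.norm_le_one
      _ = _ := by ring
  -- `1 - Q (Q - P) Q` is `Q P Q` on the range of `Q` and the identity on its complement.
  obtain ⟨w, hw⟩ := isUnit_one_sub_of_norm_lt_one h1
  have hwQ : (w : H →L[ℂ] H) * Q = Q * P * Q := by
    rw [hw]
    have : (1 - Q * (Q - P) * Q) * Q = Q - Q * Q * (Q * Q) + Q * P * (Q * Q) := by noncomm_ring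
    rw [this, hQQ, hQQ]; simp
  have hQw : Q * (w : H →L[ℂ] H) = Q * P * Q := by
    rw [hw]
    have : Q * (1 - Q * (Q - P) * Q) = Q - Q * Q * (Q * Q) + (Q * Q) * P * Q := by noncomm_ring
    rw [this, hQQ, hQQ]; simp
  have hcomm : Commute Q (w : H →L[ℂ] H) := by rw [Commute, SemiconjBy, hwQ, hQw]
  have hcomm' : Q * ((w⁻¹ : (H →L[ℂ] H)ˣ) : H →L[ℂ] H) = ((w⁻¹ : (H →L[ℂ] H)ˣ) : H →L[ℂ] H) * Q :=
    hcomm.units_inv_right.eq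
  set v := ((w⁻¹ : (H →L[ℂ] H)ˣ) : H →L[ℂ] H) with hv
  have hQA : Q * (P * Q * v) = Q := by
    rw [← mul_assoc, ← mul_assoc, ← hQw, mul_assoc, hv, Units.mul_inv, mul_one]
  have hA1 : P * (P * Q * v) = P * Q * v := by rw [← mul_assoc, ← mul_assoc, hPP]
  refine ⟨P * Q * v, hA1, ?_, hQA, ?_⟩
  · rw [mul_assoc, ← hcomm', ← mul_assoc, mul_assoc P, hQQ]
  · set A := P * Q * v with hA
    -- `Q` is injective on the range of `P`, as otherwise `P - Q` would preserve the norm of some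
    -- nonzero vector. Hence `A Q P = P` may be checked after applying `Q`.
    have key : ∀ y, P y = y → Q y = 0 → y = 0 := by
      intro y hy hy'
      by_contra hne
      have : ‖(P - Q) y‖ < ‖y‖ := by
        calc _ ≤ ‖P - Q‖ * ‖y‖ := ContinuousLinearMap.le_opNorm _ _
          _ < 1 * ‖y‖ := by gcongr
          _ = _ := one_mul _
      rw [sub_apply, hy, hy', sub_zero] at this
      exact lt_irrefl _ this
    ext x
    rw [← sub_eq_zero]
    apply key
    · have : P * (A * Q * P) - P * P = A * Q * P - P := by
        rw [← mul_assoc, ← mul_assoc, hA1, hPP]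
      simpa using congr($this x)
    · have : Q * (A * Q * P) - Q * P = 0 := by
        rw [← mul_assoc, ← mul_assoc, hQA, hQQ, sub_self]
      simpa using congr($this x)

namespace IsDefectPair

variable {P Q U V : H →L[ℂ] H}

/-- Between the ranges of `P' = P - U` and `Q' = Q - V` the compression is bijective. Its inverse
`A` is an inverse of `Q P` up to the finite rank operators `U` and `V`, and
`finrank_ker_sub_finrank_coker` counts the defects. -/
theorem isFredholm_and_pairIndex_eq (h : IsDefectPair P Q U V) :
    (pairMap P Q).IsFredholm ∧ pairIndex P Q = (rk U : ℤ) - rk V := by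
  have hPP := h.left.isIdempotentElem.eq
  have hQQ := h.right.isIdempotentElem.eq
  have hUU := h.projU.isIdempotentElem.eq
  have hVV := h.projV.isIdempotentElem.eq
  have hUP : U * P = U := by
    have := congr(star $(h.mulU))
    rwa [star_mul, h.left.isSelfAdjoint.star_eq, h.projU.isSelfAdjoint.star_eq] at this
  have hVQ : V * Q = V := by
    have := congr(star $(h.mulV))
    rwa [star_mul, h.right.isSelfAdjoint.star_eq, h.projV.isSelfAdjoint.star_eq] at this
  set P' := P - U with hP'
  set Q' := Q - V with hQ'
  have pP' : IsStarProjection P' := h.projU.sub_of_mul_eq_left h.left hUP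
  have pQ' : IsStarProjection Q' := h.projV.sub_of_mul_eq_left h.right hVQ
  obtain ⟨A, hPA, hAQ, hQA, hAQP⟩ := exists_inverse_of_norm_sub_lt_one pP' pQ' h.norm_lt
  have hPP' : P * P' = P' := by rw [hP', mul_sub, hPP, h.mulU]
  have hQ'Q : Q' * Q = Q' := by rw [hQ', sub_mul, hQQ, hVQ]
  have hQQ' : Q * Q' = Q' := by rw [hQ', mul_sub, hQQ, h.mulV]
  have hPA' : P * A = A := by rw [← hPA, ← mul_assoc, hPP']
  have hAQ' : A * Q = A := by rw [← hAQ, mul_assoc, hQ'Q]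
  have := h.finU
  have := h.finV
  unfold FiniteRank at *
  constructor
  · let v : LinearMap.range (Q : H →ₗ[ℂ] H) →L[ℂ] LinearMap.range (P : H →ₗ[ℂ] H) :=
      (A ∘L (LinearMap.range (Q : H →ₗ[ℂ] H)).subtypeL).codRestrict
        (LinearMap.range (P : H →ₗ[ℂ] H)) fun x => ⟨A x, congr($hPA' x)⟩
    have hv : ∀ x, (v x : H) = A x := fun x => rfl
    refine ContinuousLinearMap.IsFredholm.of_isQuasiInverse (v := v) ⟨?_, ?_⟩
    · rw [LinearMap.IsLeftQuasiInverse, LinearMap.FiniteRangeSetoid.equiv_iff_hasNoetherianRange]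
      refine hasNoetherianRange_of_forall_mem _
        (Submodule.map (A * Q' - 1 : H →L[ℂ] H).toLinearMap (LinearMap.range (U : H →ₗ[ℂ] H)))
        fun x => ⟨U x, ⟨x, rfl⟩, ?_⟩
      have hx : P x = x := (mem_range_iff_of_isStarProjection h.left).1 x.2
      have e : A * Q * P - P = (A * Q' - 1) * U := by
        have : A * Q * P = A * Q' * P' + A * Q' * U := by
          rw [hAQ, hAQ', hP']; noncomm_ring
        rw [this, hAQP, hP']; noncomm_ring
      have e2 := congr($e (x : H))
      simp only [sub_apply, mul_apply_eq_comp, ContinuousLinearMap.coe_coe, LinearMap.sub_apply,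
        LinearMap.comp_apply, LinearMap.id_apply, Submodule.coe_sub, hv, pairMap_coe] at e2 ⊢
      rw [← e2, hx]
    · rw [LinearMap.IsRightQuasiInverse, LinearMap.FiniteRangeSetoid.equiv_iff_hasNoetherianRange]
      refine hasNoetherianRange_of_forall_mem _ (LinearMap.range (V : H →ₗ[ℂ] H))
        fun x => ⟨A x - x, ?_⟩
      have hx : Q x = x := (mem_range_iff_of_isStarProjection h.right).1 x.2
      have e : Q * (P * A) - Q = V * (A - 1) := by
        have : Q * (P * A) = Q' * A + V * A := by rw [hPA', hQ']; noncomm_ring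
        rw [this, hQA, hQ']; noncomm_ring
      have e2 := congr($e (x : H))
      simp only [sub_apply, mul_apply_eq_comp, ContinuousLinearMap.coe_coe, LinearMap.sub_apply,
        LinearMap.comp_apply, LinearMap.id_apply, Submodule.coe_sub, hv, pairMap_coe,
        one_apply_eq_self] at e2 ⊢
      rw [← e2, hx]
  · set RP := LinearMap.range (P : H →ₗ[ℂ] H) with hRP
    set RQ := LinearMap.range (Q : H →ₗ[ℂ] H) with hRQ
    set M₁ := (LinearMap.range (P' : H →ₗ[ℂ] H)).comap RP.subtype with hM₁
    set M₀ := (LinearMap.range (U : H →ₗ[ℂ] H)).comap RP.subtype with hM₀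
    have mM₁ : ∀ x : RP, x ∈ M₁ ↔ P' x = x := fun x => mem_range_iff_of_isStarProjection pP'
    have mM₀ : ∀ x : RP, x ∈ M₀ ↔ U x = x := fun x => mem_range_iff_of_isStarProjection h.projU
    have mRP : ∀ x : RP, P x = x := fun x => (mem_range_iff_of_isStarProjection h.left).1 x.2
    have mRQ : ∀ x : RQ, Q x = x := fun x => (mem_range_iff_of_isStarProjection h.right).1 x.2
    have hleU : LinearMap.range (U : H →ₗ[ℂ] H) ≤ RP := by
      rintro _ ⟨x, rfl⟩
      exact ⟨U x, congr($(h.mulU) x)⟩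
    have hleV : LinearMap.range (V : H →ₗ[ℂ] H) ≤ RQ := by
      rintro _ ⟨x, rfl⟩
      exact ⟨V x, congr($(h.mulV) x)⟩
    have hcompl : IsCompl M₁ M₀ := by
      constructor
      · rw [Submodule.disjoint_def]
        intro x h1 h0
        rw [mM₁, hP', sub_apply, mRP] at h1
        rw [mM₀] at h0
        rw [h0, sub_self] at h1
        exact Subtype.ext h1.symm
      · rw [codisjoint_iff, eq_top_iff]
        intro x _
        have hx1 : P (U x) = U x := congr($(h.mulU) x)
        have hx2 : U (U x) = U x := congr($hUU x)
        refine Submodule.mem_sup.2 ⟨x - ⟨U x, ⟨U x, hx1⟩⟩, (mM₁ _).2 ?_, ⟨U x, ⟨U x, hx1⟩⟩,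
          (mM₀ _).2 hx2, by abel⟩
        simp only [hP', Submodule.coe_sub, map_sub, sub_apply, mRP, hx1, hx2]
        abel
    let eU := Submodule.comapSubtypeEquivOfLe hleU
    have : FiniteDimensional ℂ M₀ := eU.symm.finiteDimensional
    set p : RQ →ₗ[ℂ] LinearMap.range (Q' : H →ₗ[ℂ] H) := (pairMap Q Q').toLinearMap with hp
    have pcoe : ∀ y : RQ, (p y : H) = Q' y := fun y => by
      rw [hp, ContinuousLinearMap.coe_coe, pairMap_coe, mRQ]
    have hker : LinearMap.ker p = (LinearMap.range (V : H →ₗ[ℂ] H)).comap RQ.subtype := by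
      ext y
      rw [LinearMap.mem_ker, Subtype.ext_iff, pcoe, Submodule.mem_comap,
        Submodule.subtype_apply, mem_range_iff_of_isStarProjection h.projV, hQ', sub_apply, mRQ,
        Submodule.coe_zero, sub_eq_zero, eq_comm]
    let eV := Submodule.comapSubtypeEquivOfLe hleV
    have : FiniteDimensional ℂ (LinearMap.ker p) := by
      rw [hker]; exact eV.symm.finiteDimensional
    have hbij : Function.Bijective fun x : M₁ => p ((pairMap P Q).toLinearMap x) := by
      have hval : ∀ x : M₁, (p ((pairMap P Q).toLinearMap x) : H) = Q' x := fun x => by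
        rw [pcoe, ContinuousLinearMap.coe_coe, pairMap_coe, mRP]
        exact congr($hQ'Q x)
      constructor
      · intro x y hxy
        have h1 := congr(($hxy : H))
        simp only [hval] at h1
        have h2 : ∀ z : M₁, A (Q' z) = z := fun z => by
          have := (mM₁ _).1 z.2
          have h3 := congr($hAQP (z : RP))
          simp only [mul_apply_eq_comp] at h3
          rw [this] at h3
          exact h3
        apply Subtype.ext
        apply Subtype.ext
        rw [← h2 x, h1, h2 y]
      · intro y
        have hy : Q' (y : H) = y := (mem_range_iff_of_isStarProjection pQ').1 y.2
        refine ⟨⟨⟨A y, ⟨A y, congr($hPA' y)⟩⟩, (mM₁ _).2 congr($hPA y)⟩, ?_⟩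
        apply Subtype.ext
        rw [hval]
        change Q' (A y) = y
        rw [← mul_apply_eq_comp, hQA, hy]
    have := finrank_ker_sub_finrank_coker (pairMap P Q).toLinearMap p hcompl hbij
    rw [pairIndex, this]
    congr 2
    · exact eU.finrank_eq
    · rw [hker]; exact eV.finrank_eq

end IsDefectPair

end PairIndex

/-! ### Norm convergence of finite rank projections. -/

section FiniteRankProjections

variable {H : Type*} [NormedAddCommGroup H] [InnerProductSpace ℂ H] [CompleteSpace H]

theorem FiniteRank.compact {A : H →L[ℂ] H} (hA : FiniteRank A) : IsCompactOperator A := by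
  unfold FiniteRank at hA
  have h1 : IsCompactOperator (A.codRestrict (LinearMap.range (A : H →ₗ[ℂ] H)) fun x => ⟨x, rfl⟩) :=
    isCompactOperator_of_locallyCompactSpace_dom _
  exact h1.clm_comp (LinearMap.range (A : H →ₗ[ℂ] H)).subtypeL

theorem norm_one_sub_mul_apply_le {E F : H →L[ℂ] H} {η : ℝ}
    (h : ‖(1 - E) * F‖ ≤ η) {x : H} (hx : F x = x) : ‖x - E x‖ ≤ η * ‖x‖ := by
  have := ContinuousLinearMap.le_of_opNorm_le _ h x
  simpa [mul_apply_eq_comp, hx] using this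

/-- Projections of small distance have the same rank. -/
theorem rk_le_of_norm_one_sub_mul_lt {E F : H →L[ℂ] H} (hF : IsStarProjection F)
    (hE : FiniteRank E) (h : ‖(1 - E) * F‖ < 1) : FiniteRank F ∧ rk F ≤ rk E := by
  unfold FiniteRank rk at *
  let f : LinearMap.range (F : H →ₗ[ℂ] H) →ₗ[ℂ] LinearMap.range (E : H →ₗ[ℂ] H) :=
    (E : H →ₗ[ℂ] H).restrict fun x _ => ⟨x, rfl⟩
  have hf : Function.Injective f := by
    rw [← LinearMap.ker_eq_bot, LinearMap.ker_eq_bot']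
    intro x hx
    have h1 : E (x : H) = 0 := congr(($hx : H))
    have h2 := norm_one_sub_mul_apply_le (E := E) (F := F) le_rfl
      ((mem_range_iff_of_isStarProjection hF).1 x.2)
    rw [h1, sub_zero] at h2
    have h3 : ‖(x : H)‖ = 0 := by
      by_contra hne
      have : 0 < ‖(x : H)‖ := lt_of_le_of_ne (norm_nonneg _) (Ne.symm hne)
      nlinarith
    exact Subtype.ext (norm_eq_zero.1 h3)
  exact ⟨FiniteDimensional.of_injective f hf, LinearMap.finrank_le_finrank_of_injective hf⟩

/-- `E` is injective on the range of `F`, and the rank condition makes it onto the range of `E`.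
Thus every vector of the latter range is close to the former, which gives `‖(1 - F) E‖ ≤ 2 η`; the
remaining `η` comes from `F (1 - E)`. -/
theorem norm_sub_le_of_norm_one_sub_mul_le {E F : H →L[ℂ] H} (hE : IsStarProjection E)
    (hF : IsStarProjection F) (hEfin : FiniteRank E) (hrk : rk E ≤ rk F) {η : ℝ} (hη : η ≤ 1 / 2)
    (h : ‖(1 - E) * F‖ ≤ η) : ‖E - F‖ ≤ 3 * η := by
  have hη0 : 0 ≤ η := (norm_nonneg _).trans h
  have hrk' := rk_le_of_norm_one_sub_mul_lt hF hEfin (h.trans_lt (by linarith))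
  have hle : ∀ x, F x = x → ‖x - E x‖ ≤ η * ‖x‖ := fun x => norm_one_sub_mul_apply_le h
  have hsurj : ∀ y, E y = y → ∃ x, F x = x ∧ E x = y := by
    have := hrk'.1
    unfold FiniteRank rk at *
    let f : LinearMap.range (F : H →ₗ[ℂ] H) →ₗ[ℂ] LinearMap.range (E : H →ₗ[ℂ] H) :=
      (E : H →ₗ[ℂ] H).restrict fun x _ => ⟨x, rfl⟩
    have hf : Function.Injective f := by
      rw [← LinearMap.ker_eq_bot, LinearMap.ker_eq_bot']
      intro x hx
      have h1 : E (x : H) = 0 := congr(($hx : H))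
      have h2 := hle x ((mem_range_iff_of_isStarProjection hF).1 x.2)
      rw [h1, sub_zero] at h2
      have h3 : ‖(x : H)‖ = 0 := by
        nlinarith [norm_nonneg (x : H)]
      exact Subtype.ext (norm_eq_zero.1 h3)
    have hfs : Function.Surjective f :=
      (LinearMap.injective_iff_surjective_of_finrank_eq_finrank
        (le_antisymm hrk'.2 hrk)).1 hf
    intro y hy
    obtain ⟨x, hx⟩ := hfs ⟨y, (mem_range_iff_of_isStarProjection hE).2 hy⟩
    exact ⟨x, (mem_range_iff_of_isStarProjection hF).1 x.2, congr(($hx : H))⟩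
  have h2 : ‖(1 - F) * E‖ ≤ 2 * η := by
    refine ContinuousLinearMap.opNorm_le_bound _ (by positivity) fun z => ?_
    have hEE : E (E z) = E z := congr($(hE.isIdempotentElem.eq) z)
    obtain ⟨x, hx, hxz⟩ := hsurj (E z) hEE
    have h3 : ‖x‖ ≤ 2 * ‖E z‖ := by
      have := hle x hx
      rw [hxz] at this
      have h4 : ‖x‖ ≤ ‖x - E z‖ + ‖E z‖ := by
        simpa using norm_add_le (x - E z) (E z)
      nlinarith [norm_nonneg x]
    have h5 : ((1 - F) * E) z = (1 - F) (E x - x) := by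
      rw [mul_apply_eq_comp, map_sub, ← hxz]
      have : (1 - F) x = 0 := by simp [hx]
      rw [this, sub_zero]
    rw [h5]
    calc _ ≤ 1 * ‖E x - x‖ := ContinuousLinearMap.le_of_opNorm_le _ hF.one_sub.norm_le_one _
      _ ≤ η * ‖x‖ := by rw [one_mul, norm_sub_rev]; exact hle x hx
      _ ≤ η * (2 * ‖E z‖) := by gcongr
      _ ≤ η * (2 * (1 * ‖z‖)) := by
        gcongr
        exact ContinuousLinearMap.le_of_opNorm_le _ hE.norm_le_one _
      _ = 2 * η * ‖z‖ := by ring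
  have h3 : ‖F * (1 - E)‖ ≤ η := by
    rw [← norm_star, star_mul, star_sub, star_one, hE.isSelfAdjoint.star_eq,
      hF.isSelfAdjoint.star_eq]
    exact h
  have e : E - F = (1 - F) * E - F * (1 - E) := by noncomm_ring
  rw [e]
  exact (norm_sub_le _ _).trans (by linarith)

/-- One-sided closeness suffices in the presence of the rank bound. Through `tendsto_one_sub_mul`,
strong convergence on the range of `F` is enough. -/
theorem tendsto_of_isStarProjection {ι : Type*} {l : Filter ι} {E : ι → H →L[ℂ] H}
    {F : H →L[ℂ] H} (hE : ∀ i, IsStarProjection (E i)) (hF : IsStarProjection F)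
    (hfin : ∀ i, FiniteRank (E i)) (hrk : ∀ i, rk (E i) ≤ rk F)
    (h : Tendsto (fun i => (1 - E i) * F) l (𝓝 0)) : Tendsto E l (𝓝 F) := by
  rw [tendsto_iff_norm_sub_tendsto_zero]
  rw [tendsto_zero_iff_norm_tendsto_zero] at h
  refine squeeze_zero' (Eventually.of_forall fun _ => norm_nonneg _) ?_
    (by simpa using h.const_mul 3)
  filter_upwards [h.eventually (gt_mem_nhds (show (0 : ℝ) < 1 / 2 by norm_num))] with i hi
  exact norm_sub_le_of_norm_one_sub_mul_le (hE i) hF (hfin i) (hrk i) hi.le le_rfl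

theorem tendsto_one_sub_mul {ι : Type*} {l : Filter ι} {E : ι → H →L[ℂ] H}
    {F : H →L[ℂ] H} (hE : ∀ i, IsStarProjection (E i)) (hF : IsStarProjection F)
    (hfin : FiniteRank F) (h : ∀ x, F x = x → Tendsto (fun i => E i x) l (𝓝 x)) :
    Tendsto (fun i => (1 - E i) * F) l (𝓝 0) := by
  have hFF : ∀ x, F (F x) = F x := fun x => congr($(hF.isIdempotentElem.eq) x)
  have : Tendsto (fun i => ((1 - E i) * F) * F) l (𝓝 ((0 : H →L[ℂ] H) * F)) := by
    refine tendsto_mul_of_isCompactOperator (C := 1) (fun i => ?_) (fun x => ?_) hfin.compact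
    · calc _ ≤ ‖1 - E i‖ * ‖F‖ := norm_mul_le _ _
        _ ≤ 1 * 1 := by
          gcongr
          · exact (hE i).one_sub.norm_le_one
          · exact hF.norm_le_one
        _ = 1 := one_mul 1
    · simpa [mul_apply_eq_comp] using (tendsto_const_nhds (x := F x)).sub (h (F x) (hFF x))
  simpa [mul_assoc, hF.isIdempotentElem.eq] using this

theorem rk_eq_of_norm_sub_lt_one {E F : H →L[ℂ] H} (hE : IsStarProjection E)
    (hF : IsStarProjection F) (hEfin : FiniteRank E) (h : ‖E - F‖ < 1) :
    FiniteRank F ∧ rk E = rk F := by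
  have h1 : ‖(1 - E) * F‖ < 1 := by
    have e : (1 - E) * F = (F - E) * F := by
      rw [sub_mul, sub_mul, hF.isIdempotentElem.eq, one_mul]
    rw [e]
    calc _ ≤ ‖F - E‖ * ‖F‖ := norm_mul_le _ _
      _ ≤ ‖F - E‖ * 1 := by gcongr; exact hF.norm_le_one
      _ < 1 := by rwa [mul_one, norm_sub_rev]
  have h2 : ‖(1 - F) * E‖ < 1 := by
    have e : (1 - F) * E = (E - F) * E := by
      rw [sub_mul, sub_mul, hE.isIdempotentElem.eq, one_mul]
    rw [e]
    calc _ ≤ ‖E - F‖ * ‖E‖ := norm_mul_le _ _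
      _ ≤ ‖E - F‖ * 1 := by gcongr; exact hE.norm_le_one
      _ < 1 := by rwa [mul_one]
  obtain ⟨h3, h4⟩ := rk_le_of_norm_one_sub_mul_lt hF hEfin h1
  obtain ⟨_, h5⟩ := rk_le_of_norm_one_sub_mul_lt hE h3 h2
  exact ⟨h3, le_antisymm h5 h4⟩

theorem rk_eq_of_continuous {T : Type*} [TopologicalSpace T] [PreconnectedSpace T]
    {E : T → H →L[ℂ] H} (hE : ∀ t, IsStarProjection (E t)) (hfin : ∀ t, FiniteRank (E t))
    (hc : Continuous E) (s t : T) : rk (E s) = rk (E t) := by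
  have : IsLocallyConstant fun t => rk (E t) := by
    rw [IsLocallyConstant.iff_eventually_eq]
    intro t₀
    filter_upwards [Metric.tendsto_nhds.1 (hc.tendsto t₀) 1 one_pos] with t ht
    rw [dist_eq_norm] at ht
    exact (rk_eq_of_norm_sub_lt_one (hE t) (hE t₀) (hfin t) ht).2
  exact this.apply_eq_of_isPreconnected isPreconnected_univ (mem_univ s) (mem_univ t)

end FiniteRankProjections

/-! ### Defect projections of a pair with compact difference. -/

section PairIndexContinuity

variable {H : Type*} [NormedAddCommGroup H] [InnerProductSpace ℂ H] [CompleteSpace H]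

/-- The identity of the eigenspace is `μ⁻¹ A`, hence compact. -/
theorem finiteDimensional_eigenspace {A : H →L[ℂ] H} (hA : IsCompactOperator A) {μ : ℂ}
    (hμ : μ ≠ 0) : FiniteDimensional ℂ (LinearMap.ker (A - μ • 1 : H →L[ℂ] H).toLinearMap) := by
  set K := LinearMap.ker (A - μ • 1 : H →L[ℂ] H).toLinearMap with hK
  have hKc : IsClosed (K : Set H) := (A - μ • 1 : H →L[ℂ] H).isClosed_ker
  have hAx : ∀ x ∈ K, A x = μ • x := by
    intro x hx
    have : A x - μ • x = 0 := by simpa [hK] using hx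
    exact sub_eq_zero.1 this
  rw [← isCompactOperator_id_iff_finiteDimensional (𝕜 := ℂ)]
  have h1 : IsCompactOperator ((μ⁻¹ • A : H →L[ℂ] H) : H →ₗ[ℂ] H) := hA.smul μ⁻¹
  have h2 : ∀ x ∈ K, ((μ⁻¹ • A : H →L[ℂ] H) : H →ₗ[ℂ] H) x ∈ K := by
    intro x hx
    have : ((μ⁻¹ • A : H →L[ℂ] H) : H →ₗ[ℂ] H) x = x := by
      simp [hAx x hx, smul_smul, inv_mul_cancel₀ hμ]
    rwa [this]
  have h3 := IsCompactOperator.restrict h1 h2 hKc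
  have e : ⇑(((μ⁻¹ • A : H →L[ℂ] H) : H →ₗ[ℂ] H).restrict h2) = (_root_.id : K → K) := by
    funext x
    apply Subtype.ext
    simp [hAx x x.2, smul_smul, inv_mul_cancel₀ hμ]
  rwa [e] at h3

/-- Since `1` is not an eigenvalue of the compact operator `A²`, the operator `A² - 1` is bounded
below. Norm one would provide unit vectors on which it is arbitrarily small. -/
theorem norm_lt_one_of_isCompactOperator {A : H →L[ℂ] H} (hA : IsCompactOperator A)
    (hs : IsSelfAdjoint A) (h1 : ‖A‖ ≤ 1) (hinj : ∀ x, A (A x) = x → x = 0) : ‖A‖ < 1 := by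
  have hAA : IsCompactOperator (A * A : H →L[ℂ] H) := IsCompactOperator.mul_left hA A
  have h2 : ∃ K, AntilipschitzWith K (A * A - (1 : ℂ) • 1 : H →L[ℂ] H) := by
    refine IsCompactOperator.antilipschitz_of_not_hasEigenvalue hAA one_ne_zero fun hev => ?_
    obtain ⟨x, hx, hx0⟩ := hev.exists_hasEigenvector
    refine hx0 (hinj x ?_)
    have := Module.End.mem_eigenspace_iff.1 hx
    simpa using this
  obtain ⟨K, hK⟩ := h2
  have hK' : ∀ x, ‖x‖ ≤ K * ‖A (A x) - x‖ := by
    intro x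
    have := hK.le_mul_dist x 0
    simpa [dist_eq_norm] using this
  by_contra! hge
  have hA1 : ‖A‖ = 1 := le_antisymm h1 hge
  have hpos : (0 : ℝ) < 1 / (2 * (K + 1)) := by positivity
  obtain ⟨x, hx, hxη⟩ := exists_near_norming A (by rw [hA1]; exact one_pos) hpos
  rw [hs.star_eq, hA1] at hxη
  simp only [one_pow, Complex.ofReal_one, one_smul] at hxη
  have h3 := hK' x
  rw [hx] at h3
  have h4 : (K : ℝ) * ‖A (A x) - x‖ ≤ K * (1 / (2 * (K + 1))) := by gcongr
  have h5 : (K : ℝ) * (1 / (2 * (K + 1))) < 1 := by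
    rw [mul_one_div, div_lt_one (by positivity)]
    linarith [K.coe_nonneg]
  linarith

/-- `U` and `V` project onto the eigenspaces of `P - Q` for `1` and `-1`, that is, onto `Ran P ∩ Ker
Q` and `Ran Q ∩ Ker P`. What remains of `P - Q` is a compact difference of projections without the
eigenvalues `±1`, so `norm_lt_one_of_isCompactOperator` applies. -/
theorem exists_isDefectPair {P Q : H →L[ℂ] H} (hP : IsStarProjection P) (hQ : IsStarProjection Q)
    (h : IsCompactOperator (P - Q : H →L[ℂ] H)) : ∃ U V, IsDefectPair P Q U V := by
  set KU := LinearMap.ker (P - Q - (1 : ℂ) • 1 : H →L[ℂ] H).toLinearMap with hKU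
  set KV := LinearMap.ker (P - Q - (-1 : ℂ) • 1 : H →L[ℂ] H).toLinearMap with hKV
  have fU : FiniteDimensional ℂ KU := finiteDimensional_eigenspace h one_ne_zero
  have fV : FiniteDimensional ℂ KV := finiteDimensional_eigenspace h (by norm_num)
  have hPP : ∀ x, P (P x) = P x := fun x => congr($(hP.isIdempotentElem.eq) x)
  have hQQ : ∀ x, Q (Q x) = Q x := fun x => congr($(hQ.isIdempotentElem.eq) x)
  -- `(1 - A) x = - B x` gives `⟨x, B x⟩ + ⟨x, (1 - A) x⟩ = 0`, a sum of two squared norms.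
  have split : ∀ {A B : H →L[ℂ] H}, IsStarProjection A → IsStarProjection B →
      ∀ x, A x - B x = x → A x = x ∧ B x = 0 := by
    intro A B hA hB x hx
    have hAA : A (A x) = A x := congr($(hA.isIdempotentElem.eq) x)
    have hBB : B (B x) = B x := congr($(hB.isIdempotentElem.eq) x)
    have e1 : (1 - A) x = - B x := by
      simp only [sub_apply, one_apply_eq_self]
      nth_rewrite 1 [← hx]; abel
    have e2 : ‖B x‖ ^ 2 + ‖(1 - A) x‖ ^ 2 = 0 := by
      have i1 : (inner ℂ (B x) (B x) : ℂ) = inner ℂ x (B x) := by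
        rw [inner_apply_of_isSelfAdjoint hB.isSelfAdjoint, hBB]
      have i2 : (inner ℂ ((1 - A) x) ((1 - A) x) : ℂ) = inner ℂ x ((1 - A) x) := by
        rw [inner_apply_of_isSelfAdjoint hA.one_sub.isSelfAdjoint, ← mul_apply_eq_comp,
          hA.one_sub.isIdempotentElem.eq]
      have i3 : (inner ℂ (B x) (B x) : ℂ) + inner ℂ ((1 - A) x) ((1 - A) x) = 0 := by
        rw [i1, i2, e1, inner_neg_right]; ring
      rw [inner_self_eq_norm_sq_to_K, inner_self_eq_norm_sq_to_K] at i3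
      have i4 : ((‖B x‖ ^ 2 + ‖(1 - A) x‖ ^ 2 : ℝ) : ℂ) = 0 := by
        push_cast; exact i3
      exact_mod_cast i4
    have hB0 : B x = 0 := by
      rw [← norm_eq_zero]
      nlinarith [sq_nonneg ‖(1 - A) x‖, sq_nonneg ‖B x‖]
    rw [hB0, sub_zero] at hx
    exact ⟨hx, hB0⟩
  have mU : ∀ x, x ∈ KU ↔ P x = x ∧ Q x = 0 := by
    intro x
    have : x ∈ KU ↔ P x - Q x = x := by simp [hKU, sub_eq_zero]
    rw [this]
    exact ⟨split hP hQ x, fun ⟨h1, h2⟩ => by rw [h1, h2, sub_zero]⟩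
  have mV : ∀ x, x ∈ KV ↔ Q x = x ∧ P x = 0 := by
    intro x
    have : x ∈ KV ↔ Q x - P x = x := by
      simp only [hKV, LinearMap.mem_ker, ContinuousLinearMap.coe_coe, sub_apply, neg_smul,
        one_smul, neg_apply, one_apply_eq_self]
      rw [sub_neg_eq_add, ← neg_eq_zero, ← sub_eq_zero (a := Q x - P x)]
      constructor <;> (intro h; rw [← h]; abel)
    rw [this]
    exact ⟨split hQ hP x, fun ⟨h1, h2⟩ => by rw [h1, h2, sub_zero]⟩
  have rU : LinearMap.range (KU.starProjection : H →ₗ[ℂ] H) = KU := Submodule.range_starProjection KU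
  have rV : LinearMap.range (KV.starProjection : H →ₗ[ℂ] H) = KV := Submodule.range_starProjection KV
  have pU : IsStarProjection KU.starProjection := isStarProjection_starProjection
  have pV : IsStarProjection KV.starProjection := isStarProjection_starProjection
  have hPU : P * KU.starProjection = KU.starProjection := by
    ext x
    exact ((mU _).1 (Submodule.starProjection_apply_mem KU x)).1
  have hQV : Q * KV.starProjection = KV.starProjection := by
    ext x
    exact ((mV _).1 (Submodule.starProjection_apply_mem KV x)).1
  have finU : FiniteRank KU.starProjection := by rw [FiniteRank, rU]; exact fU
  have finV : FiniteRank KV.starProjection := by rw [FiniteRank, rV]; exact fV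
  have hUP : KU.starProjection * P = KU.starProjection := by
    have := congr(star $hPU)
    rwa [star_mul, hP.isSelfAdjoint.star_eq, pU.isSelfAdjoint.star_eq] at this
  have hVQ : KV.starProjection * Q = KV.starProjection := by
    have := congr(star $hQV)
    rwa [star_mul, hQ.isSelfAdjoint.star_eq, pV.isSelfAdjoint.star_eq] at this
  have hQU : ∀ x, Q (KU.starProjection x) = 0 := fun x =>
    ((mU _).1 (Submodule.starProjection_apply_mem KU x)).2
  have hPV : ∀ x, P (KV.starProjection x) = 0 := fun x =>
    ((mV _).1 (Submodule.starProjection_apply_mem KV x)).2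
  have pP' := pU.sub_of_mul_eq_left hP hUP
  have pQ' := pV.sub_of_mul_eq_left hQ hVQ
  refine ⟨KU.starProjection, KV.starProjection, hP, hQ, pU, pV, hPU, hQV, finU, finV, ?_⟩
  set P' := P - KU.starProjection with hP'
  set Q' := Q - KV.starProjection with hQ'
  -- `P' - Q' = P' (1 - Q') - (1 - P') Q'`, where both the values and the arguments of the two terms
  -- are orthogonal.
  have nle : ‖P' - Q'‖ ≤ 1 := by
    refine ContinuousLinearMap.opNorm_le_bound _ zero_le_one fun x => ?_
    have e : P' - Q' = P' * (1 - Q') - (1 - P') * Q' := by noncomm_ring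
    have i1 : (inner ℂ ((P' * (1 - Q')) x) (((1 - P') * Q') x) : ℂ) = 0 := by
      rw [mul_apply_eq_comp, mul_apply_eq_comp, inner_apply_of_isSelfAdjoint pP'.isSelfAdjoint,
        ← mul_apply_eq_comp P', pP'.mul_one_sub_self]
      simp
    have i2 : (inner ℂ (Q' x) ((1 - Q') x) : ℂ) = 0 := by
      rw [inner_apply_of_isSelfAdjoint pQ'.isSelfAdjoint, ← mul_apply_eq_comp Q',
        pQ'.mul_one_sub_self]
      simp
    have i3 : ‖(P' - Q') x‖ ^ 2 = ‖(P' * (1 - Q')) x‖ ^ 2 + ‖((1 - P') * Q') x‖ ^ 2 := by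
      rw [e, sub_apply, @norm_sub_sq ℂ, i1]; simp
    have i4 : ‖x‖ ^ 2 = ‖Q' x‖ ^ 2 + ‖(1 - Q') x‖ ^ 2 := by
      have : x = Q' x + (1 - Q') x := by simp
      conv_lhs => rw [this, @norm_add_sq ℂ, i2]
      simp
    have i5 : ‖(P' * (1 - Q')) x‖ ≤ ‖(1 - Q') x‖ := by
      simpa using ContinuousLinearMap.le_of_opNorm_le _ pP'.norm_le_one ((1 - Q') x)
    have i6 : ‖((1 - P') * Q') x‖ ≤ ‖Q' x‖ := by
      simpa using ContinuousLinearMap.le_of_opNorm_le _ pP'.one_sub.norm_le_one (Q' x)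
    rw [one_mul]
    refine (pow_le_pow_iff_left₀ (norm_nonneg _) (norm_nonneg _) two_ne_zero).1 ?_
    rw [i3, i4]
    linarith [pow_le_pow_left₀ (norm_nonneg _) i5 2, pow_le_pow_left₀ (norm_nonneg _) i6 2]
  have hcpt : IsCompactOperator (P' - Q' : H →L[ℂ] H) := by
    have e : P' - Q' = (P - Q) - KU.starProjection + KV.starProjection := by rw [hP', hQ']; abel
    rw [e]
    exact (h.sub finU.compact).add finV.compact
  have fix1 : ∀ x, P' x - Q' x = x → x = 0 := by
    intro x hx
    obtain ⟨h1, h2⟩ := split pP' pQ' x hx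
    have hPx : P x = x := by
      have : P (P' x) = P' x := by
        rw [hP', sub_apply, map_sub, hPP]
        congr 1
        exact congr($hPU x)
      rw [h1] at this; exact this
    have hUx : KU.starProjection x = 0 := by
      rw [hP', sub_apply, hPx] at h1
      simpa using h1
    have hQx : Q x = KV.starProjection x := by
      rw [hQ', sub_apply] at h2; exact sub_eq_zero.1 h2
    have hQ0 : Q x = 0 := by
      have i1 : (inner ℂ (Q x) (Q x) : ℂ) = 0 := by
        rw [inner_apply_of_isSelfAdjoint hQ.isSelfAdjoint, hQQ, ← hPx,
          inner_apply_of_isSelfAdjoint hP.isSelfAdjoint, hPx, hQx, hPV, inner_zero_right]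
      exact inner_self_eq_zero.1 i1
    have : x ∈ KU := (mU x).2 ⟨hPx, hQ0⟩
    rw [← Submodule.starProjection_eq_self_iff.2 this, hUx]
  have fix2 : ∀ x, Q' x - P' x = x → x = 0 := by
    intro x hx
    obtain ⟨h1, h2⟩ := split pQ' pP' x hx
    have hQx : Q x = x := by
      have : Q (Q' x) = Q' x := by
        rw [hQ', sub_apply, map_sub, hQQ]
        congr 1
        exact congr($hQV x)
      rw [h1] at this; exact this
    have hVx : KV.starProjection x = 0 := by
      rw [hQ', sub_apply, hQx] at h1
      simpa using h1
    have hPx : P x = KU.starProjection x := by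
      rw [hP', sub_apply] at h2; exact sub_eq_zero.1 h2
    have hP0 : P x = 0 := by
      have i1 : (inner ℂ (P x) (P x) : ℂ) = 0 := by
        rw [inner_apply_of_isSelfAdjoint hP.isSelfAdjoint, hPP, ← hQx,
          inner_apply_of_isSelfAdjoint hQ.isSelfAdjoint, hQx, hPx, hQU, inner_zero_right]
      exact inner_self_eq_zero.1 i1
    have : x ∈ KV := (mV x).2 ⟨hQx, hP0⟩
    rw [← Submodule.starProjection_eq_self_iff.2 this, hVx]
  refine norm_lt_one_of_isCompactOperator hcpt (pP'.isSelfAdjoint.sub pQ'.isSelfAdjoint) nle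
    fun x hx => ?_
  -- From `A² x = x` it follows that `A x + x` is fixed by `A`, hence `0`; then `A x = - x`.
  have h1 : (P' - Q') x + x = 0 := by
    apply fix1
    have : (P' - Q') ((P' - Q') x + x) = (P' - Q') x + x := by rw [map_add, hx, add_comm]
    simpa using this
  apply fix2
  have : (P' - Q') x = - x := eq_neg_of_add_eq_zero_left h1
  rw [sub_apply] at this
  rw [← neg_inj, ← this]; abel

theorem IsDefectPair.of_isCompactOperator {P Q : H →L[ℂ] H} (hP : IsStarProjection P)
    (hQ : IsStarProjection Q) (h : IsCompactOperator (P - Q : H →L[ℂ] H)) : IsIndexPair P Q := by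
  obtain ⟨U, V, hUV⟩ := exists_isDefectPair hP hQ h
  exact ⟨h, hUV.isFredholm_and_pairIndex_eq.1⟩

end PairIndexContinuity

/-! ### Homotopy invariance and additivity of the index of a pair. -/

section PairIndexConstant

variable {H : Type*} [NormedAddCommGroup H] [InnerProductSpace ℂ H] [CompleteSpace H]
  {T : Type*} [TopologicalSpace T]

/-- `U t` projects onto the image of the range of `U₀` under `P t`. The dimension cannot exceed the
rank of `U₀`, and `P t x → x` on that range, so the convergence holds in norm although `P` is only
strongly continuous. -/
theorem exists_tendsto_subprojection {P : T → H →L[ℂ] H} (hP : ∀ t, IsStarProjection (P t))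
    (hc : StrongCont P) {t₀ : T} {U₀ : H →L[ℂ] H} (hU : IsStarProjection U₀)
    (hfin : FiniteRank U₀) (hPU : P t₀ * U₀ = U₀) :
    ∃ U : T → H →L[ℂ] H, (∀ t, IsStarProjection (U t)) ∧ (∀ t, FiniteRank (U t)) ∧
      (∀ t, P t * U t = U t) ∧ Tendsto U (𝓝 t₀) (𝓝 U₀) := by
  have hf : FiniteDimensional ℂ (LinearMap.range (U₀ : H →ₗ[ℂ] H)) := hfin
  let K : T → Submodule ℂ H := fun t =>
    Submodule.map (P t : H →ₗ[ℂ] H) (LinearMap.range (U₀ : H →ₗ[ℂ] H))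
  have hr : ∀ t, LinearMap.range ((K t).starProjection : H →ₗ[ℂ] H) = K t := fun t =>
    Submodule.range_starProjection (K t)
  have hp : ∀ t, IsStarProjection (K t).starProjection := fun t => isStarProjection_starProjection
  have hfr : ∀ t, FiniteRank (K t).starProjection := fun t => by
    rw [FiniteRank, hr]; infer_instance
  refine ⟨fun t => (K t).starProjection, hp, hfr, fun t => ?_, ?_⟩
  · ext x
    obtain ⟨y, _, hy⟩ := Submodule.starProjection_apply_mem (K t) x
    rw [mul_apply_eq_comp, ← hy]
    exact congr($((hP t).isIdempotentElem.eq) y)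
  · refine tendsto_of_isStarProjection hp hU hfr (fun t => ?_)
      (tendsto_one_sub_mul hp hU hfin fun x hx => ?_)
    · rw [rk, hr]
      exact Submodule.finrank_map_le _ _
    · have hPx : P t₀ x = x := by
        have := congr($hPU x)
        rwa [mul_apply_eq_comp, hx] at this
      have h1 := tendsto_iff_norm_sub_tendsto_zero.1 ((hc.cont x).tendsto t₀)
      rw [tendsto_iff_norm_sub_tendsto_zero]
      refine squeeze_zero (fun _ => norm_nonneg _) (fun t => ?_) h1
      have hm : (K t).starProjection (P t x) = P t x :=
        Submodule.starProjection_eq_self_iff.2 ⟨x, ⟨x, hx⟩, rfl⟩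
      have e : (K t).starProjection x - x = (1 - (K t).starProjection) (P t x - x) := by
        rw [map_sub]
        simp [hm]
      rw [e, hPx]
      simpa using ContinuousLinearMap.le_of_opNorm_le _ (hp t).one_sub.norm_le_one (P t x - x)

/-- The defect projections at `t₀` are carried to nearby `t`. The strict norm inequality persists
because only `P - Q` and the defects enter it, and close projections have equal rank, so the index
is locally constant. -/
theorem pairIndex_eq_of_compactCont [PreconnectedSpace T] {P Q : T → H →L[ℂ] H}
    (hP : ∀ t, IsStarProjection (P t)) (hQ : ∀ t, IsStarProjection (Q t)) (cP : StrongCont P)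
    (cQ : StrongCont Q) (h : CompactCont fun t => P t - Q t) (s t : T) :
    pairIndex (P s) (Q s) = pairIndex (P t) (Q t) := by
  have : IsLocallyConstant fun t => pairIndex (P t) (Q t) := by
    rw [IsLocallyConstant.iff_eventually_eq]
    intro t₀
    obtain ⟨U₀, V₀, h₀⟩ := exists_isDefectPair (hP t₀) (hQ t₀) (h.compact t₀)
    obtain ⟨U, pU, fU, mU, tU⟩ := exists_tendsto_subprojection hP cP h₀.projU h₀.finU h₀.mulU
    obtain ⟨V, pV, fV, mV, tV⟩ := exists_tendsto_subprojection hQ cQ h₀.projV h₀.finV h₀.mulV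
    have h1 : Tendsto (fun t => ‖(P t - U t) - (Q t - V t)‖) (𝓝 t₀)
        (𝓝 ‖(P t₀ - U₀) - (Q t₀ - V₀)‖) := by
      have := (((h.cont.tendsto t₀).sub tU).add tV).norm
      convert this using 2
      · congr 1; abel
      · congr 1; abel
    filter_upwards [h1.eventually (gt_mem_nhds h₀.norm_lt),
      Metric.tendsto_nhds.1 tU 1 one_pos, Metric.tendsto_nhds.1 tV 1 one_pos] with t ht hU hV
    rw [dist_eq_norm] at hU hV
    have ht' : IsDefectPair (P t) (Q t) (U t) (V t) :=
      ⟨hP t, hQ t, pU t, pV t, mU t, mV t, fU t, fV t, ht⟩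
    rw [ht'.isFredholm_and_pairIndex_eq.2, h₀.isFredholm_and_pairIndex_eq.2,
      (rk_eq_of_norm_sub_lt_one (pU t) h₀.projU (fU t) hU).2,
      (rk_eq_of_norm_sub_lt_one (pV t) h₀.projV (fV t) hV).2]
  exact this.apply_eq_of_isPreconnected isPreconnected_univ (mem_univ s) (mem_univ t)

/-- The change of the index if a finite rank projection is added to the first projection. -/
theorem pairIndex_add {P Q N : H →L[ℂ] H} (hP : IsStarProjection P) (hQ : IsStarProjection Q)
    (hN : IsStarProjection N) (hfin : FiniteRank N) (hPN : P * N = 0)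
    (h : IsCompactOperator (P - Q : H →L[ℂ] H)) :
    pairIndex (P + N) Q = pairIndex P Q + rk N := by
  obtain ⟨U, V, hUV⟩ := exists_isDefectPair hP hQ h
  have hNP : N * P = 0 := by
    have := congr(star $hPN)
    rwa [star_mul, hP.isSelfAdjoint.star_eq, hN.isSelfAdjoint.star_eq, star_zero] at this
  have hUN : U * N = 0 := by
    have hUP : U * P = U := by
      have := congr(star $(hUV.mulU))
      rwa [star_mul, hP.isSelfAdjoint.star_eq, hUV.projU.isSelfAdjoint.star_eq] at this
    rw [← hUP, mul_assoc, hPN, mul_zero]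
  have hNU : N * U = 0 := by
    have := congr(star $hUN)
    rwa [star_mul, hUV.projU.isSelfAdjoint.star_eq, hN.isSelfAdjoint.star_eq, star_zero] at this
  have pPN : IsStarProjection (P + N) := hP.add hN hPN
  have pUN : IsStarProjection (U + N) := hUV.projU.add hN hUN
  have fU : FiniteDimensional ℂ (LinearMap.range (U : H →ₗ[ℂ] H)) := hUV.finU
  have fN : FiniteDimensional ℂ (LinearMap.range (N : H →ₗ[ℂ] H)) := hfin
  have hrange : LinearMap.range ((U + N : H →L[ℂ] H) : H →ₗ[ℂ] H)
      = LinearMap.range (U : H →ₗ[ℂ] H) ⊔ LinearMap.range (N : H →ₗ[ℂ] H) := by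
    refine le_antisymm ?_ (sup_le ?_ ?_)
    · rintro _ ⟨x, rfl⟩
      exact Submodule.mem_sup.2 ⟨U x, ⟨x, rfl⟩, N x, ⟨x, rfl⟩, rfl⟩
    · rintro _ ⟨x, rfl⟩
      refine (mem_range_iff_of_isStarProjection pUN).2 ?_
      have := congr($(show (U + N) * U = U by
        rw [add_mul, hNU, hUV.projU.isIdempotentElem.eq, add_zero]) x)
      exact this
    · rintro _ ⟨x, rfl⟩
      refine (mem_range_iff_of_isStarProjection pUN).2 ?_
      have := congr($(show (U + N) * N = N by
        rw [add_mul, hUN, hN.isIdempotentElem.eq, zero_add]) x)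
      exact this
  have hinf : LinearMap.range (U : H →ₗ[ℂ] H) ⊓ LinearMap.range (N : H →ₗ[ℂ] H) = ⊥ := by
    rw [Submodule.eq_bot_iff]
    rintro x ⟨h1, h2⟩
    rw [SetLike.mem_coe, mem_range_iff_of_isStarProjection hUV.projU] at h1
    rw [SetLike.mem_coe, mem_range_iff_of_isStarProjection hN] at h2
    have := congr($hUN x)
    rw [mul_apply_eq_comp, h2, h1] at this
    exact this
  have hrk : rk (U + N) = rk U + rk N := by
    have := Submodule.finrank_sup_add_finrank_inf_eq (LinearMap.range (U : H →ₗ[ℂ] H))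
      (LinearMap.range (N : H →ₗ[ℂ] H))
    rw [hinf, finrank_bot, add_zero] at this
    rw [rk, hrange, this, rk, rk]
  have hfr : FiniteRank (U + N) := by
    rw [FiniteRank, hrange]; infer_instance
  -- Adding `N` to both `P` and `U` leaves the remainder `P - U` unchanged.
  have h' : IsDefectPair (P + N) Q (U + N) V := by
    refine ⟨pPN, hQ, pUN, hUV.projV, ?_, hUV.mulV, hfr, hUV.finV, ?_⟩
    · rw [add_mul, mul_add, mul_add, hUV.mulU, hPN, hNU, hN.isIdempotentElem.eq]; simp
    · rw [add_sub_add_right_eq_sub]; exact hUV.norm_lt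
  rw [h'.isFredholm_and_pairIndex_eq.2, hUV.isFredholm_and_pairIndex_eq.2, hrk]
  push_cast
  ring

end PairIndexConstant

/-! ### Unbounded selfadjoint operators through their graphs, and their resolvents at `±i`. -/

section Unbounded

variable {H : Type*} [NormedAddCommGroup H] [InnerProductSpace ℂ H]

theorem mem_graph_iff_exists {T : H →ₗ.[ℂ] H} {x y : H} :
    (x, y) ∈ T.graph ↔ ∃ h : x ∈ T.domain, T ⟨x, h⟩ = y := by
  rw [LinearPMap.mem_graph_iff]
  constructor
  · rintro ⟨z, hz, hy⟩
    subst hz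
    exact ⟨z.2, hy⟩
  · rintro ⟨h, hy⟩
    exact ⟨⟨x, h⟩, rfl, hy⟩

theorem isBoundedInverse_iff {T : H →ₗ.[ℂ] H} {S : H →L[ℂ] H} :
    IsBoundedInverse T S ↔
      (∀ x y, (x, y) ∈ T.graph → S y = x) ∧ ∀ y, (S y, y) ∈ T.graph := by
  simp only [IsBoundedInverse, mem_graph_iff_exists]
  refine and_congr ⟨?_, ?_⟩ Iff.rfl
  · rintro h x _ ⟨hx, rfl⟩
    exact h ⟨x, hx⟩
  · intro h x
    exact h x _ ⟨x.2, rfl⟩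

theorem isComposition_iff {T : H →ₗ.[ℂ] H} {S C : H →L[ℂ] H} :
    IsComposition T S C ↔ ∀ y, (S y, C y) ∈ T.graph := by
  simp only [IsComposition, mem_graph_iff_exists, eq_comm]

theorem graph_unique {T : H →ₗ.[ℂ] H} {x y y' : H} (h : (x, y) ∈ T.graph)
    (h' : (x, y') ∈ T.graph) : y = y' := by
  obtain ⟨hx, rfl⟩ := mem_graph_iff_exists.1 h
  obtain ⟨hx', rfl⟩ := mem_graph_iff_exists.1 h'
  rfl

theorem mem_graph_shift {D : H →ₗ.[ℂ] H} {z : ℂ} {x y : H} :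
    (x, y) ∈ (shift D z).graph ↔ (x, y - z • x) ∈ D.graph := by
  rw [mem_graph_iff_exists, mem_graph_iff_exists]
  refine ⟨fun ⟨h, e⟩ => ⟨h, ?_⟩, fun ⟨h, e⟩ => ⟨h, ?_⟩⟩
  · rw [← e]
    simp only [shift, LinearPMap.vadd_apply]
    simp
  · simp only [shift, LinearPMap.vadd_apply]
    rw [e]
    simp

theorem mem_graph_add {D K : H →ₗ.[ℂ] H} {x y : H} :
    (x, y) ∈ (D + K).graph ↔
      ∃ u v, (x, u) ∈ D.graph ∧ (x, v) ∈ K.graph ∧ y = u + v := by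
  constructor
  · intro h
    obtain ⟨hx, rfl⟩ := mem_graph_iff_exists.1 h
    exact ⟨D ⟨x, hx.1⟩, K ⟨x, hx.2⟩, mem_graph_iff_exists.2 ⟨hx.1, rfl⟩,
      mem_graph_iff_exists.2 ⟨hx.2, rfl⟩, LinearPMap.add_apply ..⟩
  · rintro ⟨u, v, hu, hv, rfl⟩
    obtain ⟨hx, rfl⟩ := mem_graph_iff_exists.1 hu
    obtain ⟨hx', rfl⟩ := mem_graph_iff_exists.1 hv
    exact mem_graph_iff_exists.2 ⟨⟨hx, hx'⟩, LinearPMap.add_apply ..⟩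

theorem IsInvertible.isBoundedInverse {T : H →ₗ.[ℂ] H} (h : IsInvertible T) :
    IsBoundedInverse T (boundedInv T) := by
  unfold boundedInv
  rw [dif_pos h]
  exact h.choose_spec

theorem IsComposition.unique {T : H →ₗ.[ℂ] H} {S C C' : H →L[ℂ] H}
    (h : IsComposition T S C) (h' : IsComposition T S C') : C = C' := by
  ext y
  exact graph_unique (isComposition_iff.1 h y) (isComposition_iff.1 h' y)

theorem IsComposition.boundedComp_eq {T : H →ₗ.[ℂ] H} {S C : H →L[ℂ] H}
    (h : IsComposition T S C) : boundedComp T S = C := by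
  have h' : ∃ C, IsComposition T S C := ⟨C, h⟩
  unfold boundedComp
  rw [dif_pos h']
  exact h'.choose_spec.unique h

variable [CompleteSpace H]

theorem inner_eq_of_mem_graph {D : H →ₗ.[ℂ] H} (hD : IsSelfAdjoint D) {x y x' y' : H}
    (h : (x, y) ∈ D.graph) (h' : (x', y') ∈ D.graph) : inner ℂ y x' = inner ℂ x y' := by
  obtain ⟨hx, rfl⟩ := mem_graph_iff_exists.1 h
  obtain ⟨hx', rfl⟩ := mem_graph_iff_exists.1 h'
  have := LinearPMap.adjoint_isFormalAdjoint (T := D) hD.dense_domain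
  rw [LinearPMap.isSelfAdjoint_def.1 hD] at this
  exact this ⟨x, hx⟩ ⟨x', hx'⟩

theorem mem_graph_of_inner_eq {D : H →ₗ.[ℂ] H} (hD : IsSelfAdjoint D) {x y : H}
    (h : ∀ x' y', (x', y') ∈ D.graph → inner ℂ y x' = inner ℂ x y') : (x, y) ∈ D.graph := by
  have h2 : ∀ u : D.domain, inner ℂ y (u : H) = inner ℂ x (D u) :=
    fun u => h u (D u) (D.mem_graph u)
  have hx : x ∈ D.adjoint.domain := LinearPMap.mem_adjoint_domain_of_exists _ ⟨y, h2⟩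
  have h3 : D.adjoint ⟨x, hx⟩ = y :=
    LinearPMap.adjoint_apply_eq hD.dense_domain ⟨x, hx⟩ h2
  have : (x, y) ∈ D.adjoint.graph := mem_graph_iff_exists.2 ⟨hx, h3⟩
  rwa [LinearPMap.isSelfAdjoint_def.1 hD] at this

/-- If `x` is in the domain of the adjoint with value `y`, then `x - S y` is orthogonal to the range
of `B`, which is all of `H`. -/
theorem isSelfAdjoint_of_isInvertible {B : H →ₗ.[ℂ] H} (hs : B.IsFormalAdjoint B)
    (hd : Dense (B.domain : Set H)) (hB : IsInvertible B) : IsSelfAdjoint B := by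
  obtain ⟨S, hS⟩ := hB
  rw [isBoundedInverse_iff] at hS
  rw [LinearPMap.isSelfAdjoint_def]
  refine (LinearPMap.eq_of_le_of_domain_eq (hs.le_adjoint hd) ?_).symm
  refine le_antisymm (hs.le_adjoint hd).1 fun x hx => ?_
  set y := B.adjoint ⟨x, hx⟩
  obtain ⟨hx0, e0⟩ := mem_graph_iff_exists.1 (hS.2 y)
  have key : ∀ v : H, inner ℂ (x - S y) v = 0 := by
    intro v
    obtain ⟨hv, ev⟩ := mem_graph_iff_exists.1 (hS.2 v)
    have h1 := LinearPMap.adjoint_isFormalAdjoint hd ⟨x, hx⟩ ⟨S v, hv⟩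
    have h2 := hs ⟨S y, hx0⟩ ⟨S v, hv⟩
    rw [ev] at h1 h2
    rw [e0] at h2
    rw [inner_sub_left, ← h1, ← h2]
    exact sub_self _
  have : x = S y := sub_eq_zero.1 (inner_self_eq_zero.1 (key (x - S y)))
  rw [this]
  exact hx0

theorem norm_sq_add_smul_of_mem_graph {D : H →ₗ.[ℂ] H} (hD : IsSelfAdjoint D) {z : ℂ}
    (hz : (starRingEnd ℂ) z = -z) (hz1 : ‖z‖ = 1) {x y : H} (h : (x, y) ∈ D.graph) :
    ‖y + z • x‖ ^ 2 = ‖y‖ ^ 2 + ‖x‖ ^ 2 := by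
  have h1 : (inner ℂ y (z • x)).re = 0 := by
    have h2 := inner_eq_of_mem_graph hD h h
    have h3 : (starRingEnd ℂ) (inner ℂ y (z • x)) = -(inner ℂ y (z • x)) := by
      rw [inner_smul_right, map_mul, inner_conj_symm, hz, ← h2]
      ring
    have h4 := congrArg Complex.re h3
    simp only [Complex.conj_re, Complex.neg_re] at h4
    linarith
  have h5 := norm_add_sq (𝕜 := ℂ) y (z • x)
  simp only [RCLike.re_to_complex] at h5
  rw [h5, h1, norm_smul, hz1]
  ring

/-- The conditions on `z` mean `z = ±i`. The map `(x, y) ↦ y + z x` is bounded below on the complete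
graph, so its range is closed. A vector `w` orthogonal to the range would have `(w, z w)` in the
graph, which the norm identity for `-z` forbids unless `w = 0`. -/
theorem isInvertible_shift {D : H →ₗ.[ℂ] H} (hD : IsSelfAdjoint D) {z : ℂ}
    (hz : (starRingEnd ℂ) z = -z) (hz1 : ‖z‖ = 1) : IsInvertible (shift D z) := by
  have hcl : IsClosed (D.graph : Set (H × H)) := hD.isClosed
  have : CompleteSpace D.graph := hcl.completeSpace_coe
  let g : D.graph →L[ℂ] H :=
    ((ContinuousLinearMap.snd ℂ H H) + z • (ContinuousLinearMap.fst ℂ H H)) ∘L D.graph.subtypeL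
  have hg : ∀ p : D.graph, g p = p.1.2 + z • p.1.1 := fun p => rfl
  have hn : ∀ p : D.graph, ‖p‖ ≤ 1 * ‖g p‖ := by
    rintro ⟨⟨x, y⟩, h⟩
    have h1 := norm_sq_add_smul_of_mem_graph hD hz hz1 h
    rw [hg, one_mul]
    change ‖(x, y)‖ ≤ ‖y + z • x‖
    rw [Prod.norm_mk]
    apply max_le
    · exact le_of_sq_le_sq (by nlinarith [sq_nonneg ‖y‖]) (norm_nonneg _)
    · exact le_of_sq_le_sq (by nlinarith [sq_nonneg ‖x‖]) (norm_nonneg _)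
  have hanti : AntilipschitzWith 1 g :=
    AddMonoidHomClass.antilipschitz_of_bound g (K := 1) (by simpa using hn)
  have hclr : IsClosed (LinearMap.range (g : D.graph →ₗ[ℂ] H) : Set H) := by
    rw [LinearMap.coe_range]
    exact hanti.isClosed_range g.uniformContinuous
  have hrange : LinearMap.range (g : D.graph →ₗ[ℂ] H) = ⊤ := by
    have : CompleteSpace (LinearMap.range (g : D.graph →ₗ[ℂ] H)) := hclr.completeSpace_coe
    rw [← Submodule.orthogonal_eq_bot_iff, Submodule.eq_bot_iff]
    intro w hw
    rw [Submodule.mem_orthogonal] at hw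
    have h1 : (w, z • w) ∈ D.graph := by
      apply mem_graph_of_inner_eq hD
      intro x' y' h'
      have h2 : inner ℂ (y' + z • x') w = 0 := hw _ ⟨⟨(x', y'), h'⟩, rfl⟩
      have h3 : inner ℂ w (y' + z • x') = 0 := by rw [← inner_conj_symm, h2, map_zero]
      rw [inner_add_right, inner_smul_right] at h3
      rw [inner_smul_left, hz]
      linear_combination -h3
    have h4 := norm_sq_add_smul_of_mem_graph hD (z := -z) (by simp [hz]) (by simpa using hz1) h1
    rw [neg_smul, add_neg_cancel, norm_zero] at h4
    have h5 : ‖w‖ ^ 2 = 0 := by nlinarith [sq_nonneg ‖z • w‖, sq_nonneg ‖w‖]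
    simpa using h5
  have hker : LinearMap.ker (g : D.graph →ₗ[ℂ] H) = ⊥ := LinearMap.ker_eq_bot.2 hanti.injective
  let e := ContinuousLinearEquiv.ofBijective g hker hrange
  have hge : ∀ y, g (e.symm y) = y := fun y =>
    ContinuousLinearEquiv.ofBijective_apply_symm_apply g hker hrange y
  have heg : ∀ p, e.symm (g p) = p := fun y =>
    ContinuousLinearEquiv.ofBijective_symm_apply_apply g hker hrange y
  refine ⟨(ContinuousLinearMap.fst ℂ H H) ∘L D.graph.subtypeL ∘L (e.symm : H →L[ℂ] D.graph), ?_⟩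
  rw [isBoundedInverse_iff]
  constructor
  · intro x y hxy
    rw [mem_graph_shift] at hxy
    have h1 := heg ⟨(x, y - z • x), hxy⟩
    rw [hg] at h1
    simp only [sub_add_cancel] at h1
    change (e.symm y).1.1 = x
    rw [h1]
  · intro y
    rw [mem_graph_shift]
    have h1 := hge y
    rw [hg] at h1
    change ((e.symm y).1.1, y - z • (e.symm y).1.1) ∈ D.graph
    have h2 : (e.symm y).1.2 = y - z • (e.symm y).1.1 := eq_sub_of_add_eq h1
    rw [← h2]
    exact (e.symm y).2

theorem conj_I_eq : (starRingEnd ℂ) Complex.I = -Complex.I := Complex.conj_I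

theorem resolv_spec {D : H →ₗ.[ℂ] H} (hD : IsSelfAdjoint D) {z : ℂ}
    (hz : (starRingEnd ℂ) z = -z) (hz1 : ‖z‖ = 1) :
    (∀ x y, (x, y) ∈ D.graph → resolv D z (y + z • x) = x) ∧
      ∀ y, (resolv D z y, y - z • resolv D z y) ∈ D.graph := by
  have := isBoundedInverse_iff.1 (isInvertible_shift hD hz hz1).isBoundedInverse
  refine ⟨fun x y h => this.1 _ _ ?_, fun y => mem_graph_shift.1 (this.2 y)⟩
  rw [mem_graph_shift]
  simpa using h

theorem resolv_I_apply {D : H →ₗ.[ℂ] H} (hD : IsSelfAdjoint D) {x y : H}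
    (h : (x, y) ∈ D.graph) : resolv D Complex.I (y + Complex.I • x) = x :=
  (resolv_spec hD (by simp) (by simp)).1 x y h

theorem resolv_I_mem_graph {D : H →ₗ.[ℂ] H} (hD : IsSelfAdjoint D) (y : H) :
    (resolv D Complex.I y, y - Complex.I • resolv D Complex.I y) ∈ D.graph :=
  (resolv_spec hD (by simp) (by simp)).2 y

theorem resolv_negI_apply {D : H →ₗ.[ℂ] H} (hD : IsSelfAdjoint D) {x y : H}
    (h : (x, y) ∈ D.graph) : resolv D (-Complex.I) (y - Complex.I • x) = x := by
  have := (resolv_spec hD (z := -Complex.I) (by simp) (by simp)).1 x y h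
  rwa [neg_smul, ← sub_eq_add_neg] at this

theorem resolv_negI_mem_graph {D : H →ₗ.[ℂ] H} (hD : IsSelfAdjoint D) (y : H) :
    (resolv D (-Complex.I) y, y + Complex.I • resolv D (-Complex.I) y) ∈ D.graph := by
  have := (resolv_spec hD (z := -Complex.I) (by simp) (by simp)).2 y
  rwa [neg_smul, sub_neg_eq_add] at this

theorem star_resolv {D : H →ₗ.[ℂ] H} (hD : IsSelfAdjoint D) :
    star (resolv D Complex.I) = resolv D (-Complex.I) := by
  rw [ContinuousLinearMap.star_eq_adjoint]
  symm
  rw [ContinuousLinearMap.eq_adjoint_iff]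
  intro v u
  have h := inner_eq_of_mem_graph hD (resolv_negI_mem_graph hD v) (resolv_I_mem_graph hD u)
  rw [inner_add_left, inner_smul_left, inner_sub_right, inner_smul_right, conj_I_eq] at h
  linear_combination -h

/-- The resolvent identity at `±i`. With its mirror image it gives normality of the resolvent, and
it confines the spectrum to `resolvCircle`. -/
theorem resolv_sub_star {D : H →ₗ.[ℂ] H} (hD : IsSelfAdjoint D) :
    star (resolv D Complex.I) - resolv D Complex.I =
      (2 * Complex.I) • (resolv D Complex.I * star (resolv D Complex.I)) := by
  rw [star_resolv hD]
  ext v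
  have h := resolv_I_apply hD (resolv_negI_mem_graph hD v)
  rw [add_assoc, ← two_smul ℂ, smul_smul, map_add, map_smul] at h
  simp only [sub_apply, smul_apply, mul_apply_eq_comp]
  exact sub_eq_of_eq_add' h.symm

theorem resolv_sub_star' {D : H →ₗ.[ℂ] H} (hD : IsSelfAdjoint D) :
    star (resolv D Complex.I) - resolv D Complex.I =
      (2 * Complex.I) • (star (resolv D Complex.I) * resolv D Complex.I) := by
  rw [star_resolv hD]
  ext v
  have h := resolv_negI_apply hD (resolv_I_mem_graph hD v)
  rw [sub_sub, ← two_smul ℂ, smul_smul, map_sub, map_smul] at h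
  simp only [sub_apply, smul_apply, mul_apply_eq_comp]
  rw [sub_eq_iff_eq_add] at h ⊢
  rw [h, add_comm]

theorem isStarNormal_resolv {D : H →ₗ.[ℂ] H} (hD : IsSelfAdjoint D) :
    IsStarNormal (resolv D Complex.I) := by
  refine ⟨?_⟩
  have h := (resolv_sub_star' hD).symm.trans (resolv_sub_star hD)
  exact smul_right_injective _ (by simp : (2 * Complex.I : ℂ) ≠ 0) h

theorem resolv_injective {D : H →ₗ.[ℂ] H} (hD : IsSelfAdjoint D) {y : H}
    (h : resolv D Complex.I y = 0) : y = 0 := by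
  have h1 := resolv_I_mem_graph hD y
  rw [h, smul_zero, sub_zero] at h1
  exact graph_unique h1 (Submodule.zero_mem _)

theorem star_resolv_injective {D : H →ₗ.[ℂ] H} (hD : IsSelfAdjoint D) {y : H}
    (h : star (resolv D Complex.I) y = 0) : y = 0 := by
  rw [star_resolv hD] at h
  have h1 := resolv_negI_mem_graph hD y
  rw [h, smul_zero, add_zero] at h1
  exact graph_unique h1 (Submodule.zero_mem _)

theorem norm_resolv_le {D : H →ₗ.[ℂ] H} (hD : IsSelfAdjoint D) : ‖resolv D Complex.I‖ ≤ 1 := by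
  refine ContinuousLinearMap.opNorm_le_bound _ zero_le_one fun y => ?_
  have h := norm_sq_add_smul_of_mem_graph hD (z := Complex.I) (by simp) (by simp)
    (resolv_I_mem_graph hD y)
  rw [sub_add_cancel] at h
  rw [one_mul]
  exact le_of_sq_le_sq (by nlinarith [sq_nonneg ‖y - Complex.I • resolv D Complex.I y‖])
    (norm_nonneg _)

theorem resolv_injOn {D D' : H →ₗ.[ℂ] H} (hD : IsSelfAdjoint D) (hD' : IsSelfAdjoint D')
    (h : resolv D Complex.I = resolv D' Complex.I) : D = D' := by
  have key : ∀ {D D' : H →ₗ.[ℂ] H}, IsSelfAdjoint D → IsSelfAdjoint D' →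
      resolv D Complex.I = resolv D' Complex.I → D.graph ≤ D'.graph := by
    rintro D D' hD hD' h ⟨x, y⟩ hxy
    have h1 := resolv_I_mem_graph hD' (y + Complex.I • x)
    rw [← h, resolv_I_apply hD hxy] at h1
    simpa using h1
  exact LinearPMap.eq_of_eq_graph (le_antisymm (key hD hD' h) (key hD' hD h.symm))

/-- Closed graph theorem: symmetry of `K` on a dense domain makes the graph of `K S` closed. So
`boundedComp` takes its intended value rather than the default `0`. -/
theorem exists_isComposition {K : H →ₗ.[ℂ] H} (hK : K.IsFormalAdjoint K)
    (hd : Dense (K.domain : Set H)) {S : H →L[ℂ] H} (hS : ∀ y, S y ∈ K.domain) :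
    ∃ C, IsComposition K S C := by
  let g : H →ₗ[ℂ] H := K.toFun ∘ₗ ((S : H →ₗ[ℂ] H).codRestrict K.domain hS)
  have hg : ∀ y, g y = K ⟨S y, hS y⟩ := fun y => rfl
  have hcont : Continuous g := by
    refine g.continuous_of_seq_closed_graph fun u x y hu hgu => ?_
    refine hd.eq_of_inner_left (𝕜 := ℂ) ?_
    intro v hv
    have h1 : Tendsto (fun n => inner ℂ (g (u n)) v) atTop (𝓝 (inner ℂ y v)) :=
      hgu.inner tendsto_const_nhds
    have h2 : Tendsto (fun n => inner ℂ (S (u n)) (K ⟨v, hv⟩)) atTop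
        (𝓝 (inner ℂ (S x) (K ⟨v, hv⟩))) :=
      ((S.continuous.tendsto x).comp hu).inner tendsto_const_nhds
    have h3 : ∀ w, inner ℂ (g w) v = inner ℂ (S w) (K ⟨v, hv⟩) := fun w =>
      hK ⟨_, hS w⟩ ⟨v, hv⟩
    simp only [h3] at h1
    rw [h3]
    exact tendsto_nhds_unique h1 h2
  exact ⟨⟨g, hcont⟩, fun y => ⟨hS y, hg y⟩⟩

theorem exists_isComposition_resolv {D K : H →ₗ.[ℂ] H} (hD : IsSelfAdjoint D)
    (hK : K.IsFormalAdjoint K) (hd : D.domain ≤ K.domain) :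
    ∃ C, IsComposition K (resolv D Complex.I) C :=
  exists_isComposition hK (hD.dense_domain.mono hd) fun y =>
    hd (mem_graph_iff_exists.1 (resolv_I_mem_graph hD y)).1

end Unbounded

/-! ### The functional calculus `f(D)` on the circle of resolvent points. -/

section Calculus

/-- The function on the plane whose value at `(x + i)⁻¹` is `f x`. -/
noncomputable def toC (f : ℝ → ℝ) : ℂ → ℂ := fun z =>
  if z = 0 then 0 else ((f (z⁻¹ - Complex.I).re : ℝ) : ℂ)

/-- The point `(x + i)⁻¹` of the plane. -/
noncomputable def pt (x : ℝ) : ℂ := ((x : ℂ) + Complex.I)⁻¹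

/-- The circle formed by the points `(x + i)⁻¹` and `0`. -/
def resolvCircle : Set ℂ := {z | z.im = -Complex.normSq z}

/-- A continuous function on the real line that vanishes at infinity. -/
def IsC0 (f : ℝ → ℝ) : Prop := Continuous f ∧ Tendsto f (cocompact ℝ) (𝓝 0)

theorem ofReal_add_I_ne_zero (x : ℝ) : (x : ℂ) + Complex.I ≠ 0 := by
  intro h
  have := congrArg Complex.im h
  simp at this

theorem pt_ne_zero (x : ℝ) : pt x ≠ 0 := inv_ne_zero (ofReal_add_I_ne_zero x)

theorem toC_zero (f : ℝ → ℝ) : toC f 0 = 0 := if_pos rfl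

theorem toC_pt (f : ℝ → ℝ) (x : ℝ) : toC f (pt x) = f x := by
  unfold toC
  rw [if_neg (pt_ne_zero x)]
  simp [pt]

theorem exists_pt_eq {z : ℂ} (hz : z ∈ resolvCircle) (h0 : z ≠ 0) : ∃ x, pt x = z := by
  refine ⟨z⁻¹.re, ?_⟩
  have h : ((z⁻¹.re : ℝ) : ℂ) + Complex.I = z⁻¹ := by
    apply Complex.ext
    · simp
    · have hn : Complex.normSq z ≠ 0 := by simpa using h0
      have hz' : z.im = -Complex.normSq z := hz
      simp only [Complex.add_im, Complex.ofReal_im, Complex.I_im, zero_add, Complex.inv_im, hz']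
      field_simp
  rw [pt, h, inv_inv]

theorem isCompact_resolvCircle : IsCompact resolvCircle := by
  refine Metric.isCompact_of_isClosed_isBounded ?_ ?_
  · exact isClosed_eq Complex.continuous_im Complex.continuous_normSq.neg
  · refine (Metric.isBounded_closedBall (x := (0 : ℂ)) (r := 1)).subset fun z hz => ?_
    have hz' : z.im = -Complex.normSq z := hz
    rw [Complex.normSq_eq_norm_sq] at hz'
    have h1 := Complex.abs_im_le_norm z
    rw [hz', abs_neg, abs_of_nonneg (sq_nonneg _)] at h1
    rw [mem_closedBall_zero_iff]
    nlinarith [norm_nonneg z]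

theorem norm_pt (x : ℝ) : ‖pt x‖⁻¹ ≤ |x| + 1 := by
  rw [pt, norm_inv, inv_inv]
  refine (norm_add_le _ _).trans ?_
  simp

/-- Away from `0` this is a composition of continuous maps. Points `(x + i)⁻¹` near `0` have `|x|`
large by `norm_pt`, so there `f` is small. -/
theorem IsC0.continuousOn_toC {f : ℝ → ℝ} (hf : IsC0 f) : ContinuousOn (toC f) resolvCircle := by
  intro z hz
  by_cases h0 : z = 0
  · subst h0
    rw [Metric.continuousWithinAt_iff]
    intro ε hε
    have h1 := Metric.tendsto_nhds.1 hf.2 ε hε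
    rw [Filter.Eventually, mem_cocompact] at h1
    obtain ⟨K, hK, hK'⟩ := h1
    obtain ⟨M, hM0, hM⟩ := hK.isBounded.exists_pos_norm_le
    refine ⟨(M + 1)⁻¹, by positivity, fun {w} hw hw' => ?_⟩
    rw [toC_zero]
    by_cases hw0 : w = 0
    · rw [hw0, toC_zero, dist_self]
      exact hε
    · obtain ⟨x, rfl⟩ := exists_pt_eq hw hw0
      rw [toC_pt]
      have hx : x ∉ K := by
        intro hx
        have h2 := hM x hx
        rw [dist_zero_right] at hw'
        have h3 := norm_pt x
        have h4 : 0 < ‖pt x‖ := norm_pos_iff.2 hw0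
        have h5 := (lt_inv_comm₀ h4 (by positivity)).1 hw'
        rw [Real.norm_eq_abs] at h2
        linarith
      have h2 := hK' hx
      simp only [Set.mem_ofPred_eq, dist_zero_right] at h2
      simpa using h2
  · have h1 : ContinuousAt (fun z : ℂ => ((f (z⁻¹ - Complex.I).re : ℝ) : ℂ)) z := by
      refine Complex.continuous_ofReal.continuousAt.comp ?_
      refine hf.1.continuousAt.comp ?_
      refine Complex.continuous_re.continuousAt.comp ?_
      exact (continuousAt_inv₀ h0).sub continuousAt_const
    refine (h1.congr ?_).continuousWithinAt
    filter_upwards [isOpen_ne.mem_nhds h0] with w hw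
    unfold toC
    rw [if_neg hw]

theorem IsC0.of_hasCompactSupport {f : ℝ → ℝ} (hf : Continuous f) (h : HasCompactSupport f) :
    IsC0 f := ⟨hf, h.is_zero_at_infty⟩

theorem isC0_of_abs_le {f : ℝ → ℝ} (hf : Continuous f) {C M : ℝ}
    (h : ∀ x, M ≤ |x| → |f x| ≤ C / |x|) : IsC0 f := by
  refine ⟨hf, ?_⟩
  have h1 : Tendsto (fun x : ℝ => |x|) (cocompact ℝ) atTop := tendsto_norm_cocompact_atTop
  have h2 : Tendsto (fun x : ℝ => C / |x|) (cocompact ℝ) (𝓝 0) :=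
    (tendsto_const_nhds (x := C)).div_atTop h1
  refine squeeze_zero_norm' ?_ h2
  filter_upwards [h1.eventually (eventually_ge_atTop M)] with x hx
  exact h x hx

variable {H : Type*} [NormedAddCommGroup H] [InnerProductSpace ℂ H] [CompleteSpace H]

/-- The spectrum of a selfadjoint operator. -/
def specSet (D : H →ₗ.[ℂ] H) : Set ℝ := {x | pt x ∈ spectrum ℂ (resolv D Complex.I)}

/-- The function `f` is continuous on the spectrum of `D` and vanishes at infinity there. -/
def IsC0On (D : H →ₗ.[ℂ] H) (f : ℝ → ℝ) : Prop :=
  ContinuousOn (toC f) (spectrum ℂ (resolv D Complex.I))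

theorem funcCalc_eq (D : H →ₗ.[ℂ] H) (f : ℝ → ℝ) :
    funcCalc D f = cfc (toC f) (resolv D Complex.I) := rfl

theorem continuous_pt : Continuous pt :=
  (Complex.continuous_ofReal.add continuous_const).inv₀ ofReal_add_I_ne_zero

theorem isClosed_specSet (D : H →ₗ.[ℂ] H) : IsClosed (specSet D) :=
  (spectrum.isClosed (resolv D Complex.I)).preimage continuous_pt

theorem spectrum_subset_resolvCircle {D : H →ₗ.[ℂ] H} (hD : IsSelfAdjoint D) :
    spectrum ℂ (resolv D Complex.I) ⊆ resolvCircle := by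
  have := isStarNormal_resolv hD
  set R := resolv D Complex.I with hR
  have h1 : cfc (fun z : ℂ => star z - z) R = star R - R := by
    rw [cfc_sub (fun z : ℂ => star z) (fun z => z) R, cfc_star_id (R := ℂ) (a := R), cfc_id' ℂ R]
  have h2 : cfc (fun z : ℂ => (2 * Complex.I) • (z * star z)) R =
      (2 * Complex.I) • (R * star R) := by
    rw [cfc_smul (2 * Complex.I) (fun z : ℂ => z * star z) R,
      cfc_mul (fun z : ℂ => z) (fun z => star z) R, cfc_star_id (R := ℂ) (a := R), cfc_id' ℂ R]
  have h3 : cfc (fun z : ℂ => star z - z) R = cfc (fun z : ℂ => (2 * Complex.I) • (z * star z)) R := by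
    rw [h1, h2, resolv_sub_star hD]
  have h4 := (cfc_eq_cfc_iff_eqOn (R := ℂ) (a := R) (f := fun z : ℂ => star z - z)
    (g := fun z : ℂ => (2 * Complex.I) • (z * star z)) (hf := by fun_prop)
    (hg := by fun_prop)).1 h3
  intro z hz
  have h5 := h4 hz
  have h6 := congrArg Complex.im h5
  simp only [RCLike.star_def, Complex.mul_conj, smul_eq_mul] at h6
  simp at h6
  change z.im = -Complex.normSq z
  linarith

theorem forall_mem_spectrum {D : H →ₗ.[ℂ] H} (hD : IsSelfAdjoint D) {p : ℂ → Prop} (h0 : p 0)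
    (h : ∀ x ∈ specSet D, p (pt x)) : ∀ z ∈ spectrum ℂ (resolv D Complex.I), p z := by
  intro z hz
  by_cases hz0 : z = 0
  · rwa [hz0]
  · obtain ⟨x, rfl⟩ := exists_pt_eq (spectrum_subset_resolvCircle hD hz) hz0
    exact h x hz

theorem IsC0.isC0On {D : H →ₗ.[ℂ] H} (hD : IsSelfAdjoint D) {f : ℝ → ℝ} (hf : IsC0 f) :
    IsC0On D f := hf.continuousOn_toC.mono (spectrum_subset_resolvCircle hD)

theorem eqOn_toC {D : H →ₗ.[ℂ] H} (hD : IsSelfAdjoint D) {f g : ℝ → ℝ}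
    (h : ∀ x ∈ specSet D, f x = g x) :
    EqOn (toC f) (toC g) (spectrum ℂ (resolv D Complex.I)) :=
  forall_mem_spectrum hD (by rw [toC_zero, toC_zero]) fun x hx => by rw [toC_pt, toC_pt, h x hx]

theorem funcCalc_congr {D : H →ₗ.[ℂ] H} (hD : IsSelfAdjoint D) {f g : ℝ → ℝ}
    (h : ∀ x ∈ specSet D, f x = g x) : funcCalc D f = funcCalc D g :=
  cfc_congr (eqOn_toC hD h)

theorem toC_mul (f g : ℝ → ℝ) : toC (fun x => f x * g x) = fun z => toC f z * toC g z := by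
  ext z
  by_cases h : z = 0 <;> simp [toC, h]

theorem toC_add (f g : ℝ → ℝ) : toC (fun x => f x + g x) = fun z => toC f z + toC g z := by
  ext z
  by_cases h : z = 0 <;> simp [toC, h]

theorem toC_sub (f g : ℝ → ℝ) : toC (fun x => f x - g x) = fun z => toC f z - toC g z := by
  ext z
  by_cases h : z = 0 <;> simp [toC, h]

theorem toC_const_mul (c : ℝ) (f : ℝ → ℝ) :
    toC (fun x => c * f x) = fun z => (c : ℂ) • toC f z := by
  ext z
  by_cases h : z = 0 <;> simp [toC, h]

theorem star_toC (f : ℝ → ℝ) (z : ℂ) : star (toC f z) = toC f z := by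
  by_cases h : z = 0 <;> simp [toC, h]

variable {D : H →ₗ.[ℂ] H} {f g : ℝ → ℝ}

theorem IsC0On.mul (hf : IsC0On D f) (hg : IsC0On D g) : IsC0On D fun x => f x * g x := by
  unfold IsC0On
  rw [toC_mul]
  exact ContinuousOn.mul hf hg

theorem IsC0On.sub (hf : IsC0On D f) (hg : IsC0On D g) : IsC0On D fun x => f x - g x := by
  unfold IsC0On
  rw [toC_sub]
  exact ContinuousOn.sub hf hg

theorem IsC0On.const_mul (c : ℝ) (hf : IsC0On D f) : IsC0On D fun x => c * f x := by
  unfold IsC0On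
  rw [toC_const_mul]
  exact ContinuousOn.const_smul hf (c : ℂ)

theorem funcCalc_mul (hf : IsC0On D f) (hg : IsC0On D g) :
    funcCalc D (fun x => f x * g x) = funcCalc D f * funcCalc D g := by
  rw [funcCalc_eq, toC_mul, cfc_mul (toC f) (toC g) _ hf hg]
  rfl

theorem funcCalc_add (hf : IsC0On D f) (hg : IsC0On D g) :
    funcCalc D (fun x => f x + g x) = funcCalc D f + funcCalc D g := by
  rw [funcCalc_eq, toC_add, cfc_add _ (toC f) (toC g) (hf := hf) (hg := hg)]
  rfl

theorem funcCalc_sub (hf : IsC0On D f) (hg : IsC0On D g) :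
    funcCalc D (fun x => f x - g x) = funcCalc D f - funcCalc D g := by
  rw [funcCalc_eq, toC_sub, cfc_sub (toC f) (toC g) (hf := hf) (hg := hg)]
  rfl

theorem funcCalc_const_mul (c : ℝ) (hf : IsC0On D f) :
    funcCalc D (fun x => c * f x) = (c : ℂ) • funcCalc D f := by
  rw [funcCalc_eq, toC_const_mul, cfc_smul (c : ℂ) (toC f) (hf := hf)]
  rfl

theorem funcCalc_eq_zero (hD : IsSelfAdjoint D) (h : ∀ x ∈ specSet D, f x = 0) :
    funcCalc D f = 0 := by
  have := isStarNormal_resolv hD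
  rw [funcCalc_eq, cfc_congr (g := fun _ => 0), cfc_const_zero]
  exact forall_mem_spectrum hD (toC_zero f) fun x hx => by rw [toC_pt, h x hx, Complex.ofReal_zero]

theorem isSelfAdjoint_funcCalc (D : H →ₗ.[ℂ] H) (f : ℝ → ℝ) : IsSelfAdjoint (funcCalc D f) := by
  rw [funcCalc_eq, IsSelfAdjoint, ← cfc_star]
  exact cfc_congr fun z _ => star_toC f z

theorem commute_funcCalc (D : H →ₗ.[ℂ] H) (f g : ℝ → ℝ) :
    Commute (funcCalc D f) (funcCalc D g) := cfc_commute_cfc _ _ _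

theorem commute_resolv_funcCalc (hD : IsSelfAdjoint D) (f : ℝ → ℝ) :
    Commute (resolv D Complex.I) (funcCalc D f) := by
  have := isStarNormal_resolv hD
  have h := cfc_commute_cfc (fun z : ℂ => z) (toC f) (resolv D Complex.I)
  rwa [cfc_id' ℂ (resolv D Complex.I)] at h

open scoped ComplexOrder in
theorem funcCalc_nonneg (hD : IsSelfAdjoint D) (h : ∀ x ∈ specSet D, 0 ≤ f x) :
    0 ≤ funcCalc D f := by
  rw [funcCalc_eq]
  exact cfc_nonneg (forall_mem_spectrum hD (by rw [toC_zero]) fun x hx => by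
    rw [toC_pt]; exact_mod_cast h x hx)

theorem norm_funcCalc_le (hD : IsSelfAdjoint D) {c : ℝ} (hc : 0 ≤ c)
    (h : ∀ x ∈ specSet D, |f x| ≤ c) : ‖funcCalc D f‖ ≤ c := by
  rw [funcCalc_eq]
  exact norm_cfc_le hc (forall_mem_spectrum hD (by rw [toC_zero]; simpa using hc) fun x hx => by
    rw [toC_pt]; simpa using h x hx)

theorem eq_zero_of_funcCalc_eq_zero (hD : IsSelfAdjoint D) (hf : IsC0On D f)
    (h : funcCalc D f = 0) : ∀ x ∈ specSet D, f x = 0 := by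
  have := isStarNormal_resolv hD
  intro x hx
  have h1 : cfc (toC f) (resolv D Complex.I) = cfc (fun _ : ℂ => (0 : ℂ)) (resolv D Complex.I) := by
    rw [cfc_const_zero]; exact h
  have h2 := (cfc_eq_cfc_iff_eqOn (R := ℂ) (hf := hf) (hg := continuousOn_const)).1 h1 hx
  simp only [toC_pt] at h2
  exact_mod_cast h2

/-- The constant `c` is kept apart because constants do not vanish at infinity. The assertion
amounts to `R (c + m(D) + i f(D)) = f(D)` for the resolvent `R`, an identity of functions on the
spectrum. -/
theorem funcCalc_mem_graph (hD : IsSelfAdjoint D) {m : ℝ → ℝ} {c : ℝ} (hf : IsC0On D f)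
    (hm : IsC0On D m) (h : ∀ x ∈ specSet D, x * f x = c + m x) (y : H) :
    (funcCalc D f y, (c : ℂ) • y + funcCalc D m y) ∈ D.graph := by
  have := isStarNormal_resolv hD
  have h1 : resolv D Complex.I * (cfc (fun z => (c : ℂ) + toC m z) (resolv D Complex.I) +
      Complex.I • funcCalc D f) = funcCalc D f := by
    have e1 : cfc (fun z => Complex.I • toC f z) (resolv D Complex.I) =
      Complex.I • funcCalc D f := cfc_smul Complex.I (toC f) _ hf
    have hc : ContinuousOn (fun z => (c : ℂ) + toC m z) (spectrum ℂ (resolv D Complex.I)) :=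
      continuousOn_const.add hm
    have hf' : ContinuousOn (fun z => Complex.I • toC f z) (spectrum ℂ (resolv D Complex.I)) :=
      hf.const_smul Complex.I
    rw [← e1, ← cfc_add (hf := hc) (hg := hf')]
    nth_rw 1 [← cfc_id' ℂ (resolv D Complex.I)]
    rw [← cfc_mul (fun z : ℂ => z) (fun z => (c : ℂ) + toC m z + Complex.I • toC f z) _
      continuousOn_id (hc.add hf'), funcCalc_eq]
    refine cfc_congr (forall_mem_spectrum hD (by simp [toC_zero]) fun x hx => ?_)
    change pt x * ((c : ℂ) + toC m (pt x) + Complex.I • toC f (pt x)) = toC f (pt x)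
    rw [toC_pt, toC_pt, pt, smul_eq_mul]
    have h2 : (x : ℂ) * f x = c + m x := by exact_mod_cast h x hx
    rw [← h2]
    field_simp [ofReal_add_I_ne_zero x]
  have h2 : cfc (fun z => (c : ℂ) + toC m z) (resolv D Complex.I) = (c : ℂ) • 1 + funcCalc D m := by
    rw [cfc_add _ (fun _ => (c : ℂ)) (toC m) (hf := continuousOn_const) (hg := hm),
      cfc_const (c : ℂ) (resolv D Complex.I),
      Algebra.algebraMap_eq_smul_one]
    rfl
  rw [h2] at h1
  have h3 := resolv_I_mem_graph hD (((c : ℂ) • 1 + funcCalc D m + Complex.I • funcCalc D f) y)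
  have h4 := congrArg (fun A : H →L[ℂ] H => A y) h1
  simp only [mul_apply_eq_comp] at h4
  rw [h4] at h3
  simpa using h3

end Calculus

/-! ### Strong continuity of `f(D)` in the parameter. -/

section StrongContinuity

variable {H : Type*} [NormedAddCommGroup H] [InnerProductSpace ℂ H] [CompleteSpace H]
  {T : Type*} [TopologicalSpace T]

/-- Structural induction over polynomials in `z` and its conjugate. The extension `F` to the plane
is needed because the functional calculus takes functions on all of `ℂ`. -/
theorem StrongCont.exists_approx_cfc {M : T → H →L[ℂ] H} (hM : StrongCont M)
    (hn : ∀ t, IsStarNormal (M t)) {s : Set ℂ} [CompactSpace s] (g : C(s, ℂ))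
    (hg : g ∈ (polynomialFunctions s).starClosure) :
    ∃ F : ℂ → ℂ, Continuous F ∧ (∀ z : s, F z = g z) ∧ StrongCont fun t => _root_.cfc F (M t) := by
  rw [polynomialFunctions.starClosure_eq_adjoin_X] at hg
  induction hg using StarAlgebra.adjoin_induction with
  | mem x hx =>
    rw [mem_singleton_iff] at hx
    subst hx
    refine ⟨fun z => z, continuous_id, fun z => by simp, ?_⟩
    convert hM using 2 with t
    have := hn t
    exact cfc_id' ℂ (M t)
  | algebraMap r =>
    refine ⟨fun _ => r, continuous_const, fun z => rfl, ?_⟩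
    convert StrongCont.const (T := T) (r • (1 : H →L[ℂ] H)) using 2 with t
    have := hn t
    rw [cfc_const r (M t), Algebra.algebraMap_eq_smul_one]
  | add x y _ _ hx hy =>
    obtain ⟨F, hF, hFx, hF'⟩ := hx
    obtain ⟨G, hG, hGx, hG'⟩ := hy
    refine ⟨fun z => F z + G z, hF.add hG, fun z => by simp [hFx, hGx], ?_⟩
    convert hF'.add hG' using 2 with t
    exact cfc_add (M t) F G (hF.continuousOn) (hG.continuousOn)
  | mul x y _ _ hx hy =>
    obtain ⟨F, hF, hFx, hF'⟩ := hx
    obtain ⟨G, hG, hGx, hG'⟩ := hy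
    refine ⟨fun z => F z * G z, hF.mul hG, fun z => by simp [hFx, hGx], ?_⟩
    convert hF'.mul hG' using 2 with t
    exact cfc_mul F G (M t) (hF.continuousOn) (hG.continuousOn)
  | star x _ hx =>
    obtain ⟨F, hF, hFx, hF'⟩ := hx
    refine ⟨fun z => Star.star (F z), continuous_star.comp hF, fun z => by simp [hFx], ?_⟩
    convert hF'.star using 2 with t
    exact cfc_star F (M t)

/-- All the spectra lie on one compact circle, so a Stone–Weierstrass approximation there is uniform
in `t`. -/
theorem StrongCont.funcCalc {D : T → H →ₗ.[ℂ] H} (hD : ∀ t, IsSelfAdjoint (D t))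
    (hR : StrongCont fun t => resolv (D t) Complex.I) {f : ℝ → ℝ} (hf : IsC0 f) :
    StrongCont fun t => funcCalc (D t) f := by
  have hn := fun t => isStarNormal_resolv (hD t)
  refine StrongCont.of_approx fun ε hε => ?_
  have : CompactSpace resolvCircle := isCompact_iff_compactSpace.1 isCompact_resolvCircle
  let g : C(resolvCircle, ℂ) := ⟨_, hf.continuousOn_toC.domRestrict⟩
  have hg : g ∈ (polynomialFunctions resolvCircle).starClosure.topologicalClosure := by
    rw [polynomialFunctions.starClosure_topologicalClosure]
    exact StarSubalgebra.mem_top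
  have hg' : g ∈ closure ((polynomialFunctions resolvCircle).starClosure : Set C(resolvCircle, ℂ)) :=
    hg
  obtain ⟨p, hp, hgp⟩ := Metric.mem_closure_iff.1 hg' ε hε
  obtain ⟨F, hF, hFp, hF'⟩ := hR.exists_approx_cfc hn p hp
  refine ⟨_, hF', fun t => ?_⟩
  have := hn t
  rw [funcCalc_eq, ← cfc_sub (hf := hf.isC0On (hD t)) (hg := hF.continuousOn)]
  refine norm_cfc_le hε.le fun z hz => ?_
  have hz' := spectrum_subset_resolvCircle (hD t) hz
  have h1 := hFp ⟨z, hz'⟩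
  simp only at h1
  rw [h1]
  have h2 := ContinuousMap.norm_coe_le_norm (g - p) ⟨z, hz'⟩
  rw [← dist_eq_norm] at h2
  exact (le_trans (le_of_eq rfl) h2).trans (by simpa [dist_eq_norm] using hgp.le)

end StrongContinuity

/-! ### Trapezoidal test functions. -/

section Hat

/-- The trapezoidal function with value `1` on `[-a, a]` and `0` outside `(-b, b)`. -/
noncomputable def hat (a b x : ℝ) : ℝ := max 0 (min 1 ((b - |x|) / (b - a)))

theorem continuous_hat (a b : ℝ) : Continuous (hat a b) := by
  unfold hat; fun_prop

theorem hat_nonneg (a b x : ℝ) : 0 ≤ hat a b x := le_max_left _ _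

theorem hat_le_one (a b x : ℝ) : hat a b x ≤ 1 := max_le zero_le_one (min_le_left _ _)

theorem hat_eq_one {a b x : ℝ} (hab : a < b) (hx : |x| ≤ a) : hat a b x = 1 := by
  have : 1 ≤ (b - |x|) / (b - a) := by
    rw [le_div_iff₀ (by linarith)]; linarith
  rw [hat, min_eq_left this]
  exact max_eq_right zero_le_one

theorem hat_eq_zero {a b x : ℝ} (hab : a < b) (hx : b ≤ |x|) : hat a b x = 0 := by
  have : (b - |x|) / (b - a) ≤ 0 := div_nonpos_of_nonpos_of_nonneg (by linarith) (by linarith)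
  rw [hat]
  exact max_eq_left ((min_le_right _ _).trans this)

theorem hasCompactSupport_of_abs {f : ℝ → ℝ} {b : ℝ} (h : ∀ x, b < |x| → f x = 0) :
    HasCompactSupport f := by
  refine HasCompactSupport.intro (isCompact_Icc (a := -b) (b := b)) fun x hx => h x ?_
  by_contra hb
  exact hx (abs_le.1 (not_lt.1 hb))

theorem isC0_hat {a b : ℝ} (hab : a < b) : IsC0 (hat a b) :=
  IsC0.of_hasCompactSupport (continuous_hat a b)
    (hasCompactSupport_of_abs (b := b) fun _ hx => hat_eq_zero hab hx.le)

theorem IsC0.mul_of_bounded {f g : ℝ → ℝ} (hf : IsC0 f) (hg : Continuous g) {C : ℝ}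
    (hC : ∀ x, |g x| ≤ C) : IsC0 fun x => f x * g x := by
  refine ⟨hf.1.mul hg, ?_⟩
  refine hf.2.zero_mul_isBoundedUnder_le ?_
  exact isBoundedUnder_of ⟨C, hC⟩

theorem IsC0.mul_hat {f : ℝ → ℝ} (hf : IsC0 f) (a b : ℝ) : IsC0 fun x => f x * hat a b x :=
  hf.mul_of_bounded (continuous_hat a b) (C := 1) fun x => by
    rw [abs_of_nonneg (hat_nonneg a b x)]; exact hat_le_one a b x

theorem IsC0.sub {f g : ℝ → ℝ} (hf : IsC0 f) (hg : IsC0 g) : IsC0 fun x => f x - g x :=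
  ⟨hf.1.sub hg.1, by simpa using hf.2.sub hg.2⟩

end Hat

/-! ### Spectral subspaces and spectral projections. -/

section SpectralSubspace

variable {H : Type*} [NormedAddCommGroup H] [InnerProductSpace ℂ H] [CompleteSpace H]
  {D : H →ₗ.[ℂ] H} {S : Set ℝ}

theorem mem_spectralSubspace {x : H} : x ∈ spectralSubspace D S ↔ ∀ f : ℝ → ℝ,
    Continuous f ∧ HasCompactSupport f ∧ (∀ s ∈ S, f s = 0) → funcCalc D f x = 0 := by
  simp [spectralSubspace, Submodule.mem_iInf]

theorem spectralSubspace_mono {S' : Set ℝ} (h : S ⊆ S') :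
    spectralSubspace D S ≤ spectralSubspace D S' := fun x hx => by
  rw [mem_spectralSubspace] at hx ⊢
  exact fun f hf => hx f ⟨hf.1, hf.2.1, fun s hs => hf.2.2 s (h hs)⟩

/-- The truncations of `f` converge to `f` uniformly. This extends the defining condition of
`spectralSubspace` from compactly supported functions to those vanishing at infinity. -/
theorem funcCalc_apply_eq_zero_of_hat (hD : IsSelfAdjoint D) {f : ℝ → ℝ} (hf : IsC0 f) {x : H}
    (h : ∀ n : ℕ, funcCalc D (fun s => f s * hat n (n + 1) s) x = 0) : funcCalc D f x = 0 := by
  have key : ∀ ε > 0, ‖funcCalc D f x‖ ≤ ε * ‖x‖ := by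
    intro ε hε
    have h1 := Metric.tendsto_nhds.1 hf.2 ε hε
    rw [Filter.Eventually, mem_cocompact] at h1
    obtain ⟨K, hK, hK'⟩ := h1
    obtain ⟨M, hM⟩ := hK.isBounded.exists_norm_le
    obtain ⟨n, hn⟩ := exists_nat_gt M
    have hn1 : (n : ℝ) < n + 1 := by linarith
    have h2 := funcCalc_sub (D := D) (hf.isC0On hD) ((hf.mul_hat n (n + 1)).isC0On hD)
    have h3 : funcCalc D f x = funcCalc D (fun s => f s - f s * hat n (n + 1) s) x := by
      rw [h2, sub_apply, h n, sub_zero]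
    rw [h3]
    refine ContinuousLinearMap.le_of_opNorm_le _ (norm_funcCalc_le hD hε.le fun s _ => ?_) x
    by_cases hs : |s| ≤ n
    · rw [hat_eq_one hn1 hs, mul_one, sub_self, abs_zero]
      exact hε.le
    · have hs' : s ∉ K := fun hsK => hs ((hM s hsK).trans hn.le)
      have h4 := hK' hs'
      simp only [Set.mem_ofPred_eq, dist_zero_right, Real.norm_eq_abs] at h4
      have h5 : f s - f s * hat n (n + 1) s = f s * (1 - hat n (n + 1) s) := by ring
      rw [h5, abs_mul, abs_of_nonneg (sub_nonneg.2 (hat_le_one n (n + 1) s))]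
      nlinarith [abs_nonneg (f s), hat_nonneg n (n + 1) s]
  have h0 : ‖funcCalc D f x‖ ≤ 0 := by
    by_contra hne
    rw [not_le] at hne
    have hx : 0 < ‖x‖ := by
      by_contra hx
      have := key 1 one_pos
      nlinarith [norm_nonneg x]
    have := key (‖funcCalc D f x‖ / (2 * ‖x‖)) (by positivity)
    have e : ‖funcCalc D f x‖ / (2 * ‖x‖) * ‖x‖ = ‖funcCalc D f x‖ / 2 := by
      field_simp
    linarith
  exact norm_le_zero_iff.1 h0

theorem funcCalc_apply_eq_zero (hD : IsSelfAdjoint D) {f : ℝ → ℝ} (hf : IsC0 f)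
    (h : ∀ s ∈ S, f s = 0) {x : H} (hx : x ∈ spectralSubspace D S) : funcCalc D f x = 0 := by
  rw [mem_spectralSubspace] at hx
  refine funcCalc_apply_eq_zero_of_hat hD hf fun n => hx _ ⟨(hf.mul_hat _ _).1, ?_, fun s hs => ?_⟩
  · exact hasCompactSupport_of_abs (b := n + 1) fun s hs => by
      rw [hat_eq_zero (by linarith) hs.le, mul_zero]
  · rw [h s hs, zero_mul]

theorem funcCalc_mem_spectralSubspace (hD : IsSelfAdjoint D) {f : ℝ → ℝ} (hf : IsC0On D f)
    (h : ∀ x ∈ specSet D, x ∉ S → f x = 0) (y : H) : funcCalc D f y ∈ spectralSubspace D S := by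
  rw [mem_spectralSubspace]
  rintro g ⟨hg, hgc, hgS⟩
  rw [← mul_apply_eq_comp, ← funcCalc_mul ((IsC0.of_hasCompactSupport hg hgc).isC0On hD) hf,
    funcCalc_eq_zero hD, zero_apply]
  intro x hx
  by_cases hxS : x ∈ S
  · rw [hgS x hxS, zero_mul]
  · rw [h x hx hxS, mul_zero]

/-- The function `(1 + x²)⁻¹`. -/
noncomputable def invOneAddSq (x : ℝ) : ℝ := (1 + x ^ 2)⁻¹

theorem isC0_invOneAddSq : IsC0 invOneAddSq := by
  refine isC0_of_abs_le (C := 1) (M := 1) ?_ fun x hx => ?_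
  · exact (by fun_prop : Continuous fun x : ℝ => 1 + x ^ 2).inv₀ fun x => by positivity
  · unfold invOneAddSq
    rw [abs_of_nonneg (by positivity), ← one_div]
    apply one_div_le_one_div_of_le (by linarith)
    rw [← sq_abs]
    nlinarith

theorem funcCalc_invOneAddSq (hD : IsSelfAdjoint D) :
    funcCalc D invOneAddSq = star (resolv D Complex.I) * resolv D Complex.I := by
  have := isStarNormal_resolv hD
  have h1 : cfc (fun z : ℂ => star z * z) (resolv D Complex.I) =
      star (resolv D Complex.I) * resolv D Complex.I := by
    rw [cfc_mul (fun z : ℂ => star z) (fun z => z) (resolv D Complex.I),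
      cfc_star_id (R := ℂ) (a := resolv D Complex.I), cfc_id' ℂ (resolv D Complex.I)]
  rw [← h1, funcCalc_eq]
  refine cfc_congr (forall_mem_spectrum hD (by simp [toC_zero]) fun x _ => ?_)
  rw [toC_pt]
  change _ = (starRingEnd ℂ) (pt x) * pt x
  rw [mul_comm, Complex.mul_conj, pt, Complex.normSq_inv, invOneAddSq]
  norm_cast
  congr 1
  rw [Complex.normSq_apply]
  simp
  ring

theorem eq_zero_of_funcCalc_invOneAddSq (hD : IsSelfAdjoint D) {x : H}
    (h : funcCalc D invOneAddSq x = 0) : x = 0 := by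
  rw [funcCalc_invOneAddSq hD, mul_apply_eq_comp] at h
  exact resolv_injective hD (star_resolv_injective hD h)

/-- `1 - k` does not vanish at infinity, so it is multiplied by `(1 + x²)⁻¹`. The product kills `x`,
and `(1 + D²)⁻¹ = R* R` is injective. -/
theorem funcCalc_apply_eq_self (hD : IsSelfAdjoint D) {k : ℝ → ℝ} (hk : IsC0 k)
    (h : ∀ s ∈ S, k s = 1) {x : H} (hx : x ∈ spectralSubspace D S) : funcCalc D k x = x := by
  have h0 := isC0_invOneAddSq.isC0On hD
  have hb : ∀ x, |k x| ≤ ‖(⟨⟨k, hk.1⟩, hk.2⟩ : ZeroAtInftyContinuousMap ℝ ℝ).toBCF‖ := fun x =>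
    (ZeroAtInftyContinuousMap.toBCF ⟨⟨k, hk.1⟩, hk.2⟩).norm_coe_le_norm x
  have hm := isC0_invOneAddSq.mul_of_bounded hk.1 hb
  have h1 := funcCalc_apply_eq_zero hD (isC0_invOneAddSq.sub hm)
    (fun s hs => by rw [h s hs, mul_one, sub_self]) hx
  rw [funcCalc_sub h0 (hm.isC0On hD), funcCalc_mul h0 (hk.isC0On hD), sub_apply,
    mul_apply_eq_comp, ← map_sub] at h1
  exact (sub_eq_zero.1 (eq_zero_of_funcCalc_invOneAddSq hD h1)).symm

theorem isStarProjection_spectralProj (D : H →ₗ.[ℂ] H) (S : Set ℝ) :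
    IsStarProjection (spectralProj D S) := isStarProjection_starProjection

theorem range_spectralProj (D : H →ₗ.[ℂ] H) (S : Set ℝ) :
    LinearMap.range (spectralProj D S : H →ₗ[ℂ] H) = spectralSubspace D S :=
  Submodule.range_starProjection _

theorem spectralProj_apply_mem (D : H →ₗ.[ℂ] H) (S : Set ℝ) (x : H) :
    spectralProj D S x ∈ spectralSubspace D S := Submodule.starProjection_apply_mem _ x

theorem spectralProj_apply_eq_self {x : H} :
    spectralProj D S x = x ↔ x ∈ spectralSubspace D S := Submodule.starProjection_eq_self_iff

theorem eq_spectralProj {F : H →L[ℂ] H} (hF : IsStarProjection F)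
    (h : ∀ x, F x = x ↔ x ∈ spectralSubspace D S) : spectralProj D S = F := by
  have h1 : spectralProj D S = F * spectralProj D S := by
    ext x
    rw [mul_apply_eq_comp, (h _).2 (spectralProj_apply_mem D S x)]
  have h2 : F = spectralProj D S * F := by
    ext x
    rw [mul_apply_eq_comp]
    refine (spectralProj_apply_eq_self.2 ((h _).1 ?_)).symm
    rw [← mul_apply_eq_comp, hF.isIdempotentElem.eq]
  have h3 := congrArg star h2
  rw [star_mul, hF.isSelfAdjoint.star_eq,
    (isStarProjection_spectralProj D S).isSelfAdjoint.star_eq] at h3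
  exact h1.trans h3.symm

theorem commute_spectralProj_of_mapsTo {A : H →L[ℂ] H} (hA : IsSelfAdjoint A)
    (h : ∀ x ∈ spectralSubspace D S, A x ∈ spectralSubspace D S) :
    Commute (spectralProj D S) A := by
  have h1 : A * spectralProj D S = spectralProj D S * A * spectralProj D S := by
    ext x
    simp only [mul_apply_eq_comp]
    exact (spectralProj_apply_eq_self.2 (h _ (spectralProj_apply_mem D S x))).symm
  have h2 := congrArg star h1
  simp only [star_mul, hA.star_eq, (isStarProjection_spectralProj D S).isSelfAdjoint.star_eq] at h2
  rw [commute_iff_eq, h2, ← mul_assoc, ← h1]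

theorem commute_spectralProj_funcCalc (D : H →ₗ.[ℂ] H) (S : Set ℝ) (f : ℝ → ℝ) :
    Commute (spectralProj D S) (funcCalc D f) := by
  refine commute_spectralProj_of_mapsTo (isSelfAdjoint_funcCalc D f) fun x hx => ?_
  rw [mem_spectralSubspace] at hx ⊢
  intro g hg
  rw [← mul_apply_eq_comp, (commute_funcCalc D g f).eq, mul_apply_eq_comp, hx g hg, map_zero]

theorem commute_spectralProj (D : H →ₗ.[ℂ] H) (S S' : Set ℝ) :
    Commute (spectralProj D S) (spectralProj D S') := by
  symm
  refine commute_spectralProj_of_mapsTo (isStarProjection_spectralProj D S).isSelfAdjoint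
    fun x hx => ?_
  rw [mem_spectralSubspace] at hx ⊢
  intro g hg
  rw [← mul_apply_eq_comp, ← (commute_spectralProj_funcCalc D S g).eq, mul_apply_eq_comp, hx g hg,
    map_zero]

/-- On the spectrum `k` is the indicator function of `S`. Through this, continuity results for
`f(D)` reach spectral projections across a gap. -/
theorem spectralProj_eq_funcCalc (hD : IsSelfAdjoint D) {k : ℝ → ℝ} (hk : IsC0 k)
    (h1 : ∀ s ∈ S, k s = 1) (h0 : ∀ s ∈ specSet D, s ∉ S → k s = 0) :
    spectralProj D S = funcCalc D k := by
  refine eq_spectralProj ⟨?_, isSelfAdjoint_funcCalc D k⟩ fun x => ⟨fun hx => ?_, fun hx =>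
    funcCalc_apply_eq_self hD hk h1 hx⟩
  · rw [IsIdempotentElem, ← funcCalc_mul (hk.isC0On hD) (hk.isC0On hD)]
    refine funcCalc_congr hD fun s hs => ?_
    by_cases hsS : s ∈ S
    · rw [h1 s hsS, mul_one]
    · rw [h0 s hs hsS, mul_zero]
  · rw [← hx]
    exact funcCalc_mem_spectralSubspace hD (hk.isC0On hD) h0 x

theorem spectralProj_mul_of_inf {S S' S'' : Set ℝ}
    (h : spectralSubspace D S ⊓ spectralSubspace D S' = spectralSubspace D S'') :
    spectralProj D S * spectralProj D S' = spectralProj D S'' := by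
  have hc := commute_spectralProj D S S'
  refine (eq_spectralProj ((isStarProjection_spectralProj D S).mul
    (isStarProjection_spectralProj D S') hc) fun x => ⟨fun hx => ?_, fun hx => ?_⟩).symm
  · rw [← h]
    refine ⟨?_, ?_⟩
    · rw [← hx, mul_apply_eq_comp]
      exact spectralProj_apply_mem _ _ _
    · rw [← hx, hc.eq, mul_apply_eq_comp]
      exact spectralProj_apply_mem _ _ _
  · rw [← h] at hx
    rw [mul_apply_eq_comp, spectralProj_apply_eq_self.2 hx.2, spectralProj_apply_eq_self.2 hx.1]

/-- A test function vanishing on `[0, μ]` is the sum of `f (min s 0)`, which vanishes on `[0, ∞)`,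
and `f (max s μ)`, which vanishes on `[-μ, μ]`. -/
theorem spectralSubspace_Ici_inf_Icc (hD : IsSelfAdjoint D) {μ : ℝ} (hμ : 0 < μ) :
    spectralSubspace D (Ici 0) ⊓ spectralSubspace D (Icc (-μ) μ) =
      spectralSubspace D (Icc 0 μ) := by
  refine le_antisymm (fun x hx => ?_) (le_inf (spectralSubspace_mono Icc_subset_Ici_self)
    (spectralSubspace_mono (Icc_subset_Icc_left (by linarith))))
  obtain ⟨hx1, hx2⟩ := hx
  rw [mem_spectralSubspace]
  rintro f ⟨hf, hfc, hfS⟩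
  have f0 : f 0 = 0 := hfS 0 ⟨le_rfl, hμ.le⟩
  have fμ : f μ = 0 := hfS μ ⟨hμ.le, le_rfl⟩
  have c1 : IsC0 fun s => f (min s 0) := by
    refine IsC0.of_hasCompactSupport (hf.comp (by fun_prop)) (hfc.mono fun s hs => ?_)
    rw [Function.mem_support] at hs ⊢
    rcases le_total s 0 with h | h
    · rwa [min_eq_left h] at hs
    · rw [min_eq_right h] at hs
      exact absurd f0 hs
  have c2 : IsC0 fun s => f (max s μ) := by
    refine IsC0.of_hasCompactSupport (hf.comp (by fun_prop)) (hfc.mono fun s hs => ?_)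
    rw [Function.mem_support] at hs ⊢
    rcases le_total μ s with h | h
    · rwa [max_eq_left h] at hs
    · rw [max_eq_right h] at hs
      exact absurd fμ hs
  have h1 := funcCalc_apply_eq_zero hD c1 (S := Ici 0)
    (fun s hs => by rw [min_eq_right hs, f0]) hx1
  have h2 := funcCalc_apply_eq_zero hD c2 (S := Icc (-μ) μ)
    (fun s hs => by rw [max_eq_right hs.2, fμ]) hx2
  have h3 : f = fun s => f (min s 0) + f (max s μ) := by
    ext s
    rcases le_total s 0 with h | h
    · rw [min_eq_left h, max_eq_right (h.trans hμ.le), fμ, add_zero]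
    · rw [min_eq_right h, f0, zero_add]
      rcases le_total s μ with h' | h'
      · rw [max_eq_right h', fμ, hfS s ⟨h, h'⟩]
      · rw [max_eq_left h']
  rw [h3, funcCalc_add (c1.isC0On hD) (c2.isC0On hD), add_apply, h1, h2, add_zero]

end SpectralSubspace

/-! ### Resolvent set and spectrum. -/

section ResolventSet

variable {H : Type*} [NormedAddCommGroup H] [InnerProductSpace ℂ H] [CompleteSpace H]
  {D : H →ₗ.[ℂ] H}

theorem mem_graph_shift_neg {μ : ℝ} {x y : H} :
    (x, y) ∈ (shift D (-(μ : ℂ))).graph ↔ (x, y + (μ : ℂ) • x) ∈ D.graph := by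
  rw [mem_graph_shift, neg_smul, sub_neg_eq_add]

theorem pt_smul_inv_smul (x : ℝ) (y : H) : pt x • ((x : ℂ) + Complex.I) • y = y := by
  rw [smul_smul, pt, inv_mul_cancel₀ (ofReal_add_I_ne_zero x), one_smul]

/-- With `c = μ + i` and `S = (D - μ)⁻¹`, the inverse of `c⁻¹ - R` is `c (1 + c S)`. -/
theorem InResolventSet.notMem_specSet (hD : IsSelfAdjoint D) {μ : ℝ} (h : InResolventSet D μ) :
    μ ∉ specSet D := by
  obtain ⟨S, hS⟩ := h
  rw [isBoundedInverse_iff] at hS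
  set R := resolv D Complex.I
  set c : ℂ := (μ : ℂ) + Complex.I with hc
  have h1 : ∀ y, S (y - c • R y) = R y := fun y => by
    refine hS.1 _ _ ?_
    rw [mem_graph_shift_neg]
    have := resolv_I_mem_graph hD y
    convert this using 2
    rw [hc, add_smul]
    change _ = y - Complex.I • R y
    abel
  have h2 : ∀ y, R (y + c • S y) = S y := fun y => by
    have := resolv_I_apply hD (mem_graph_shift_neg.1 (hS.2 y))
    rwa [add_assoc, ← add_smul] at this
  intro hμ
  refine spectrum.notMem_iff.2 ?_ hμ
  refine ⟨⟨algebraMap ℂ (H →L[ℂ] H) (pt μ) - R, c • (1 + c • S), ?_, ?_⟩, rfl⟩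
  · ext y
    simp only [mul_apply_eq_comp, sub_apply, smul_apply, add_apply, one_apply_eq_self,
      Algebra.algebraMap_eq_smul_one]
    rw [map_smul, h2, hc, pt_smul_inv_smul]
    abel
  · ext y
    simp only [mul_apply_eq_comp, sub_apply, smul_apply, add_apply, one_apply_eq_self,
      Algebra.algebraMap_eq_smul_one]
    have h3 := h1 (pt μ • y)
    have h4 : c • pt μ • y = y := by
      rw [smul_comm, hc, pt_smul_inv_smul]
    have h5 : c • R (pt μ • y) = R y := by rw [← map_smul, h4]
    rw [h5] at h3
    rw [h3, smul_add, h5, smul_sub, h4]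
    abel

theorem inResolventSet_of_notMem_specSet (hD : IsSelfAdjoint D) {μ : ℝ} (h : μ ∉ specSet D) :
    InResolventSet D μ := by
  set R := resolv D Complex.I with hR
  set c : ℂ := (μ : ℂ) + Complex.I with hc
  obtain ⟨u, hu⟩ := spectrum.notMem_iff.1 (show pt μ ∉ spectrum ℂ R from h)
  rw [Algebra.algebraMap_eq_smul_one] at hu
  have hu1 : ∀ y, (u : H →L[ℂ] H) ((↑u⁻¹ : H →L[ℂ] H) y) = y := fun y => by
    rw [← mul_apply_eq_comp, u.mul_inv, one_apply_eq_self]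
  have hu2 : ∀ y, (↑u⁻¹ : H →L[ℂ] H) ((u : H →L[ℂ] H) y) = y := fun y => by
    rw [← mul_apply_eq_comp, u.inv_mul, one_apply_eq_self]
  have hua : ∀ y, (u : H →L[ℂ] H) y = pt μ • y - R y := fun y => by rw [hu]; simp
  have hcomm : ∀ y, R ((↑u⁻¹ : H →L[ℂ] H) y) = (↑u⁻¹ : H →L[ℂ] H) (R y) := fun y => by
    rw [← hu2 (R ((↑u⁻¹ : H →L[ℂ] H) y)), hua, ← map_smul, ← map_sub, ← hua, hu1]
  refine ⟨R * (pt μ • (↑u⁻¹ : H →L[ℂ] H)), ?_⟩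
  rw [isBoundedInverse_iff]
  constructor
  · intro x y hxy
    rw [mem_graph_shift_neg] at hxy
    have h1 := resolv_I_apply hD hxy
    rw [add_assoc, ← add_smul, map_add, map_smul] at h1
    have h2 : pt μ • R y = (u : H →L[ℂ] H) x := by
      rw [hua, ← pt_smul_inv_smul μ (R x), ← smul_sub]
      congr 1
      rw [eq_sub_iff_add_eq]
      exact h1
    rw [mul_apply_eq_comp, smul_apply, map_smul, hcomm, ← map_smul, h2, hu2]
  · intro y
    rw [mem_graph_shift_neg]
    set w : H := pt μ • (↑u⁻¹ : H →L[ℂ] H) y with hw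
    change (R w, y + (μ : ℂ) • R w) ∈ D.graph
    have h1 := resolv_I_mem_graph hD w
    convert h1 using 2
    change _ = w - Complex.I • R w
    have h2 : w - c • R w = y := by
      have h3 := hu1 y
      rw [hua] at h3
      rw [hw, map_smul, smul_comm c, hc, pt_smul_inv_smul]
      exact h3
    rw [← h2, hc, add_smul]
    abel

theorem exists_gap {μ : ℝ} (h : μ ∉ specSet D) : ∃ δ > 0, ∀ x ∈ specSet D, δ ≤ |x - μ| := by
  obtain ⟨δ, hδ, hb⟩ := Metric.isOpen_iff.1 (isClosed_specSet D).isOpen_compl μ h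
  refine ⟨δ, hδ, fun x hx => ?_⟩
  by_contra hlt
  rw [not_le, ← Real.dist_eq] at hlt
  exact hb hlt hx

/-- The spectrum is closed, so it leaves a gap just outside `[-μ, μ]` in which the trapezoid can
descend to `0`. -/
theorem exists_hat_eq_spectralProj (hD : IsSelfAdjoint D) {μ : ℝ} (h : μ ∉ specSet D)
    (h' : -μ ∉ specSet D) : ∃ δ > 0, (∀ x ∈ specSet D, |x| ≤ μ ∨ μ + δ ≤ |x|) ∧
      spectralProj D (Icc (-μ) μ) = funcCalc D (hat μ (μ + δ)) := by
  obtain ⟨δ, hδ, hb⟩ := exists_gap h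
  obtain ⟨δ', hδ', hb'⟩ := exists_gap h'
  have hgap : ∀ x ∈ specSet D, |x| ≤ μ ∨ μ + min δ δ' ≤ |x| := by
    intro x hx
    have h1 := hb x hx
    have h2 := hb' x hx
    have h3 := min_le_left δ δ'
    have h4 := min_le_right δ δ'
    by_contra! hcon
    obtain ⟨hc1, hc2⟩ := hcon
    rcases le_total 0 x with h0 | h0
    · rw [abs_of_nonneg h0] at hc1 hc2
      rw [abs_of_nonneg (by linarith)] at h1
      linarith
    · rw [abs_of_nonpos h0] at hc1 hc2
      rw [abs_of_nonpos (by linarith)] at h2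
      linarith
  have hm : 0 < min δ δ' := lt_min hδ hδ'
  refine ⟨min δ δ', hm, hgap, ?_⟩
  refine spectralProj_eq_funcCalc hD (isC0_hat (by linarith)) (fun s hs => ?_) fun s hs hsS => ?_
  · exact hat_eq_one (by linarith) (abs_le.2 hs)
  · rcases hgap s hs with h1 | h1
    · exact absurd (abs_le.1 h1) hsS
    · exact hat_eq_zero (by linarith) h1

end ResolventSet

/-! ### A parametrix of `D` at a level and its relation to `(D + K)⁻¹`. -/

section Parametrix

/-- A continuous function on the real line that agrees with `x⁻¹` for `|x| ≥ μ`. -/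
noncomputable def recip (μ x : ℝ) : ℝ := x / max (μ ^ 2) (x ^ 2)

theorem isC0_div_max {μ : ℝ} (hμ : 0 < μ) {h : ℝ → ℝ} (hc : Continuous h)
    (hb : ∀ x, |h x| ≤ |x|) : IsC0 fun x => h x / max (μ ^ 2) (x ^ 2) := by
  have hpos : ∀ x : ℝ, 0 < max (μ ^ 2) (x ^ 2) := fun x => lt_max_of_lt_left (by positivity)
  refine isC0_of_abs_le (C := 1) (M := μ) ?_ fun x hx => ?_
  · exact hc.div (by fun_prop) fun x => (hpos x).ne'
  · have hx0 : 0 < |x| := hμ.trans_le hx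
    rw [abs_div, abs_of_pos (hpos x), div_le_div_iff₀ (hpos x) hx0]
    have h1 : |x| * |x| ≤ max (μ ^ 2) (x ^ 2) := by
      rw [abs_mul_abs_self, ← sq]; exact le_max_right _ _
    nlinarith [hb x]

theorem isC0_recip {μ : ℝ} (hμ : 0 < μ) : IsC0 (recip μ) :=
  isC0_div_max hμ continuous_id fun _ => le_rfl

theorem mul_recip {μ x : ℝ} (hμ : 0 < μ) (hx : μ ≤ |x|) : x * recip μ x = 1 := by
  have hx0 : 0 < |x| := hμ.trans_le hx
  have h1 : μ ^ 2 ≤ x ^ 2 := by rw [← sq_abs x]; gcongr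
  rw [recip, max_eq_right h1]
  have : x ≠ 0 := abs_pos.1 hx0
  field_simp

theorem continuous_mul_recip {μ : ℝ} (hμ : 0 < μ) : Continuous fun x => x * recip μ x :=
  continuous_id.mul (isC0_recip hμ).1

theorem isC0_mul_recip_sub_one {μ : ℝ} (hμ : 0 < μ) : IsC0 fun x => x * recip μ x - 1 :=
  IsC0.of_hasCompactSupport ((continuous_mul_recip hμ).sub continuous_const)
    (hasCompactSupport_of_abs (b := μ) fun x hx => by
      rw [mul_recip hμ hx.le, sub_self])

theorem isC0_id_mul_hat {a b : ℝ} (hab : a < b) : IsC0 fun x => x * hat a b x :=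
  IsC0.of_hasCompactSupport (continuous_id.mul (continuous_hat a b))
    (hasCompactSupport_of_abs (b := b) fun x hx => by
      rw [hat_eq_zero hab hx.le, mul_zero])

variable {H : Type*} [NormedAddCommGroup H] [InnerProductSpace ℂ H] [CompleteSpace H]

/-- The operator is replaced by the identity on the reducing subspace `Ran E`, so its positive
projection absorbs all of `Ran E`. -/
theorem IsPosProj.join {A P E : H →L[ℂ] H} (hA : IsPosProj A P) (hE : IsStarProjection E)
    (cP : Commute E P) (cA : Commute E A) :
    IsPosProj (A * (1 - E) + E) (P + (1 - P) * E) := by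
  have e2 : ∀ x, E * (A * x) = A * (E * x) := fun x => by rw [← mul_assoc, cA.eq, mul_assoc]
  have e3 : ∀ x, P * (A * x) = A * (P * x) := fun x => by rw [← mul_assoc, hA.comm.eq, mul_assoc]
  have hs : star (1 - E) = 1 - E := by rw [star_sub, star_one, hE.isSelfAdjoint.star_eq]
  refine ⟨?_, ?_, ?_, ?_⟩
  · have e : P + (1 - P) * E = 1 - (1 - P) * (1 - E) := by noncomm_ring
    rw [e]
    exact (hA.proj.one_sub.mul hE.one_sub (((Commute.one_left _).sub_left
      ((Commute.one_right _).sub_right cP.symm)))).one_sub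
  · have h1 : Commute P (A * (1 - E) + E) :=
      (hA.comm.mul_right ((Commute.one_right P).sub_right cP.symm)).add_right cP.symm
    have h2 : Commute E (A * (1 - E) + E) :=
      (cA.mul_right ((Commute.one_right E).sub_right (Commute.refl E))).add_right (Commute.refl E)
    exact h1.add_left (((Commute.one_left _).sub_left h1).mul_left h2)
  · have h := star_left_conjugate_nonneg hA.nonneg (1 - E)
    rw [hs] at h
    have e : (P + (1 - P) * E) * (A * (1 - E) + E) = (1 - E) * (P * A) * (1 - E) + E := by
      simp only [mul_add, add_mul, mul_sub, sub_mul, mul_assoc, e2, e3, cP.eq, cA.eq,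
        hA.comm.eq, hE.isIdempotentElem.eq, one_mul, mul_one]
      abel
    rw [e]
    exact add_nonneg h hE.nonneg
  · have h := star_left_conjugate_nonneg hA.nonpos (1 - E)
    rw [hs] at h
    have e : (P + (1 - P) * E - 1) * (A * (1 - E) + E) = (1 - E) * ((P - 1) * A) * (1 - E) := by
      simp only [mul_add, add_mul, mul_sub, sub_mul, mul_assoc, e2, e3, cP.eq, cA.eq,
        hA.comm.eq, hE.isIdempotentElem.eq, one_mul, mul_one]
      abel
    rwa [e]

variable {D : H →ₗ.[ℂ] H}

/-- `recip μ` is a difference of nonnegative functions, one vanishing on the negative and one on the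
positive half-line; `1_{≥0}(D)` fixes the first part and kills the second. -/
theorem isPosProj_recip (hD : IsSelfAdjoint D) {μ : ℝ} (hμ : 0 < μ) :
    IsPosProj (funcCalc D (recip μ)) (nonnegProj D) := by
  have hpos : ∀ x : ℝ, 0 < max (μ ^ 2) (x ^ 2) := fun x => lt_max_of_lt_left (by positivity)
  have hp : IsC0 fun x => max x 0 / max (μ ^ 2) (x ^ 2) :=
    isC0_div_max hμ (by fun_prop) fun x => by
      rw [abs_of_nonneg (le_max_right _ _)]; exact max_le (le_abs_self x) (abs_nonneg x)
  have hn : IsC0 fun x => max (-x) 0 / max (μ ^ 2) (x ^ 2) :=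
    isC0_div_max hμ (by fun_prop) fun x => by
      rw [abs_of_nonneg (le_max_right _ _)]; exact max_le (neg_le_abs x) (abs_nonneg x)
  have e : funcCalc D (recip μ) = funcCalc D (fun x => max x 0 / max (μ ^ 2) (x ^ 2)) -
      funcCalc D (fun x => max (-x) 0 / max (μ ^ 2) (x ^ 2)) := by
    rw [← funcCalc_sub (hp.isC0On hD) (hn.isC0On hD)]
    congr 1
    ext x
    rw [recip, ← sub_div]
    congr 1
    rcases le_total x 0 with h | h
    · rw [max_eq_right h, max_eq_left (by linarith)]; ring
    · rw [max_eq_left h, max_eq_right (by linarith)]; ring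
  have h1 : nonnegProj D * funcCalc D (fun x => max x 0 / max (μ ^ 2) (x ^ 2)) =
      funcCalc D (fun x => max x 0 / max (μ ^ 2) (x ^ 2)) := by
    ext y
    rw [mul_apply_eq_comp]
    refine spectralProj_apply_eq_self.2 (funcCalc_mem_spectralSubspace hD (hp.isC0On hD)
      (fun x _ hx => ?_) y)
    rw [max_eq_right (le_of_lt (not_le.1 hx)), zero_div]
  have h2 : nonnegProj D * funcCalc D (fun x => max (-x) 0 / max (μ ^ 2) (x ^ 2)) = 0 := by
    rw [nonnegProj, (commute_spectralProj_funcCalc D _ _).eq]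
    ext y
    rw [mul_apply_eq_comp]
    refine funcCalc_apply_eq_zero hD hn (fun x hx => ?_) (spectralProj_apply_mem D (Ici 0) y)
    have hx' : 0 ≤ x := hx
    rw [max_eq_right (by linarith), zero_div]
  have h3 : nonnegProj D * funcCalc D (recip μ) =
      funcCalc D (fun x => max x 0 / max (μ ^ 2) (x ^ 2)) := by
    rw [e, mul_sub, h1, h2, sub_zero]
  refine ⟨isStarProjection_spectralProj _ _, commute_spectralProj_funcCalc _ _ _, ?_, ?_⟩
  · rw [h3]
    exact funcCalc_nonneg hD fun x _ => div_nonneg (le_max_right _ _) (hpos x).le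
  · rw [sub_mul, h3, one_mul, e, sub_sub_cancel]
    exact funcCalc_nonneg hD fun x _ => div_nonneg (le_max_right _ _) (hpos x).le

/-- A bounded selfadjoint operator that inverts `D` off the spectral subspace of `[-μ, μ]` and is
the identity on that subspace. -/
noncomputable def levelInv (D : H →ₗ.[ℂ] H) (μ : ℝ) : H →L[ℂ] H :=
  funcCalc D (recip μ) * (1 - spectralProj D (Icc (-μ) μ)) + spectralProj D (Icc (-μ) μ)

/-- The composition of `D` with `levelInv D μ`. -/
noncomputable def levelComp (D : H →ₗ.[ℂ] H) (μ : ℝ) : H →L[ℂ] H :=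
  1 - spectralProj D (Icc (-μ) μ) +
    funcCalc D (fun x => x * hat μ (2 * μ) x) * spectralProj D (Icc (-μ) μ)

theorem isSelfAdjoint_levelInv (D : H →ₗ.[ℂ] H) (μ : ℝ) : IsSelfAdjoint (levelInv D μ) := by
  have hE := (isStarProjection_spectralProj D (Icc (-μ) μ)).isSelfAdjoint
  have hc := commute_spectralProj_funcCalc D (Icc (-μ) μ) (recip μ)
  have h1 : Commute (funcCalc D (recip μ)) (1 - spectralProj D (Icc (-μ) μ)) :=
    (Commute.one_right _).sub_right hc.symm
  have h2 : IsSelfAdjoint (1 - spectralProj D (Icc (-μ) μ)) := (IsSelfAdjoint.one _).sub hE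
  exact ((isSelfAdjoint_funcCalc D _).commute_iff h2 |>.1 h1).add hE

/-- The projection is `1_{≥-μ}(D)`, which does not see eigenvalues crossing `0`. -/
theorem isPosProj_levelInv (hD : IsSelfAdjoint D) {μ : ℝ} (hμ : 0 < μ) :
    IsPosProj (levelInv D μ)
      (nonnegProj D + (1 - nonnegProj D) * spectralProj D (Icc (-μ) μ)) :=
  (isPosProj_recip hD hμ).join (isStarProjection_spectralProj _ _) (commute_spectralProj _ _ _)
    (commute_spectralProj_funcCalc _ _ _)

theorem recip_mem_graph (hD : IsSelfAdjoint D) {μ : ℝ} (hμ : 0 < μ) (h : μ ∉ specSet D)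
    (h' : -μ ∉ specSet D) (y : H) :
    (funcCalc D (recip μ) (y - spectralProj D (Icc (-μ) μ) y),
      y - spectralProj D (Icc (-μ) μ) y) ∈ D.graph := by
  obtain ⟨δ, hδ, hgap, hE⟩ := exists_hat_eq_spectralProj hD h h'
  have hm := isC0_mul_recip_sub_one hμ
  have h0 := funcCalc_mem_graph hD (c := 1) ((isC0_recip hμ).isC0On hD) (hm.isC0On hD)
    (fun x _ => by ring) (y - spectralProj D (Icc (-μ) μ) y)
  have h1 : funcCalc D (fun x => x * recip μ x - 1) (y - spectralProj D (Icc (-μ) μ) y) = 0 := by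
    have hk := isC0_hat (show μ < μ + δ by linarith)
    rw [map_sub, hE, ← mul_apply_eq_comp, ← funcCalc_mul (hm.isC0On hD) (hk.isC0On hD),
      ← sub_apply, ← funcCalc_sub (hm.isC0On hD) ((hm.isC0On hD).mul (hk.isC0On hD)),
      funcCalc_eq_zero hD, zero_apply]
    intro x hx
    rcases hgap x hx with h | h
    · rw [hat_eq_one (by linarith) h, mul_one, sub_self]
    · rw [mul_recip hμ (by linarith)]; ring
  rw [h1] at h0
  simpa using h0

theorem levelInv_mem_graph (hD : IsSelfAdjoint D) {μ : ℝ} (hμ : 0 < μ) (h : μ ∉ specSet D)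
    (h' : -μ ∉ specSet D) (y : H) : (levelInv D μ y, levelComp D μ y) ∈ D.graph := by
  have h1 := recip_mem_graph hD hμ h h' y
  obtain ⟨δ, hδ, hgap, hE⟩ := exists_hat_eq_spectralProj hD h h'
  have hk := isC0_hat (show μ < μ + δ by linarith)
  -- This function stands in for `x` on `[-μ, μ]`. Its outer radius `2 μ` is independent of the gap
  -- `δ`, so the same function can be used along a whole path.
  have hl := isC0_id_mul_hat (show μ < 2 * μ by linarith)
  have h2 := funcCalc_mem_graph hD (c := 0) (hk.isC0On hD) ((hl.isC0On hD).mul (hk.isC0On hD))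
    (fun x hx => ?_) y
  · rw [funcCalc_mul (hl.isC0On hD) (hk.isC0On hD), ← hE] at h2
    have h3 := D.graph.add_mem h1 h2
    convert h3 using 1
    simp [levelInv, levelComp]
  · rw [zero_add]
    rcases hgap x hx with h | h
    · rw [hat_eq_one (by linarith) h, hat_eq_one (by linarith) h]; ring
    · rw [hat_eq_zero (by linarith) h]; ring

theorem levelInv_injective (hD : IsSelfAdjoint D) {μ : ℝ} (hμ : 0 < μ) (h : μ ∉ specSet D)
    (h' : -μ ∉ specSet D) : Function.Injective (levelInv D μ) := by
  rw [injective_iff_map_eq_zero]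
  intro y hy
  have hE := (isStarProjection_spectralProj D (Icc (-μ) μ)).isIdempotentElem.eq
  have hc := commute_spectralProj_funcCalc D (Icc (-μ) μ) (recip μ)
  have h1 : spectralProj D (Icc (-μ) μ) * levelInv D μ = spectralProj D (Icc (-μ) μ) := by
    rw [levelInv, mul_add, ← mul_assoc, hc.eq, mul_assoc, mul_sub, hE]
    simp
  have h2 : spectralProj D (Icc (-μ) μ) y = 0 := by
    rw [← h1, mul_apply_eq_comp, hy, map_zero]
  have h3 := recip_mem_graph hD hμ h h' y
  have h4 : funcCalc D (recip μ) (y - spectralProj D (Icc (-μ) μ) y) = 0 := by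
    rw [levelInv, add_apply, h2, add_zero, mul_apply_eq_comp, sub_apply, one_apply_eq_self] at hy
    exact hy
  rw [h4, h2, sub_zero] at h3
  exact graph_unique h3 (Submodule.zero_mem _)

theorem isSelfAdjoint_of_isBoundedInverse {B : H →ₗ.[ℂ] H} (hB : IsSelfAdjoint B)
    {S : H →L[ℂ] H} (hS : IsBoundedInverse B S) : IsSelfAdjoint S := by
  rw [isBoundedInverse_iff] at hS
  rw [IsSelfAdjoint, ContinuousLinearMap.star_eq_adjoint]
  symm
  rw [ContinuousLinearMap.eq_adjoint_iff]
  intro x y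
  exact (inner_eq_of_mem_graph hB (hS.2 x) (hS.2 y)).symm

/-- `0` has distance at least some `δ > 0` from the spectrum of `B`, hence `S` is `recip δ` of `B`.
-/
theorem isPosProj_boundedInverse {B : H →ₗ.[ℂ] H} (hB : IsSelfAdjoint B) {S : H →L[ℂ] H}
    (hS : IsBoundedInverse B S) : IsPosProj S (nonnegProj B) := by
  have h0 : InResolventSet B 0 := by
    have e : ∀ x y, (x, y) ∈ (shift B (-((0 : ℝ) : ℂ))).graph ↔ (x, y) ∈ B.graph := fun x y => by
      rw [mem_graph_shift_neg, Complex.ofReal_zero, zero_smul, add_zero]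
    refine ⟨S, ?_⟩
    rw [isBoundedInverse_iff] at hS ⊢
    exact ⟨fun x y h => hS.1 x y ((e x y).1 h), fun y => (e _ _).2 (hS.2 y)⟩
  obtain ⟨δ, hδ, hgap⟩ := exists_gap (h0.notMem_specSet hB)
  have : S = funcCalc B (recip δ) := by
    ext y
    have h1 := funcCalc_mem_graph hB (c := 1) ((isC0_recip hδ).isC0On hB)
      ((isC0_mul_recip_sub_one hδ).isC0On hB) (fun x _ => by ring) y
    have h2 : funcCalc B (fun x => x * recip δ x - 1) = 0 := funcCalc_eq_zero hB fun x hx => by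
      rw [mul_recip hδ (by simpa using hgap x hx), sub_self]
    rw [h2, zero_apply, Complex.ofReal_one, one_smul, add_zero] at h1
    exact (isBoundedInverse_iff.1 hS).1 _ _ h1
  rw [this]
  exact isPosProj_recip hB hδ

/-- With `L = levelInv D μ` and `R = (D + i)⁻¹`, one has `L = R (D L + i L)`, so `K L = C (D L + i
L)`. The operator in brackets is therefore `(D + K) L`, and it is a compact perturbation of `1` when
`C` is compact and the level has finite rank. -/
theorem boundedInverse_mul_one_sub {K : H →ₗ.[ℂ] H} (hD : IsSelfAdjoint D) {C S : H →L[ℂ] H}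
    (hC : IsComposition K (resolv D Complex.I) C) (hS : IsBoundedInverse (D + K) S) {μ : ℝ}
    (hμ : 0 < μ) (h : μ ∉ specSet D) (h' : -μ ∉ specSet D) :
    S * (1 - (1 - levelComp D μ - C * (levelComp D μ + Complex.I • levelInv D μ))) =
      levelInv D μ := by
  ext y
  rw [mul_apply_eq_comp]
  refine (isBoundedInverse_iff.1 hS).1 _ _ ?_
  have h1 := levelInv_mem_graph hD hμ h h' y
  have h2 := resolv_I_apply hD h1
  have h3 := isComposition_iff.1 hC (levelComp D μ y + Complex.I • levelInv D μ y)
  rw [h2] at h3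
  refine mem_graph_add.2 ⟨_, _, h1, h3, ?_⟩
  simp only [sub_apply, one_apply_eq_self, mul_apply_eq_comp, add_apply, smul_apply]
  abel

/-- The Fredholm alternative. -/
theorem isUnit_one_sub_of_injective {Y : H →L[ℂ] H} (hY : IsCompactOperator Y)
    (hi : Function.Injective (1 - Y : H →L[ℂ] H)) : IsUnit (1 - Y) := by
  rcases hY.hasEigenvalue_or_mem_resolventSet one_ne_zero with h | h
  · obtain ⟨v, hv⟩ := h.exists_hasEigenvector
    have h1 : Y v = v := by simpa using hv.apply_eq_smul
    exact absurd (hi (by rw [sub_apply, one_apply_eq_self, h1, sub_self, map_zero] :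
      (1 - Y) v = (1 - Y) 0)) hv.2
  · rw [spectrum.mem_resolventSet_iff, map_one] at h
    exact h

theorem rk_sub_of_mul_eq {E F : H →L[ℂ] H} (hE : IsStarProjection E) (hF : IsStarProjection F)
    (hfin : FiniteRank E) (h1 : E * F = F) (h2 : F * E = F) :
    FiniteRank (E - F) ∧ rk E = rk F + rk (E - F) := by
  have hN : IsStarProjection (E - F) := by
    refine ⟨?_, hE.isSelfAdjoint.sub hF.isSelfAdjoint⟩
    rw [IsIdempotentElem, mul_sub, sub_mul, sub_mul, h1, h2, hE.isIdempotentElem.eq,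
      hF.isIdempotentElem.eq]
    abel
  have hEN : E * (E - F) = E - F := by rw [mul_sub, h1, hE.isIdempotentElem.eq]
  have hle : LinearMap.range ((E - F : H →L[ℂ] H) : H →ₗ[ℂ] H) ≤
      LinearMap.range (E : H →ₗ[ℂ] H) := by
    rintro x ⟨y, rfl⟩
    exact ⟨(E - F) y, congr($hEN y)⟩
  have hle' : LinearMap.range (F : H →ₗ[ℂ] H) ≤ LinearMap.range (E : H →ₗ[ℂ] H) := by
    rintro x ⟨y, rfl⟩
    exact ⟨F y, congr($h1 y)⟩
  have i1 : FiniteDimensional ℂ (LinearMap.range (E : H →ₗ[ℂ] H)) := hfin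
  have i2 := Submodule.finiteDimensional_of_le hle
  have i3 := Submodule.finiteDimensional_of_le hle'
  refine ⟨i2, ?_⟩
  have hsup : LinearMap.range (F : H →ₗ[ℂ] H) ⊔ LinearMap.range ((E - F : H →L[ℂ] H) : H →ₗ[ℂ] H)
      = LinearMap.range (E : H →ₗ[ℂ] H) := by
    refine le_antisymm (sup_le hle' hle) ?_
    rintro x ⟨y, rfl⟩
    have : (E : H →ₗ[ℂ] H) y = (F : H →ₗ[ℂ] H) y + ((E - F : H →L[ℂ] H) : H →ₗ[ℂ] H) y := by
      simp
    rw [this]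
    exact Submodule.add_mem_sup ⟨y, rfl⟩ ⟨y, rfl⟩
  have hinf : LinearMap.range (F : H →ₗ[ℂ] H) ⊓ LinearMap.range ((E - F : H →L[ℂ] H) : H →ₗ[ℂ] H)
      = ⊥ := by
    rw [Submodule.eq_bot_iff]
    rintro x ⟨hx1, hx2⟩
    have e1 := (mem_range_iff_of_isStarProjection hF).1 hx1
    have e2 := (mem_range_iff_of_isStarProjection hN).1 hx2
    have e3 : E x = x := by rw [← e1, ← mul_apply_eq_comp, h1]
    rw [sub_apply, e3, e1, sub_self] at e2
    exact e2.symm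
  have := Submodule.finrank_sup_add_finrank_inf_eq (LinearMap.range (F : H →ₗ[ℂ] H))
    (LinearMap.range ((E - F : H →L[ℂ] H) : H →ₗ[ℂ] H))
  rw [hsup, hinf, finrank_bot, add_zero] at this
  exact this

end Parametrix

/-! ### Change of the index along one piece of the path. -/

section Level

variable {H : Type*} [NormedAddCommGroup H] [InnerProductSpace ℂ H] [CompleteSpace H]
  {T : Type*} [TopologicalSpace T] [CompactSpace T]

theorem StrongCont.of_continuous {M : T → H →L[ℂ] H} (hM : Continuous M) : StrongCont M := by
  obtain ⟨C, hC⟩ := (isCompact_range hM).isBounded.exists_norm_le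
  refine ⟨⟨C, fun t => hC _ ⟨t, rfl⟩⟩, fun x => hM.clm_apply continuous_const, fun x => ?_⟩
  exact (continuous_star.comp hM).clm_apply continuous_const

variable {D K : T → H →ₗ.[ℂ] H} {C : T → H →L[ℂ] H} {μ : ℝ}

/-- Reduction to `IsPosProj.compactCont_sub` for `L = levelInv (D t) μ` and `S = (D + K)⁻¹`. From `S
(1 - Y) = L` and injectivity of `L`, the operator `1 - Y` is injective, hence invertible, and `S = L
(1 - Y)⁻¹` is strongly continuous. This also gives `S - L = S Y`, whose adjoint is the factorisation
with `L` on the right. -/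
theorem compactCont_sub_of_level (hD : ∀ t, IsSelfAdjoint (D t))
    (hR : StrongCont fun t => resolv (D t) Complex.I)
    (hC : ∀ t, IsComposition (K t) (resolv (D t) Complex.I) (C t)) (hCc : CompactCont C)
    (hBs : ∀ t, IsSelfAdjoint (D t + K t)) (hB : ∀ t, IsInvertible (D t + K t)) (hμ : 0 < μ)
    (h : ∀ t, μ ∉ specSet (D t)) (h' : ∀ t, -μ ∉ specSet (D t))
    (hfin : ∀ t, FiniteRank (spectralProj (D t) (Icc (-μ) μ)))
    (hE : Continuous fun t => spectralProj (D t) (Icc (-μ) μ)) :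
    (StrongCont fun t => nonnegProj (D t) +
      (1 - nonnegProj (D t)) * spectralProj (D t) (Icc (-μ) μ)) ∧
    (StrongCont fun t => nonnegProj (D t + K t)) ∧
    CompactCont fun t => nonnegProj (D t) +
      (1 - nonnegProj (D t)) * spectralProj (D t) (Icc (-μ) μ) - nonnegProj (D t + K t) := by
  choose S hS using hB
  have cE : CompactCont fun t => spectralProj (D t) (Icc (-μ) μ) := ⟨hE, fun t => (hfin t).compact⟩
  have sE := StrongCont.of_continuous hE
  have sl := hR.funcCalc hD (isC0_id_mul_hat (show μ < 2 * μ by linarith))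
  have sr := hR.funcCalc hD (isC0_recip hμ)
  have s1 : StrongCont fun _ : T => (1 : H →L[ℂ] H) := StrongCont.one
  have cl := cE.mul_left sl
  have sW : StrongCont fun t => levelComp (D t) μ := (s1.sub sE).add (sl.mul sE)
  have sL : StrongCont fun t => levelInv (D t) μ := (sr.mul (s1.sub sE)).add sE
  set Y : T → H →L[ℂ] H := fun t => 1 - levelComp (D t) μ -
    C t * (levelComp (D t) μ + Complex.I • levelInv (D t) μ) with hY
  have cY : CompactCont Y := by
    have h1 := (cE.sub cl).sub (hCc.mul_right (sW.add (sL.smul Complex.I)))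
    convert h1 using 2 with t
    change 1 - levelComp (D t) μ - _ = _
    congr 1
    rw [levelComp]
    abel
  have hSY : ∀ t, S t * (1 - Y t) = levelInv (D t) μ := fun t =>
    boundedInverse_mul_one_sub (hD t) (hC t) (hS t) hμ (h t) (h' t)
  have hLi := fun t => levelInv_injective (hD t) hμ (h t) (h' t)
  have hu : ∀ t, IsUnit (1 - Y t) := fun t => by
    refine isUnit_one_sub_of_injective (cY.compact t) fun x y hxy => hLi t ?_
    rw [← hSY, mul_apply_eq_comp, hxy, mul_apply_eq_comp]
  set G : T → H →L[ℂ] H := fun t => Ring.inverse (1 - Y t) with hG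
  have hGc : Continuous G := by
    rw [continuous_iff_continuousAt]
    intro t
    obtain ⟨u, hu⟩ := hu t
    have h1 := NormedRing.inverse_continuousAt u
    rw [hu] at h1
    exact ContinuousAt.comp (f := fun t => 1 - Y t) h1 (continuous_const.sub cY.cont).continuousAt
  have sG := StrongCont.of_continuous hGc
  have hSG : ∀ t, S t = levelInv (D t) μ * G t := fun t => by
    rw [← hSY, mul_assoc, Ring.mul_inverse_cancel _ (hu t), mul_one]
  have sS : StrongCont S := by
    have := sL.mul sG
    convert this using 2 with t
    exact hSG t
  have hSs := fun t => isSelfAdjoint_of_isBoundedInverse (hBs t) (hS t)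
  have hSi : ∀ t, Function.Injective (S t) := fun t x y hxy => by
    have := (isBoundedInverse_iff.1 (hS t)).2
    have h1 := this x
    rw [hxy] at h1
    exact graph_unique h1 (this y)
  have hLs := fun t => isSelfAdjoint_levelInv (D t) μ
  have hP := fun t => isPosProj_levelInv (hD t) hμ
  have hQ := fun t => isPosProj_boundedInverse (hBs t) (hS t)
  have e1 : ∀ t, S t - levelInv (D t) μ = S t * Y t := fun t => by
    rw [← hSY]; noncomm_ring
  have e2 : ∀ t, S t - levelInv (D t) μ = (star (Y t) * star (G t)) * levelInv (D t) μ := fun t => by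
    have h1 := congrArg star (e1 t)
    rw [star_sub, star_mul, (hSs t).star_eq, (hLs t).star_eq] at h1
    have h2 := congrArg star (hSG t)
    rw [star_mul, (hSs t).star_eq, (hLs t).star_eq] at h2
    rw [h1, mul_assoc, ← h2]
  refine ⟨IsPosProj.strongCont hP sL hLs hLi, IsPosProj.strongCont hQ sS hSs hSi,
    IsPosProj.compactCont_sub hP hQ sL sS hLs hSs hLi hSi cY (cY.star.mul_right sG.star) e1 e2⟩

/-- `(1 - P) E` is `E` minus `1_{[0,μ]}(D)`, so passing from `1_{≥-μ}(D)` back to `P` changes the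
index by `rk E - levelDim`. The index for `1_{≥-μ}(D)` and the rank of `E` are constant. -/
theorem isIndexPair_and_levelDim_sub [PreconnectedSpace T] (hD : ∀ t, IsSelfAdjoint (D t))
    (hR : StrongCont fun t => resolv (D t) Complex.I)
    (hC : ∀ t, IsComposition (K t) (resolv (D t) Complex.I) (C t)) (hCc : CompactCont C)
    (hBs : ∀ t, IsSelfAdjoint (D t + K t)) (hB : ∀ t, IsInvertible (D t + K t)) (hμ : 0 < μ)
    (h : ∀ t, μ ∉ specSet (D t)) (h' : ∀ t, -μ ∉ specSet (D t))
    (hfin : ∀ t, FiniteRank (spectralProj (D t) (Icc (-μ) μ)))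
    (hE : Continuous fun t => spectralProj (D t) (Icc (-μ) μ)) :
    (∀ t, IsIndexPair (nonnegProj (D t)) (nonnegProj (D t + K t))) ∧
    ∀ s t, (levelDim (D t) μ : ℤ) - levelDim (D s) μ =
      pairIndex (nonnegProj (D t)) (nonnegProj (D t + K t)) -
        pairIndex (nonnegProj (D s)) (nonnegProj (D s + K s)) := by
  obtain ⟨sP, sQ, cPQ⟩ := compactCont_sub_of_level hD hR hC hCc hBs hB hμ h h' hfin hE
  have hP : ∀ t, IsStarProjection (nonnegProj (D t)) := fun t =>
    isStarProjection_spectralProj (D t) (Ici 0)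
  have hEp := fun t => isStarProjection_spectralProj (D t) (Icc (-μ) μ)
  have hQ : ∀ t, IsStarProjection (nonnegProj (D t + K t)) := fun t =>
    isStarProjection_spectralProj (D t + K t) (Ici 0)
  have hPE : ∀ t, nonnegProj (D t) * spectralProj (D t) (Icc (-μ) μ) =
    spectralProj (D t) (Icc 0 μ) := fun t =>
      spectralProj_mul_of_inf (spectralSubspace_Ici_inf_Icc (hD t) hμ)
  have hN : ∀ t, (1 - nonnegProj (D t)) * spectralProj (D t) (Icc (-μ) μ) =
      spectralProj (D t) (Icc (-μ) μ) - spectralProj (D t) (Icc 0 μ) := fun t => by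
    rw [sub_mul, one_mul, hPE]
  have hcomm := fun t => commute_spectralProj (D t) (Ici 0) (Icc (-μ) μ)
  have hrk := fun t => rk_sub_of_mul_eq (hEp t) (isStarProjection_spectralProj (D t) (Icc 0 μ))
    (hfin t) (by rw [← hPE, nonnegProj, (hcomm t).eq, ← mul_assoc, (hEp t).isIdempotentElem.eq])
    (by rw [← hPE, mul_assoc, (hEp t).isIdempotentElem.eq])
  have hNp : ∀ t, IsStarProjection
      ((1 - nonnegProj (D t)) * spectralProj (D t) (Icc (-μ) μ)) := fun t =>
    (hP t).one_sub.mul (hEp t) ((Commute.one_left _).sub_left (hcomm t))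
  have hNfin : ∀ t, FiniteRank
      ((1 - nonnegProj (D t)) * spectralProj (D t) (Icc (-μ) μ)) := fun t => by
    rw [hN]; exact (hrk t).1
  have hcpt : ∀ t, IsCompactOperator (nonnegProj (D t) - nonnegProj (D t + K t) : H →L[ℂ] H) := by
    intro t
    have h1 := (cPQ.compact t).sub (hNfin t).compact
    have e : nonnegProj (D t) - nonnegProj (D t + K t) = nonnegProj (D t) +
        (1 - nonnegProj (D t)) * spectralProj (D t) (Icc (-μ) μ) - nonnegProj (D t + K t) -
        (1 - nonnegProj (D t)) * spectralProj (D t) (Icc (-μ) μ) := by abel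
    rw [e]
    exact h1
  refine ⟨fun t => IsDefectPair.of_isCompactOperator (hP t) (hQ t) (hcpt t), fun s t => ?_⟩
  have hadd : ∀ t, pairIndex (nonnegProj (D t) +
      (1 - nonnegProj (D t)) * spectralProj (D t) (Icc (-μ) μ)) (nonnegProj (D t + K t)) =
      pairIndex (nonnegProj (D t)) (nonnegProj (D t + K t)) +
        (rk (spectralProj (D t) (Icc (-μ) μ)) - levelDim (D t) μ) := by
    intro t
    rw [pairIndex_add (hP t) (hQ t) (hNp t) (hNfin t) _ (hcpt t), hN, (hrk t).2]
    · change _ = _ + (((levelDim (D t) μ + _ : ℕ) : ℤ) - _)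
      push_cast
      ring
    · rw [← mul_assoc, mul_sub, mul_one, (hP t).isIdempotentElem.eq, sub_self, zero_mul]
  have hconst := pairIndex_eq_of_compactCont (fun t => (isPosProj_levelInv (hD t) hμ).proj) hQ sP sQ
    cPQ s t
  rw [hadd, hadd, rk_eq_of_continuous hEp hfin hE s t] at hconst
  linarith

end Level

/-! ### The spectral gap at `0` of a Fredholm operator and its stability. -/

section Gap

variable {H : Type*} [NormedAddCommGroup H] [InnerProductSpace ℂ H] [CompleteSpace H]

/-- A quasi-inverse `v` satisfies `F v F = F`, so `y - v F y` lies in the kernel. If `y` is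
orthogonal to the kernel, then `‖y‖² = ⟨y, v F y⟩`. -/
theorem exists_bound_of_isFredholm {F : H →L[ℂ] H} (hF : F.IsFredholm) :
    ∃ C > 0, ∀ y, (∀ x, F x = 0 → inner ℂ y x = 0) → ‖y‖ ≤ C * ‖F y‖ := by
  obtain ⟨pkg⟩ := hF.nonempty_fredholmPackage
  have hv : ∀ x, F (pkg.quasiInverse (F x)) = F x := by
    intro x
    have e : ∀ x, F x = (pkg.equiv (pkg.decDom.proj x) : H) := fun x => congr($(pkg.eq_equiv) x)
    have e2 : pkg.quasiInverse (F x) = (pkg.decDom.proj x : H) := by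
      rw [e]
      simp [ContinuousLinearMap.FredholmPackage.quasiInverse]
    have e3 : pkg.decDom.proj (pkg.decDom.proj x : H) = pkg.decDom.proj x :=
      Submodule.projectionOnto_apply_left pkg.decDom.isTopCompl.isCompl _
    rw [e2, e, e, e3]
  refine ⟨‖pkg.quasiInverse‖ + 1, by positivity, fun y hy => ?_⟩
  have h1 := hy (y - pkg.quasiInverse (F y)) (by rw [map_sub, hv, sub_self])
  rw [inner_sub_right, sub_eq_zero] at h1
  have h2 : ‖y‖ * ‖y‖ ≤ ‖y‖ * (‖pkg.quasiInverse‖ * ‖F y‖) := by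
    rw [← inner_self_eq_norm_mul_norm (𝕜 := ℂ) y, h1]
    refine (RCLike.re_le_norm _).trans ((norm_inner_le_norm _ _).trans ?_)
    gcongr
    exact pkg.quasiInverse.le_opNorm _
  rcases (norm_nonneg y).eq_or_lt with h | h
  · rw [← h]; positivity
  · have := le_of_mul_le_mul_left h2 h
    nlinarith [norm_nonneg (F y)]

/-- The function `(1 + x²)^{-1/2}`. -/
noncomputable def invSqrt (x : ℝ) : ℝ := (Real.sqrt (1 + x ^ 2))⁻¹

theorem sqrt_one_add_sq_pos (x : ℝ) : 0 < Real.sqrt (1 + x ^ 2) := Real.sqrt_pos.2 (by positivity)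

theorem invSqrt_pos (x : ℝ) : 0 < invSqrt x := inv_pos.2 (sqrt_one_add_sq_pos x)

theorem abs_le_sqrt_one_add_sq (x : ℝ) : |x| ≤ Real.sqrt (1 + x ^ 2) :=
  Real.abs_le_sqrt (by linarith)

theorem invSqrt_le_one (x : ℝ) : invSqrt x ≤ 1 :=
  inv_le_one_of_one_le₀ (Real.one_le_sqrt.2 (by nlinarith [sq_nonneg x]))

theorem continuous_invSqrt : Continuous invSqrt :=
  (by fun_prop : Continuous fun x : ℝ => Real.sqrt (1 + x ^ 2)).inv₀
    fun x => (sqrt_one_add_sq_pos x).ne'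

theorem isC0_invSqrt : IsC0 invSqrt := by
  refine isC0_of_abs_le (C := 1) (M := 1) continuous_invSqrt fun x hx => ?_
  rw [abs_of_pos (invSqrt_pos x), invSqrt, ← one_div]
  exact one_div_le_one_div_of_le (by linarith) (abs_le_sqrt_one_add_sq x)

theorem invSqrt_mul_self (x : ℝ) : invSqrt x * invSqrt x = invOneAddSq x := by
  rw [invSqrt, invOneAddSq, ← mul_inv, Real.mul_self_sqrt (by positivity)]

/-- The function `x (1 + x²)^{-1/2}`. -/
noncomputable def bddFun (x : ℝ) : ℝ := x * invSqrt x

theorem continuous_bddFun : Continuous bddFun := continuous_id.mul continuous_invSqrt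

theorem abs_bddFun_le_one (x : ℝ) : |bddFun x| ≤ 1 := by
  rw [bddFun, abs_mul, abs_of_pos (invSqrt_pos x), invSqrt, ← div_eq_mul_inv]
  exact div_le_one_of_le₀ (abs_le_sqrt_one_add_sq x) (sqrt_one_add_sq_pos x).le

theorem abs_bddFun_le_abs (x : ℝ) : |bddFun x| ≤ |x| := by
  rw [bddFun, abs_mul, abs_of_pos (invSqrt_pos x)]
  exact mul_le_of_le_one_right (abs_nonneg x) (invSqrt_le_one x)

variable {D : H →ₗ.[ℂ] H}

theorem norm_funcCalc_invSqrt_apply (hD : IsSelfAdjoint D) (u : H) :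
    ‖funcCalc D invSqrt u‖ = ‖resolv D Complex.I u‖ := by
  have h1 : funcCalc D invSqrt * funcCalc D invSqrt =
      star (resolv D Complex.I) * resolv D Complex.I := by
    rw [← funcCalc_invOneAddSq hD, ← funcCalc_mul (isC0_invSqrt.isC0On hD)
      (isC0_invSqrt.isC0On hD)]
    exact funcCalc_congr hD fun x _ => invSqrt_mul_self x
  have h2 : inner ℂ (funcCalc D invSqrt u) (funcCalc D invSqrt u) =
      inner ℂ (resolv D Complex.I u) (resolv D Complex.I u) := by
    rw [← inner_apply_of_isSelfAdjoint (isSelfAdjoint_funcCalc D invSqrt), ← mul_apply_eq_comp, h1,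
      mul_apply_eq_comp, ContinuousLinearMap.star_eq_adjoint, ContinuousLinearMap.adjoint_inner_left]
  rw [inner_self_eq_norm_sq_to_K, inner_self_eq_norm_sq_to_K] at h2
  have h3 : ‖funcCalc D invSqrt u‖ ^ 2 = ‖resolv D Complex.I u‖ ^ 2 := by exact_mod_cast h2
  exact (sq_eq_sq₀ (norm_nonneg _) (norm_nonneg _)).1 h3

/-- By selfadjointness it suffices to bound `⟨y, (1 + D²)^{-1/2} D x⟩` by a multiple of `‖x‖`. The
operator `(1 + D²)^{-1/2}` has the same norms on vectors as the resolvent `R`, and `R D x = x - i R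
x`, which gives the factor `2`. -/
theorem funcCalc_invSqrt_mem_domain (hD : IsSelfAdjoint D) (y : H) :
    funcCalc D invSqrt y ∈ D.domain := by
  have h : funcCalc D invSqrt y ∈ D.adjoint.domain := by
    rw [LinearPMap.mem_adjoint_domain_iff]
    refine AddMonoidHomClass.continuous_of_bound _ (‖y‖ * 2) fun x => ?_
    change ‖inner ℂ (funcCalc D invSqrt y) (D x)‖ ≤ _
    rw [inner_apply_of_isSelfAdjoint (isSelfAdjoint_funcCalc D invSqrt)]
    refine (norm_inner_le_norm _ _).trans ?_
    rw [norm_funcCalc_invSqrt_apply hD, mul_assoc]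
    refine mul_le_mul_of_nonneg_left ?_ (norm_nonneg y)
    have h1 := resolv_I_apply hD (D.mem_graph x)
    rw [map_add, map_smul, ← eq_sub_iff_add_eq] at h1
    rw [h1, two_mul]
    refine (norm_sub_le _ _).trans (add_le_add le_rfl ?_)
    rw [norm_smul, Complex.norm_I, one_mul]
    exact (ContinuousLinearMap.le_of_opNorm_le _ (norm_resolv_le hD) _).trans (by rw [one_mul]; rfl)
  rwa [LinearPMap.isSelfAdjoint_def.1 hD] at h

theorem boundedTransform_mem_graph (hD : IsSelfAdjoint D) (y : H) :
    (funcCalc D invSqrt y, boundedTransform D y) ∈ D.graph := by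
  have hs : D.IsFormalAdjoint D := by
    have := LinearPMap.adjoint_isFormalAdjoint (T := D) hD.dense_domain
    rwa [LinearPMap.isSelfAdjoint_def.1 hD] at this
  obtain ⟨C, hC⟩ := exists_isComposition hs hD.dense_domain (funcCalc_invSqrt_mem_domain hD)
  have : boundedTransform D = C := hC.boundedComp_eq
  rw [this]
  exact isComposition_iff.1 hC y

theorem funcCalc_apply_mem_graph (hD : IsSelfAdjoint D) (k : ℝ → ℝ) {x y : H}
    (h : (x, y) ∈ D.graph) : (funcCalc D k x, funcCalc D k y) ∈ D.graph := by
  have h1 := resolv_I_mem_graph hD (funcCalc D k (y + Complex.I • x))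
  rw [← mul_apply_eq_comp, (commute_resolv_funcCalc hD k).eq, mul_apply_eq_comp,
    resolv_I_apply hD h] at h1
  simpa using h1

theorem IsC0.bddFun_mul {k : ℝ → ℝ} (hk : IsC0 k) : IsC0 fun x => bddFun x * k x := by
  simpa only [mul_comm] using hk.mul_of_bounded continuous_bddFun abs_bddFun_le_one

theorem boundedTransform_funcCalc (hD : IsSelfAdjoint D) {k : ℝ → ℝ} (hk : IsC0 k) (y : H) :
    boundedTransform D (funcCalc D k y) = funcCalc D (fun x => bddFun x * k x) y := by
  have h1 := boundedTransform_mem_graph hD (funcCalc D k y)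
  have hw := isC0_invSqrt.isC0On hD
  rw [← mul_apply_eq_comp, ← funcCalc_mul hw (hk.isC0On hD)] at h1
  have h2 := funcCalc_mem_graph hD (c := 0) (hw.mul (hk.isC0On hD)) (hk.bddFun_mul.isC0On hD)
    (fun x _ => by rw [zero_add, bddFun, mul_assoc]) y
  rw [Complex.ofReal_zero, zero_smul, zero_add] at h2
  exact graph_unique h1 h2

theorem boundedTransform_funcCalc_comm (hD : IsSelfAdjoint D) (k : ℝ → ℝ) (y : H) :
    boundedTransform D (funcCalc D k y) = funcCalc D k (boundedTransform D y) := by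
  have h1 := boundedTransform_mem_graph hD (funcCalc D k y)
  have h2 := funcCalc_apply_mem_graph hD k (boundedTransform_mem_graph hD y)
  rw [← mul_apply_eq_comp, (commute_funcCalc D _ _).eq, mul_apply_eq_comp] at h1
  exact graph_unique h1 h2

/-- A continuous function that is positive exactly for `a < |x| < b`. -/
noncomputable def bump (a b x : ℝ) : ℝ := max 0 (min (|x| - a) (b - |x|))

theorem bump_eq_zero {a b x : ℝ} (h : |x| ≤ a ∨ b ≤ |x|) : bump a b x = 0 := by
  refine max_eq_left ?_
  rcases h with h | h
  · exact (min_le_left _ _).trans (by linarith)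
  · exact (min_le_right _ _).trans (by linarith)

theorem bump_pos {a b x : ℝ} (h : a < |x|) (h' : |x| < b) : 0 < bump a b x :=
  lt_max_of_lt_right (lt_min (by linarith) (by linarith))

theorem isC0_bump (a b : ℝ) : IsC0 (bump a b) := by
  refine IsC0.of_hasCompactSupport (by unfold bump; fun_prop)
    (hasCompactSupport_of_abs (b := b) fun x hx => bump_eq_zero (Or.inr hx.le))

theorem finiteRank_spectralProj_zero (hD : IsSelfAdjoint D)
    (hF : (boundedTransform D).IsFredholm) : FiniteRank (spectralProj D {0}) := by
  have := hF.finite_ker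
  have hk := isC0_hat (show (1 : ℝ) < 2 by norm_num)
  rw [FiniteRank, range_spectralProj]
  refine Submodule.finiteDimensional_of_le (S₂ := (boundedTransform D).ker) fun x hx => ?_
  have h1 := funcCalc_apply_eq_self hD hk (fun s hs => by
    rw [mem_singleton_iff] at hs
    exact hat_eq_one (by norm_num) (by rw [hs]; simp)) hx
  change boundedTransform D x = 0
  rw [← h1, boundedTransform_funcCalc hD hk]
  exact funcCalc_apply_eq_zero hD hk.bddFun_mul (fun s hs => by
    rw [mem_singleton_iff] at hs
    rw [hs, bddFun, zero_mul, zero_mul]) hx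

/-- Near a spectral point `x₀ ≠ 0` with `3 C |x₀| < 1`, the bounded transform has norm at most `3
|x₀|` on vectors orthogonal to its kernel, contrary to the lower bound. So a bump around `x₀` gives
the operator `0`, which is impossible at a point of the spectrum. -/
theorem exists_gap_of_isFredholm (hD : IsSelfAdjoint D) (hF : (boundedTransform D).IsFredholm) :
    ∃ ε > 0, ∀ x ∈ specSet D, x ≠ 0 → ε ≤ |x| := by
  obtain ⟨C, hC, hb⟩ := exists_bound_of_isFredholm hF
  refine ⟨1 / (3 * C), by positivity, fun x₀ hx₀ hne => ?_⟩
  by_contra hlt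
  rw [not_le, lt_div_iff₀ (by positivity)] at hlt
  have hpos : 0 < |x₀| := abs_pos.2 hne
  set a := |x₀| with ha
  have hk := isC0_bump (a / 2) (2 * a)
  have hf := hk.bddFun_mul
  have hh : IsC0 fun x => bddFun x * hat (2 * a) (3 * a) x :=
    (isC0_hat (show 2 * a < 3 * a by linarith)).bddFun_mul
  have hzero : funcCalc D (fun x => bddFun x * bump (a / 2) (2 * a) x) = 0 := by
    ext v
    rw [zero_apply]
    set y := funcCalc D (fun x => bddFun x * bump (a / 2) (2 * a) x) v with hy
    -- `y` lies in the range of the bounded transform and is therefore orthogonal to its kernel.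
    have h1 : ‖y‖ ≤ C * ‖boundedTransform D y‖ := by
      refine hb y fun x hx => ?_
      rw [hy, inner_apply_of_isSelfAdjoint (isSelfAdjoint_funcCalc D _),
        ← boundedTransform_funcCalc hD hk, boundedTransform_funcCalc_comm hD, hx, map_zero,
        inner_zero_right]
    have h2 : boundedTransform D y =
        funcCalc D (fun x => bddFun x * hat (2 * a) (3 * a) x) y := by
      rw [hy, boundedTransform_funcCalc hD hf, ← mul_apply_eq_comp,
        ← funcCalc_mul (hh.isC0On hD) (hf.isC0On hD)]
      congr 1
      refine funcCalc_congr hD fun x _ => ?_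
      by_cases hx : |x| ≤ 2 * a
      · rw [hat_eq_one (by linarith) hx, mul_one]
      · rw [bump_eq_zero (Or.inr (not_le.1 hx).le)]; ring
    have h3 : ‖funcCalc D (fun x => bddFun x * hat (2 * a) (3 * a) x)‖ ≤ 3 * a := by
      refine norm_funcCalc_le hD (by positivity) fun x _ => ?_
      rw [abs_mul, abs_of_nonneg (hat_nonneg _ _ x)]
      by_cases hx : |x| ≤ 3 * a
      · exact (mul_le_of_le_one_right (abs_nonneg _) (hat_le_one _ _ x)).trans
          ((abs_bddFun_le_abs x).trans hx)
      · rw [hat_eq_zero (by linarith) (not_le.1 hx).le, mul_zero]; positivity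
    have h4 := ContinuousLinearMap.le_of_opNorm_le _ h3 y
    rw [← h2] at h4
    have h5 : ‖y‖ ≤ C * (3 * a * ‖y‖) := h1.trans (by gcongr)
    have h6 : ‖y‖ ≤ 0 := by nlinarith [norm_nonneg y]
    exact norm_le_zero_iff.1 h6
  have h7 := eq_zero_of_funcCalc_eq_zero hD (hf.isC0On hD) hzero x₀ hx₀
  have h8 := bump_pos (a := a / 2) (b := 2 * a) (x := x₀) (by rw [← ha]; linarith)
    (by rw [← ha]; linarith)
  have h9 : bddFun x₀ ≠ 0 := mul_ne_zero hne (invSqrt_pos x₀).ne'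
  exact mul_ne_zero h9 h8.ne' h7

/-- The projection `E` is injective on the spectral subspace of `[-ε, ε]`. -/
def NearKer (E : H →L[ℂ] H) (ε : ℝ) (D : H →ₗ.[ℂ] H) : Prop :=
  ∀ x ∈ spectralSubspace D (Icc (-ε) ε), E x = 0 → x = 0

theorem NearKer.mono {E : H →L[ℂ] H} {ε ε' : ℝ} (h : NearKer E ε D) (hε : ε' ≤ ε) :
    NearKer E ε' D := fun x hx =>
  h x (spectralSubspace_mono (Icc_subset_Icc (by linarith) hε) hx)

/-- On the spectral subspace of `[-ε, ε]`, `ψ(D) - c` acts as the nonnegative operator given by the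
truncated positive part of `ψ - c`; pair with `x`. -/
theorem le_norm_funcCalc_apply (hD : IsSelfAdjoint D) {ψ : ℝ → ℝ} (hψ : IsC0 ψ) {ε c : ℝ}
    (hε : 0 < ε) (h : ∀ s, |s| ≤ ε → c ≤ ψ s) {x : H}
    (hx : x ∈ spectralSubspace D (Icc (-ε) ε)) : c * ‖x‖ ≤ ‖funcCalc D ψ x‖ := by
  have hk := isC0_hat (show ε < 2 * ε by linarith)
  have hk1 := funcCalc_apply_eq_self hD hk (fun s hs => hat_eq_one (by linarith) (abs_le.2 hs)) hx
  have hkc := (hk.isC0On hD).const_mul c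
  have hp : IsC0 fun s => max (ψ s - c) 0 * hat ε (2 * ε) s :=
    IsC0.of_hasCompactSupport (((hψ.1.sub continuous_const).max continuous_const).mul hk.1)
      (hasCompactSupport_of_abs (b := 2 * ε) fun s hs => by
        rw [hat_eq_zero (by linarith) hs.le, mul_zero])
  have hψk := (hψ.isC0On hD).mul (hk.isC0On hD)
  have hq : IsC0 fun s => max (ψ s - c) 0 * hat ε (2 * ε) s -
      (ψ s * hat ε (2 * ε) s - c * hat ε (2 * ε) s) :=
    hp.sub ((hψ.mul_hat _ _).sub (by
      simpa only [mul_comm] using hk.mul_of_bounded (continuous_const (y := c)) fun _ => le_rfl))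
  have h1 := funcCalc_apply_eq_zero hD hq (fun s hs => by
    rw [max_eq_left (sub_nonneg.2 (h s (abs_le.2 hs)))]; ring) hx
  rw [funcCalc_sub (hp.isC0On hD) (hψk.sub hkc), funcCalc_sub hψk hkc, funcCalc_const_mul c
    (hk.isC0On hD), funcCalc_mul (hψ.isC0On hD) (hk.isC0On hD), sub_apply, sub_apply, smul_apply,
    mul_apply_eq_comp, hk1, sub_eq_zero] at h1
  have h2 : 0 ≤ (inner ℂ x (funcCalc D (fun s => max (ψ s - c) 0 * hat ε (2 * ε) s) x)).re := by
    have := funcCalc_nonneg hD (f := fun s => max (ψ s - c) 0 * hat ε (2 * ε) s) fun s _ =>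
      mul_nonneg (le_max_right _ _) (hat_nonneg _ _ _)
    rw [ContinuousLinearMap.nonneg_iff_isPositive] at this
    exact this.re_inner_nonneg_right x
  rw [h1, inner_sub_right, inner_smul_right, Complex.sub_re, Complex.re_ofReal_mul] at h2
  have h3 : (inner ℂ x x).re = ‖x‖ * ‖x‖ := inner_self_eq_norm_mul_norm (𝕜 := ℂ) x
  rw [h3] at h2
  have h4 : (inner ℂ x (funcCalc D ψ x)).re ≤ ‖x‖ * ‖funcCalc D ψ x‖ :=
    (Complex.re_le_norm _).trans (norm_inner_le_norm _ _)
  rcases (norm_nonneg x).eq_or_lt with h0 | h0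
  · rw [← h0, mul_zero]; exact norm_nonneg _
  · refine le_of_mul_le_mul_left ?_ h0
    nlinarith

theorem spectralProj_zero_eq (hD : IsSelfAdjoint D) {ε a b : ℝ}
    (hg : ∀ x ∈ specSet D, x ≠ 0 → ε ≤ |x|) (ha : 0 ≤ a) (hab : a < b) (hb : b ≤ ε) :
    spectralProj D {0} = funcCalc D (hat a b) := by
  refine spectralProj_eq_funcCalc hD (isC0_hat hab) (fun s hs => ?_) fun s hs hs0 => ?_
  · rw [mem_singleton_iff] at hs
    exact hat_eq_one hab (by rw [hs, abs_zero]; exact ha)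
  · exact hat_eq_zero hab (hb.trans (hg s hs hs0))

theorem norm_funcCalc_apply_le (hD : IsSelfAdjoint D) {ψ : ℝ → ℝ} (hψ : IsC0 ψ) {ε d : ℝ}
    (hε : 0 < ε) (hg : ∀ x ∈ specSet D, x ≠ 0 → ε ≤ |x|) (hd : 0 ≤ d)
    (h : ∀ s, ε ≤ |s| → |ψ s| ≤ d) {x : H} (hx : spectralProj D {0} x = 0) :
    ‖funcCalc D ψ x‖ ≤ d * ‖x‖ := by
  rw [spectralProj_zero_eq hD hg le_rfl hε le_rfl] at hx
  have hk := isC0_hat hε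
  have h1 : funcCalc D ψ x = funcCalc D (fun s => ψ s - ψ s * hat 0 ε s) x := by
    rw [funcCalc_sub (hψ.isC0On hD) ((hψ.isC0On hD).mul (hk.isC0On hD)),
      funcCalc_mul (hψ.isC0On hD) (hk.isC0On hD), sub_apply, mul_apply_eq_comp, hx, map_zero,
      sub_zero]
  rw [h1]
  refine ContinuousLinearMap.le_of_opNorm_le _ (norm_funcCalc_le hD hd fun s hs => ?_) x
  by_cases h0 : s = 0
  · rw [h0, hat_eq_one hε (by simp), mul_one, sub_self, abs_zero]
    exact hd
  · rw [hat_eq_zero hε (hg s hs h0), mul_zero, sub_zero]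
    exact h s (hg s hs h0)

/-- For `x` in the spectral subspace of `D` and orthogonal to the kernel of `D₀`, `‖ψ(D) x‖ ≥ c ‖x‖`
while `‖ψ(D₀) x‖ ≤ d ‖x‖`. The two operators are too close for this unless `x = 0`. -/
theorem nearKer_of_norm_sub_lt {D₀ : H →ₗ.[ℂ] H} (hD₀ : IsSelfAdjoint D₀) (hD : IsSelfAdjoint D)
    {ψ : ℝ → ℝ} (hψ : IsC0 ψ) {ε ε₀ c d : ℝ} (hε : 0 < ε) (hε₀ : 0 < ε₀)
    (hg : ∀ x ∈ specSet D₀, x ≠ 0 → ε₀ ≤ |x|) (hc : ∀ s, |s| ≤ ε → c ≤ ψ s) (hd : 0 ≤ d)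
    (hψd : ∀ s, ε₀ ≤ |s| → |ψ s| ≤ d) (h : ‖funcCalc D ψ - funcCalc D₀ ψ‖ < c - d) :
    NearKer (spectralProj D₀ {0}) ε D := by
  intro x hx hx0
  have h1 := le_norm_funcCalc_apply hD hψ hε hc hx
  have h2 := norm_funcCalc_apply_le hD₀ hψ hε₀ hg hd hψd hx0
  have h3 := (funcCalc D ψ - funcCalc D₀ ψ).le_opNorm x
  have h4 : ‖funcCalc D ψ x‖ ≤ ‖(funcCalc D ψ - funcCalc D₀ ψ) x‖ + ‖funcCalc D₀ ψ x‖ := by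
    have := norm_add_le ((funcCalc D ψ - funcCalc D₀ ψ) x) (funcCalc D₀ ψ x)
    rwa [sub_apply, sub_add_cancel] at this
  by_contra hne
  have h5 : 0 < ‖x‖ := norm_pos_iff.2 hne
  nlinarith

end Gap

/-! ### The cut-off functions `φ_n`. -/

section Cutoff

variable {φ : ℝ → ℝ}

theorem IsCutoff.eq_zero (hφ : IsCutoff φ) {x : ℝ} (hx : 1 ≤ |x|) : φ x = 0 := by
  have hout : ∀ x, 1 < |x| → φ x = 0 := fun x hx => by
    refine image_eq_zero_of_notMem_tsupport ?_
    rw [hφ.support]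
    exact fun h => not_lt.2 (abs_le.2 h) hx
  rcases hx.eq_or_lt with h | h
  · have hc : Continuous φ := hφ.smooth.continuous
    -- The points `±1` belong to the closed support, so the value there is a limit from outside.
    have h1 : Tendsto (fun n : ℕ => φ ((1 + 1 / ((n : ℝ) + 1)) * x)) atTop (𝓝 (φ ((1 + 0) * x))) :=
      (hc.tendsto _).comp ((tendsto_const_nhds.add tendsto_one_div_add_atTop_nhds_zero_nat).mul
        tendsto_const_nhds)
    rw [add_zero, one_mul] at h1
    refine tendsto_nhds_unique h1 (tendsto_const_nhds.congr fun n => (hout _ ?_).symm)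
    have h2 : 0 < 1 / ((n : ℝ) + 1) := by positivity
    rw [abs_mul, ← h, mul_one, abs_of_pos (by linarith)]
    linarith
  · exact hout x h

theorem IsCutoff.lt_of_abs_lt (hφ : IsCutoff φ) {x y : ℝ} (h : |x| < |y|) (hy : |y| ≤ 1) :
    φ y < φ x := by
  have hm : StrictMonoOn φ (Icc (-1) 0) := by
    refine strictMonoOn_of_deriv_pos (convex_Icc _ _) hφ.smooth.continuous.continuousOn fun x hx => ?_
    rw [interior_Icc] at hx
    exact hφ.deriv_pos x hx
  have habs : ∀ x, φ x = φ (-|x|) := fun x => by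
    rcases abs_choice x with h | h
    · rw [h, hφ.even]
    · rw [h, neg_neg]
  rw [habs x, habs y]
  exact hm ⟨by linarith, by linarith [abs_nonneg y]⟩ ⟨by linarith, by linarith [abs_nonneg x]⟩
    (by linarith)

theorem IsCutoff.nonneg (hφ : IsCutoff φ) (x : ℝ) : 0 ≤ φ x := by
  rcases lt_or_ge |x| 1 with h | h
  · have := hφ.lt_of_abs_lt (x := x) (y := 1) (by simpa using h) (by simp)
    rw [hφ.eq_zero (x := 1) (by simp)] at this
    exact this.le
  · rw [hφ.eq_zero h]

theorem IsCutoff.le_of_abs_le (hφ : IsCutoff φ) {x y : ℝ} (h : |x| ≤ |y|) : φ y ≤ φ x := by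
  rcases h.eq_or_lt with h | h
  · rcases abs_eq_abs.1 h with h | h
    · rw [h]
    · rw [h, hφ.even]
  · rcases le_or_gt |y| 1 with h1 | h1
    · exact (hφ.lt_of_abs_lt h h1).le
    · rw [hφ.eq_zero h1.le]
      exact hφ.nonneg x

theorem IsCutoff.isC0 (hφ : IsCutoff φ) (n : ℕ+) : IsC0 fun x => φ ((n : ℕ) * x) := by
  have hn : (1 : ℝ) ≤ ((n : ℕ) : ℝ) := by exact_mod_cast n.pos
  refine IsC0.of_hasCompactSupport (hφ.smooth.continuous.comp (by fun_prop))
    (hasCompactSupport_of_abs (b := 1) fun x hx => hφ.eq_zero ?_)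
  rw [abs_mul, abs_of_pos (by linarith)]
  nlinarith

variable {H : Type*} [NormedAddCommGroup H] [InnerProductSpace ℂ H] [CompleteSpace H]

theorem IsCutoff.exists_nearKer (hφ : IsCutoff φ) {D₀ : H →ₗ.[ℂ] H} (hD₀ : IsSelfAdjoint D₀)
    {ε₀ : ℝ} (hε₀ : 0 < ε₀) (hg : ∀ x ∈ specSet D₀, x ≠ 0 → ε₀ ≤ |x|) (n : ℕ+) :
    ∃ ε > 0, ∃ η > 0, ∀ D : H →ₗ.[ℂ] H, IsSelfAdjoint D →
      ‖cutoffOp φ n D - cutoffOp φ n D₀‖ < η → NearKer (spectralProj D₀ {0}) ε D := by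
  have hn : (0 : ℝ) < ((n : ℕ) : ℝ) := by exact_mod_cast n.pos
  -- `2 ε ≤ ε₀` puts `2 ε` inside the gap of `D₀`. `2 n ε ≤ 1` keeps `n ε` and `2 n ε` where `φ` is
  -- strictly decreasing, so `φ(n ε) - φ(2 n ε)` is a positive tolerance.
  set ε := min (ε₀ / 2) (1 / (2 * ((n : ℕ) : ℝ))) with hε
  have hεpos : 0 < ε := by positivity
  have h1 : 2 * ε ≤ ε₀ := by
    have := min_le_left (ε₀ / 2) (1 / (2 * ((n : ℕ) : ℝ)))
    rw [← hε] at this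
    linarith
  have h2 : (n : ℕ) * (2 * ε) ≤ 1 := by
    have := min_le_right (ε₀ / 2) (1 / (2 * ((n : ℕ) : ℝ)))
    rw [← hε, le_div_iff₀ (by positivity)] at this
    linarith
  have habs : ∀ x : ℝ, |((n : ℕ) : ℝ) * x| = (n : ℕ) * |x| := fun x => by
    rw [abs_mul, abs_of_pos hn]
  refine ⟨ε, hεpos, φ ((n : ℕ) * ε) - φ ((n : ℕ) * (2 * ε)), ?_, fun D hD h => ?_⟩
  · refine sub_pos.2 (hφ.lt_of_abs_lt ?_ ?_)
    · rw [habs, habs, abs_of_pos hεpos, abs_of_pos (by positivity)]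
      nlinarith
    · rw [habs, abs_of_pos (by positivity)]
      exact h2
  · refine nearKer_of_norm_sub_lt hD₀ hD (hφ.isC0 n) hεpos hε₀ hg (c := φ ((n : ℕ) * ε))
      (d := φ ((n : ℕ) * (2 * ε))) (fun s hs => ?_) (hφ.nonneg _) (fun s hs => ?_) h
    · refine hφ.le_of_abs_le ?_
      rw [habs, habs, abs_of_pos hεpos]
      gcongr
    · rw [abs_of_nonneg (hφ.nonneg _)]
      refine hφ.le_of_abs_le ?_
      rw [habs, habs, abs_of_pos (by positivity : 0 < 2 * ε)]
      gcongr
      exact h1.trans hs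

end Cutoff

/-! ### Continuous paths in the inductive limit topology. -/

section LimitTopology

variable {H : Type*} [NormedAddCommGroup H] [InnerProductSpace ℂ H] [CompleteSpace H] {φ : ℝ → ℝ}

theorem stageTopology_continuous_resolv (φ : ℝ → ℝ) (n : ℕ+) :
    @Continuous (SelfAdjointOp H) (H → H) (stageTopology φ n) _
      (fun D x => resolv D.1 Complex.I x) := by
  let _ := stageTopology (H := H) φ n
  refine continuous_pi fun x => continuous_iff_le_induced.2 ?_
  exact inf_le_left.trans (inf_le_left.trans (iInf_le _ x))

theorem stageTopology_continuous_resolv_neg (φ : ℝ → ℝ) (n : ℕ+) :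
    @Continuous (SelfAdjointOp H) (H → H) (stageTopology φ n) _
      (fun D x => resolv D.1 (-Complex.I) x) := by
  let _ := stageTopology (H := H) φ n
  refine continuous_pi fun x => continuous_iff_le_induced.2 ?_
  exact inf_le_left.trans (inf_le_right.trans (iInf_le _ x))

theorem stageTopology_continuous_cutoffOp (φ : ℝ → ℝ) (n : ℕ+) :
    @Continuous (SelfAdjointOp H) (H →L[ℂ] H) (stageTopology φ n) _
      (fun D => cutoffOp φ n D.1) := by
  let _ := stageTopology (H := H) φ n
  exact continuous_iff_le_induced.2 inf_le_right

theorem limitTopology_continuous {X : Type*} [TopologicalSpace X] {g : SelfAdjointOp H → X}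
    (hg : ∀ n, @Continuous _ _ (stageTopology φ n) _ g) :
    @Continuous (SF H) X (limitTopology φ) _ (fun D => g D.1) := by
  refine continuous_iSup_dom.2 fun n => continuous_coinduced_dom.2 ?_
  let _ := stageTopology (H := H) φ n
  let _ : TopologicalSpace (SFStage (H := H) φ n) :=
    TopologicalSpace.induced (fun D : SFStage (H := H) φ n => D.1.1) (stageTopology φ n)
  exact (hg n).comp continuous_induced_dom

theorem continuous_resolv (φ : ℝ → ℝ) : @Continuous (SF H) (H → H) (limitTopology φ) _
    (fun D x => resolv D.1.1 Complex.I x) :=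
  limitTopology_continuous fun n => stageTopology_continuous_resolv φ n

theorem continuous_resolv_neg (φ : ℝ → ℝ) : @Continuous (SF H) (H → H) (limitTopology φ) _
    (fun D x => resolv D.1.1 (-Complex.I) x) :=
  limitTopology_continuous fun n => stageTopology_continuous_resolv_neg φ n

theorem strongCont_resolv {T : Type*} [TopologicalSpace T] {D : T → SF H}
    (hD : @Continuous _ _ _ (limitTopology φ) D) :
    StrongCont fun t => resolv (D t).1.1 Complex.I := by
  let _ := limitTopology (H := H) φ
  refine ⟨⟨1, fun t => norm_resolv_le (D t).1.2⟩, fun x => ?_, fun x => ?_⟩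
  · exact (continuous_apply x).comp ((continuous_resolv φ).comp hD)
  · simp only [star_resolv (D _).1.2]
    exact (continuous_apply x).comp ((continuous_resolv_neg φ).comp hD)

theorem SF.ext_resolv {D D' : SF H}
    (h : (fun x => resolv D.1.1 Complex.I x) = fun x => resolv D'.1.1 Complex.I x) : D = D' :=
  Subtype.ext (Subtype.ext (resolv_injOn D.1.2 D'.1.2 (ContinuousLinearMap.ext (congrFun h))))

/-- Openness is tested on each stage. Near `D₀` the stage controls `φ_n(D)`, which forces `NearKer`
with an `ε` depending on `n` only, and the `u j` eventually violate it. Near any other point the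
strong limit of the resolvents separates. The finitely many remaining `u j` are excluded one by one,
as resolvents determine the operators. -/
theorem isOpen_compl_range_of_not_nearKer (hφ : IsCutoff φ) {u : ℕ → SF H} {D₀ : SF H}
    (hu : Tendsto (fun j x => resolv (u j).1.1 Complex.I x) atTop
      (𝓝 fun x => resolv D₀.1.1 Complex.I x))
    (h : ∀ ε > 0, ∀ᶠ j in atTop, ¬NearKer (spectralProj D₀.1.1 {0}) ε (u j).1.1) :
    IsOpen[limitTopology φ] (range u)ᶜ := by
  rw [isOpen_iSup_iff]
  intro n
  rw [isOpen_coinduced]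
  let _ := stageTopology (H := H) φ n
  let _ : TopologicalSpace (SFStage (H := H) φ n) :=
    TopologicalSpace.induced (fun D : SFStage (H := H) φ n => D.1.1) (stageTopology φ n)
  have hval : Continuous fun D : SFStage (H := H) φ n => D.1.1 := continuous_induced_dom
  have hρ := (stageTopology_continuous_resolv (H := H) φ n).comp hval
  have hκ := (stageTopology_continuous_cutoffOp (H := H) φ n).comp hval
  rw [isOpen_iff_mem_nhds]
  intro x hx
  have key : ∃ U ∈ 𝓝 x, ∀ᶠ j in atTop, ∀ y ∈ U, y.1 ≠ u j := by
    by_cases hx0 : x.1 = D₀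
    · obtain ⟨ε₀, hε₀, hg⟩ := exists_gap_of_isFredholm D₀.1.2 D₀.2
      obtain ⟨ε, hε, η, hη, hn⟩ := hφ.exists_nearKer D₀.1.2 hε₀ hg n
      refine ⟨_, hκ.continuousAt.preimage_mem_nhds (Metric.ball_mem_nhds _ hη), ?_⟩
      filter_upwards [h ε hε] with j hj y hy hyj
      rw [mem_preimage, mem_ball_iff_norm] at hy
      refine hj (hn _ (u j).1.2 ?_)
      rw [← hyj, ← hx0]
      exact hy
    · have hne : (fun z => resolv x.1.1.1 Complex.I z) ≠ fun z => resolv D₀.1.1 Complex.I z :=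
        fun h => hx0 (SF.ext_resolv h)
      obtain ⟨U, V, hU, hV, hxU, hV0, hUV⟩ := t2_separation hne
      refine ⟨_, hρ.continuousAt.preimage_mem_nhds (hU.mem_nhds hxU), ?_⟩
      filter_upwards [hu.eventually (hV.mem_nhds hV0)] with j hj y hy hyj
      refine disjoint_left.1 hUV hy ?_
      simp only [Function.comp_apply, hyj]
      exact hj
  obtain ⟨U, hU, hev⟩ := key
  obtain ⟨J, hJ⟩ := eventually_atTop.1 hev
  have h2 : (⋂ j ∈ Finset.range J, {y : SFStage (H := H) φ n |
      (fun z => resolv y.1.1.1 Complex.I z) ≠ fun z => resolv (u j).1.1 Complex.I z}) ∈ 𝓝 x := by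
    refine (biInter_finset_mem _).2 fun j _ => ?_
    refine hρ.continuousAt.preimage_mem_nhds (isOpen_ne.mem_nhds fun h => ?_)
    exact hx ⟨j, (SF.ext_resolv h).symm⟩
  filter_upwards [hU, h2] with y hyU hy2
  rintro ⟨j, hj⟩
  rcases lt_or_ge j J with hlt | hge
  · have := mem_iInter₂.1 hy2 j (Finset.mem_range.2 hlt)
    exact this (by rw [hj])
  · exact hJ j hge y hyU hj.symm

/-- The path is not assumed to stay in one stage near `t₀`. If no `ε` worked, there would be `t_j →
t₀` violating `NearKer` with `ε → 0`. The complement of `{D (t_j)}` is then an open neighbourhood of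
`D t₀` which `D (t_j)` never enters, against continuity. -/
theorem eventually_nearKer (hφ : IsCutoff φ) {T : Type*} [TopologicalSpace T]
    [FirstCountableTopology T] {D : T → SF H} (hD : @Continuous _ _ _ (limitTopology φ) D)
    (t₀ : T) :
    ∃ ε > 0, ∀ᶠ t in 𝓝 t₀, NearKer (spectralProj (D t₀).1.1 {0}) ε (D t).1.1 := by
  let _ := limitTopology (H := H) φ
  by_contra! hcon
  obtain ⟨ε₀, hε₀, hg⟩ := exists_gap_of_isFredholm (D t₀).1.2 (D t₀).2
  obtain ⟨ε₁, hε₁, η, hη, hn⟩ := hφ.exists_nearKer (D t₀).1.2 hε₀ hg 1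
  -- `D t₀` itself satisfies `NearKer` at `ε₁`, hence differs from every `D (t j)`.
  have h0 := hn _ (D t₀).1.2 (by simpa using hη)
  obtain ⟨V, hV⟩ := (𝓝 t₀).exists_antitone_basis
  have hpos : ∀ j : ℕ, 0 < ε₁ / ((j : ℝ) + 1) := fun j => by positivity
  have hex : ∀ j : ℕ, ∃ t ∈ V j,
      ¬NearKer (spectralProj (D t₀).1.1 {0}) (ε₁ / ((j : ℝ) + 1)) (D t).1.1 := fun j => by
    have := hcon _ (hpos j)
    obtain ⟨t, ht, ht'⟩ := (this.and_eventually (hV.mem j)).exists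
    exact ⟨t, ht', ht⟩
  choose t ht htn using hex
  have htt : Tendsto t atTop (𝓝 t₀) := hV.tendsto ht
  have hlim : Tendsto (fun j : ℕ => ε₁ / ((j : ℝ) + 1)) atTop (𝓝 0) := by
    have := (tendsto_one_div_add_atTop_nhds_zero_nat (𝕜 := ℝ)).const_mul ε₁
    simpa [div_eq_mul_inv] using this
  have hopen := isOpen_compl_range_of_not_nearKer hφ (u := fun j => D (t j)) (D₀ := D t₀)
    ((((continuous_resolv φ).comp hD).tendsto t₀).comp htt) (fun ε hε => by
      filter_upwards [hlim.eventually (gt_mem_nhds hε)] with j hj hnear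
      exact htn j (hnear.mono hj.le))
  have hmem : D t₀ ∈ (range fun j => D (t j))ᶜ := by
    rintro ⟨j, hj⟩
    refine htn j ?_
    simp only at hj
    rw [hj]
    refine h0.mono (div_le_self hε₁.le ?_)
    have : (0 : ℝ) ≤ j := j.cast_nonneg
    linarith
  obtain ⟨j, hj⟩ := (((hD.tendsto t₀).comp htt).eventually (hopen.mem_nhds hmem)).exists
  exact hj ⟨j, rfl⟩

end LimitTopology

/-! ### Local existence of levels and of admissible subdivisions. -/

section LocalLevel

variable {H : Type*} [NormedAddCommGroup H] [InnerProductSpace ℂ H] [CompleteSpace H]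

/-- The points `±μ` are not in the spectrum of `D` and the spectral projection of `[-μ, μ]` has
rank `r` and is given by a fixed continuous function. -/
structure IsLevelAt (D : H →ₗ.[ℂ] H) (μ : ℝ) (r : ℕ) : Prop where
  pos : 0 < μ
  notMem : μ ∉ specSet D
  neg_notMem : -μ ∉ specSet D
  finiteRank : FiniteRank (spectralProj D (Icc (-μ) μ))
  rk_eq : rk (spectralProj D (Icc (-μ) μ)) = r
  eq_funcCalc : spectralProj D (Icc (-μ) μ) = funcCalc D (hat μ (4 / 3 * μ))

theorem finrank_le_of_nearKer {D : H →ₗ.[ℂ] H} {E : H →L[ℂ] H} (hE : FiniteRank E) {ε : ℝ}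
    (h : NearKer E ε D) : FiniteDimensional ℂ (spectralSubspace D (Icc (-ε) ε)) ∧
      Module.finrank ℂ (spectralSubspace D (Icc (-ε) ε)) ≤ rk E := by
  have : FiniteDimensional ℂ (LinearMap.range (E : H →ₗ[ℂ] H)) := hE
  let g : spectralSubspace D (Icc (-ε) ε) →ₗ[ℂ] LinearMap.range (E : H →ₗ[ℂ] H) :=
    (E : H →ₗ[ℂ] H).rangeRestrict ∘ₗ (spectralSubspace D (Icc (-ε) ε)).subtype
  have hg : Function.Injective g := by
    rw [injective_iff_map_eq_zero]
    intro x hx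
    exact Subtype.ext (h x x.2 (congrArg Subtype.val hx))
  exact ⟨Module.Finite.of_injective g hg, LinearMap.finrank_le_finrank_of_injective hg⟩

/-- A squeeze of dimensions: `NearKer` gives at most `rk E` on `[-ε, ε]`, and the norm condition
gives at least `rk E` already on `[-ε/2, ε/2]`. So there is no spectrum with `ε/2 < |x| < ε`. The
level `3/4 ε` lies in this gap, and `4/3` of it is `ε`. -/
theorem isLevelAt_of_nearKer {D : H →ₗ.[ℂ] H} (hD : IsSelfAdjoint D) {E : H →L[ℂ] H}
    (hEp : IsStarProjection E) (hE : FiniteRank E) {ε : ℝ} (hε : 0 < ε) (h : NearKer E ε D)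
    (hlt : ‖(1 - funcCalc D (hat (ε / 3) (ε / 2))) * E‖ < 1) : IsLevelAt D (3 / 4 * ε) (rk E) := by
  obtain ⟨hfin, hle⟩ := finrank_le_of_nearKer hE h
  have hk := isC0_hat (show ε / 3 < ε / 2 by linarith)
  have hsub : ∀ {a b : ℝ}, a ≤ b →
      spectralSubspace D (Icc (-a) a) ≤ spectralSubspace D (Icc (-b) b) := fun hab =>
    spectralSubspace_mono (Icc_subset_Icc (by linarith) hab)
  have hr : LinearMap.range (funcCalc D (hat (ε / 3) (ε / 2)) : H →ₗ[ℂ] H) ≤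
      spectralSubspace D (Icc (-(ε / 2)) (ε / 2)) := by
    rintro x ⟨y, rfl⟩
    refine funcCalc_mem_spectralSubspace hD (hk.isC0On hD) (fun x _ hx => ?_) y
    refine hat_eq_zero (by linarith) (not_lt.1 fun hlt => hx ?_)
    exact abs_le.1 hlt.le
  have hle1 := hsub (show ε / 2 ≤ 3 / 4 * ε by linarith)
  have hle2 := hsub (show 3 / 4 * ε ≤ ε by linarith)
  have i2 := Submodule.finiteDimensional_of_le hle2
  have i1 := Submodule.finiteDimensional_of_le hle1
  have i0 := Submodule.finiteDimensional_of_le hr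
  have hrk := (rk_le_of_norm_one_sub_mul_lt hEp i0 hlt).2
  have f0 : rk (funcCalc D (hat (ε / 3) (ε / 2))) ≤ _ := Submodule.finrank_mono hr
  have f1 := Submodule.finrank_mono hle1
  have f2 := Submodule.finrank_mono hle2
  have heq : spectralSubspace D (Icc (-(ε / 2)) (ε / 2)) = spectralSubspace D (Icc (-ε) ε) :=
    Submodule.eq_of_le_of_finrank_le (hle1.trans hle2) (by omega)
  have hb := isC0_bump (ε / 2) ε
  have hgap : ∀ x ∈ specSet D, |x| ≤ ε / 2 ∨ ε ≤ |x| := by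
    have h0 : funcCalc D (fun x => bump (ε / 2) ε x * bump (ε / 2) ε x) = 0 := by
      ext y
      rw [funcCalc_mul (hb.isC0On hD) (hb.isC0On hD), mul_apply_eq_comp, zero_apply]
      refine funcCalc_apply_eq_zero hD hb (S := Icc (-(ε / 2)) (ε / 2))
        (fun s hs => bump_eq_zero (Or.inl (abs_le.2 hs))) ?_
      rw [heq]
      refine funcCalc_mem_spectralSubspace hD (hb.isC0On hD) (fun x _ hx => ?_) y
      refine bump_eq_zero (Or.inr (not_lt.1 fun hlt => hx ?_))
      exact abs_le.1 hlt.le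
    intro x hx
    by_contra! hcon
    have := eq_zero_of_funcCalc_eq_zero hD ((hb.isC0On hD).mul (hb.isC0On hD)) h0 x hx
    exact (mul_pos (bump_pos hcon.1 hcon.2) (bump_pos hcon.1 hcon.2)).ne' this
  have habs : |3 / 4 * ε| = 3 / 4 * ε := abs_of_pos (by positivity)
  refine ⟨by positivity, fun hm => ?_, fun hm => ?_, ?_, ?_, ?_⟩
  · rcases hgap _ hm with h | h <;> rw [habs] at h <;> linarith
  · rcases hgap _ hm with h | h <;> rw [abs_neg, habs] at h <;> linarith
  · rw [FiniteRank, range_spectralProj]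
    exact i2
  · rw [rk, range_spectralProj]
    omega
  · have e : 4 / 3 * (3 / 4 * ε) = ε := by ring
    rw [e]
    refine spectralProj_eq_funcCalc hD (isC0_hat (by linarith)) (fun s hs => ?_) fun s hs hsS => ?_
    · exact hat_eq_one (by linarith) (abs_le.2 hs)
    · rcases hgap s hs with h | h
      · exact absurd (abs_le.1 (h.trans (by linarith : ε / 2 ≤ 3 / 4 * ε))) hsS
      · exact hat_eq_zero (by linarith) h

/-- `E` is the projection onto the kernel of `D t₀`. Its finite rank turns strong continuity of the
trapezoid function of `D t` into the norm condition of `isLevelAt_of_nearKer`. -/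
theorem eventually_isLevelAt {φ : ℝ → ℝ} (hφ : IsCutoff φ) {T : Type*} [TopologicalSpace T]
    [FirstCountableTopology T] {D : T → SF H} (hD : @Continuous _ _ _ (limitTopology φ) D)
    (t₀ : T) : ∃ μ r, ∀ᶠ t in 𝓝 t₀, IsLevelAt (D t).1.1 μ r := by
  obtain ⟨ε₁, hε₁, hev⟩ := eventually_nearKer hφ hD t₀
  obtain ⟨ε₀, hε₀, hg⟩ := exists_gap_of_isFredholm (D t₀).1.2 (D t₀).2
  have hfin := finiteRank_spectralProj_zero (D t₀).1.2 (D t₀).2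
  have hE := isStarProjection_spectralProj (D t₀).1.1 {0}
  set ε := min ε₀ ε₁ with hεd
  have hε : 0 < ε := lt_min hε₀ hε₁
  have hk := isC0_hat (show ε / 3 < ε / 2 by linarith)
  have hs := (strongCont_resolv hD).funcCalc (fun t => (D t).1.2) hk
  have hs1 := (StrongCont.one (T := T) (H := H)).sub hs
  have h0 : spectralProj (D t₀).1.1 {0} = funcCalc (D t₀).1.1 (hat (ε / 3) (ε / 2)) :=
    spectralProj_zero_eq (D t₀).1.2 hg (by positivity) (by linarith)
      ((by linarith : ε / 2 ≤ ε).trans (min_le_left _ _))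
  obtain ⟨C, hC⟩ := hs1.bound
  have hlim := tendsto_mul_of_isCompactOperator hC (fun x => (hs1.cont x).tendsto t₀) hfin.compact
  have hz : (1 - funcCalc (D t₀).1.1 (hat (ε / 3) (ε / 2))) * spectralProj (D t₀).1.1 {0} = 0 := by
    rw [← h0, sub_mul, one_mul, hE.isIdempotentElem.eq, sub_self]
  rw [hz] at hlim
  have hlt := hlim.norm
  rw [norm_zero] at hlt
  refine ⟨3 / 4 * ε, rk (spectralProj (D t₀).1.1 {0}), ?_⟩
  filter_upwards [hev, hlt.eventually (gt_mem_nhds one_pos)] with t ht ht1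
  exact isLevelAt_of_nearKer (D t).1.2 hE hfin hε (ht.mono (min_le_right _ _)) ht1

/-- For finite rank projections of constant rank, strong continuity implies norm continuity. -/
theorem continuous_of_rk_eq {T : Type*} [TopologicalSpace T] {E : T → H →L[ℂ] H}
    (hE : ∀ t, IsStarProjection (E t)) (hfin : ∀ t, FiniteRank (E t))
    (hrk : ∀ s t, rk (E s) = rk (E t)) (hs : StrongCont E) : Continuous E := by
  rw [continuous_iff_continuousAt]
  intro t
  refine tendsto_of_isStarProjection hE (hE t) hfin (fun s => (hrk s t).le) ?_
  refine tendsto_one_sub_mul hE (hE t) (hfin t) fun x hx => ?_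
  have := (hs.cont x).tendsto t
  rwa [hx] at this

theorem isLevel_of_isLevelAt {φ : ℝ → ℝ} {D : ℝ → SF H} {s t μ : ℝ} {n : ℕ}
    (hD : @ContinuousOn ℝ (SF H) _ (limitTopology φ) D (Icc s t)) (hμ : 0 < μ)
    (h : ∀ r ∈ Icc s t, IsLevelAt (D r).1.1 μ n) : IsLevel (fun r => (D r).1.1) s t μ := by
  let _ := limitTopology (H := H) φ
  refine ⟨hμ, fun r hr => inResolventSet_of_notMem_specSet (D r).1.2 (h r hr).notMem,
    fun r hr => ?_, fun r hr => (h r hr).finiteRank, ?_⟩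
  · exact inResolventSet_of_notMem_specSet (D r).1.2 (h r hr).neg_notMem
  · rw [continuousOn_iff_continuous_domRestrict] at hD ⊢
    refine continuous_of_rk_eq (fun r => isStarProjection_spectralProj _ _)
      (fun r => (h r r.2).finiteRank) (fun r r' => ?_) ?_
    · exact (h r r.2).rk_eq.trans (h r' r'.2).rk_eq.symm
    · have hs := (strongCont_resolv (D := (Icc s t).domRestrict D) hD).funcCalc
        (D := fun r : Icc s t => (D r).1.1) (fun r => (D r).1.2)
        (isC0_hat (show μ < 4 / 3 * μ by linarith))
      convert hs using 2 with r
      exact (h r r.2).eq_funcCalc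

/-- Compactness of `[a, b]`: a subdivision fine enough for the cover by neighbourhoods on which one
level works. -/
theorem exists_hasSpectralFlow {φ : ℝ → ℝ} (hφ : IsCutoff φ) {a b : ℝ} (hab : a ≤ b)
    {D : ℝ → SF H} (hD : @ContinuousOn ℝ (SF H) _ (limitTopology φ) D (Icc a b)) :
    ∃ m, HasSpectralFlow (fun t => (D t).1.1) a b m := by
  let _ := limitTopology (H := H) φ
  have hDc := continuousOn_iff_continuous_domRestrict.1 hD
  have hloc := fun t₀ : Icc a b => eventually_isLevelAt hφ hDc t₀
  choose μ r hev using hloc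
  choose c hc hco hcm using fun t₀ => eventually_nhds_iff.1 (hev t₀)
  obtain ⟨t, h0, hmono, ⟨N, hN⟩, hcov⟩ := exists_monotone_Icc_subset_open_cover_Icc hab hco
    (fun x _ => mem_iUnion.2 ⟨x, hcm x⟩)
  choose i hi using hcov
  refine ⟨_, N, fun j => t j, fun j => μ (i j), by simp only [h0], by simp only [hN N le_rfl], fun j _ => ⟨hmono j.le_succ, ?_⟩, rfl⟩
  have hsub : Icc (t j : ℝ) (t (j + 1)) ⊆ Icc a b :=
    Icc_subset_Icc (t j).2.1 (t (j + 1)).2.2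
  have hlev : ∀ r' ∈ Icc (t j : ℝ) (t (j + 1)), IsLevelAt (D r').1.1 (μ (i j)) (r (i j)) :=
    fun r' hr' => hc (i j) ⟨r', hsub hr'⟩ (hi j ⟨hr'.1, hr'.2⟩)
  exact isLevel_of_isLevelAt (hD.mono hsub)
    (hlev _ (left_mem_Icc.2 (hmono j.le_succ))).pos hlev

end LocalLevel

/-! ### Selfadjointness of `D + K`, telescoping, and the main theorem. -/

section Main

variable {H : Type*} [NormedAddCommGroup H] [InnerProductSpace ℂ H] [CompleteSpace H]
  {φ : ℝ → ℝ} {D : ℝ → SF H} {K : ℝ → H →ₗ.[ℂ] H}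

theorem isComposition_boundedComp_resolv {D K : H →ₗ.[ℂ] H} (hD : IsSelfAdjoint D)
    (hK : K.IsFormalAdjoint K) (hd : D.domain ≤ K.domain) :
    IsComposition K (resolv D Complex.I) (boundedComp K (resolv D Complex.I)) := by
  obtain ⟨C, hC⟩ := exists_isComposition_resolv hD hK hd
  rw [hC.boundedComp_eq]
  exact hC

theorem isSelfAdjoint_add {D K : H →ₗ.[ℂ] H} (hD : IsSelfAdjoint D) (hK : K.IsFormalAdjoint K)
    (hd : D.domain ≤ K.domain) (h : IsInvertible (D + K)) : IsSelfAdjoint (D + K) := by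
  refine isSelfAdjoint_of_isInvertible (fun x y => ?_) ?_ h
  · have hs : D.IsFormalAdjoint D := by
      have := LinearPMap.adjoint_isFormalAdjoint (T := D) hD.dense_domain
      rwa [LinearPMap.isSelfAdjoint_def.1 hD] at this
    have h1 := hs ⟨x, x.2.1⟩ ⟨y, y.2.1⟩
    have h2 := hK ⟨x, x.2.2⟩ ⟨y, y.2.2⟩
    rw [LinearPMap.add_apply, LinearPMap.add_apply, inner_add_left, inner_add_right]
    exact congrArg₂ (· + ·) h1 h2
  · have : (D + K).domain = D.domain := inf_eq_left.2 hd
    rw [this]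
    exact hD.dense_domain

theorem isIndexPair_and_levelDim_sub_of_isLevel {s t μ : ℝ}
    (hD : @ContinuousOn ℝ (SF H) _ (limitTopology φ) D (Icc s t))
    (hKsymm : ∀ r ∈ Icc s t, (K r).IsFormalAdjoint (K r))
    (hKdom : ∀ r ∈ Icc s t, (D r).1.1.domain ≤ (K r).domain)
    (hKcompact : ∀ r ∈ Icc s t, IsCompactOperator
      (boundedComp (K r) (resolv (D r).1.1 Complex.I)))
    (hKcont : ContinuousOn (fun r => boundedComp (K r) (resolv (D r).1.1 Complex.I)) (Icc s t))
    (hDK : ∀ r ∈ Icc s t, IsInvertible ((D r).1.1 + K r))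
    (h : IsLevel (fun r => (D r).1.1) s t μ) (hst : s ≤ t) :
    IsIndexPair (nonnegProj (D s).1.1) (nonnegProj ((D s).1.1 + K s)) ∧
    (levelDim (D t).1.1 μ : ℤ) - levelDim (D s).1.1 μ =
      pairIndex (nonnegProj (D t).1.1) (nonnegProj ((D t).1.1 + K t)) -
        pairIndex (nonnegProj (D s).1.1) (nonnegProj ((D s).1.1 + K s)) := by
  let _ := limitTopology (H := H) φ
  have : PreconnectedSpace (Icc s t) := Subtype.preconnectedSpace isPreconnected_Icc
  have hDc := continuousOn_iff_continuous_domRestrict.1 hD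
  have key := isIndexPair_and_levelDim_sub (T := Icc s t) (D := fun r => (D r).1.1)
    (K := fun r => K r) (fun r => (D r).1.2) (strongCont_resolv hDc)
    (fun r => isComposition_boundedComp_resolv (D r).1.2 (hKsymm r r.2) (hKdom r r.2))
    ⟨continuousOn_iff_continuous_domRestrict.1 hKcont, fun r => hKcompact r r.2⟩
    (fun r => isSelfAdjoint_add (D r).1.2 (hKsymm r r.2) (hKdom r r.2) (hDK r r.2))
    (fun r => hDK r r.2) h.pos (fun r => (h.pos_mem r r.2).notMem_specSet (D r).1.2)
    (fun r => (h.neg_mem r r.2).notMem_specSet (D r).1.2) (fun r => h.finite r r.2)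
    (continuousOn_iff_continuous_domRestrict.1 h.cont)
  exact ⟨key.1 ⟨s, left_mem_Icc.2 hst⟩,
    key.2 ⟨s, left_mem_Icc.2 hst⟩ ⟨t, right_mem_Icc.2 hst⟩⟩

/-- The telescoping applies to an arbitrary admissible subdivision, so this also gives uniqueness of
the value. -/
theorem eq_pairIndex_sub_of_hasSpectralFlow {a b : ℝ} {m : ℤ}
    (hD : @ContinuousOn ℝ (SF H) _ (limitTopology φ) D (Icc a b))
    (hKsymm : ∀ r ∈ Icc a b, (K r).IsFormalAdjoint (K r))
    (hKdom : ∀ r ∈ Icc a b, (D r).1.1.domain ≤ (K r).domain)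
    (hKcompact : ∀ r ∈ Icc a b, IsCompactOperator
      (boundedComp (K r) (resolv (D r).1.1 Complex.I)))
    (hKcont : ContinuousOn (fun r => boundedComp (K r) (resolv (D r).1.1 Complex.I)) (Icc a b))
    (hDK : ∀ r ∈ Icc a b, IsInvertible ((D r).1.1 + K r))
    (h : HasSpectralFlow (fun r => (D r).1.1) a b m) :
    m = pairIndex (nonnegProj (D b).1.1) (nonnegProj ((D b).1.1 + K b)) -
        pairIndex (nonnegProj (D a).1.1) (nonnegProj ((D a).1.1 + K a)) := by
  let _ := limitTopology (H := H) φ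
  obtain ⟨N, s, μ, h0, hN, hlev, rfl⟩ := h
  -- The sequence `s` is unconstrained beyond `N`, hence the truncation.
  have hmono : Monotone fun k => s (min k N) := by
    refine monotone_nat_of_le_succ fun k => ?_
    rcases lt_or_ge k N with hk | hk
    · rw [min_eq_left hk.le, min_eq_left (Nat.succ_le_of_lt hk)]
      exact (hlev k hk).1
    · rw [min_eq_right hk, min_eq_right (hk.trans k.le_succ)]
  have hmem : ∀ k ≤ N, s k ∈ Icc a b := fun k hk => by
    have h1 := hmono (Nat.zero_le k)
    have h2 := hmono hk
    simp only [Nat.zero_min, min_eq_left hk, min_self, h0, hN] at h1 h2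
    exact ⟨h1, h2⟩
  rw [← h0, ← hN, ← Finset.sum_range_sub (fun k => pairIndex (nonnegProj (D (s k)).1.1)
    (nonnegProj ((D (s k)).1.1 + K (s k))))]
  refine Finset.sum_congr rfl fun j hj => ?_
  have hj' := Finset.mem_range.1 hj
  have hsub : Icc (s j) (s (j + 1)) ⊆ Icc a b :=
    Icc_subset_Icc (hmem j hj'.le).1 (hmem (j + 1) hj').2
  exact (isIndexPair_and_levelDim_sub_of_isLevel (hD.mono hsub) (fun r hr => hKsymm r (hsub hr))
    (fun r hr => hKdom r (hsub hr)) (fun r hr => hKcompact r (hsub hr)) (hKcont.mono hsub)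
    (fun r hr => hDK r (hsub hr)) (hlev j hj').2 (hlev j hj').1).2

/-- Apply the result for one piece to the degenerate interval `[t, t]`, with a level of `D t` alone.
-/
theorem isIndexPair_nonnegProj (hφ : IsCutoff φ) {a b : ℝ}
    (hD : @ContinuousOn ℝ (SF H) _ (limitTopology φ) D (Icc a b))
    (hKsymm : ∀ r ∈ Icc a b, (K r).IsFormalAdjoint (K r))
    (hKdom : ∀ r ∈ Icc a b, (D r).1.1.domain ≤ (K r).domain)
    (hKcompact : ∀ r ∈ Icc a b, IsCompactOperator
      (boundedComp (K r) (resolv (D r).1.1 Complex.I)))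
    (hDK : ∀ r ∈ Icc a b, IsInvertible ((D r).1.1 + K r)) {t : ℝ} (ht : t ∈ Icc a b) :
    IsIndexPair (nonnegProj (D t).1.1) (nonnegProj ((D t).1.1 + K t)) := by
  let _ := limitTopology (H := H) φ
  obtain ⟨μ, r, hev⟩ := eventually_isLevelAt hφ (continuousOn_iff_continuous_domRestrict.1 hD) ⟨t, ht⟩
  have hlev := hev.self_of_nhds
  have hsub : Icc t t ⊆ Icc a b := by
    rw [Icc_self]
    exact singleton_subset_iff.2 ht
  have hl := isLevel_of_isLevelAt (hD.mono hsub) hlev.pos (n := r) fun r' hr' => by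
    rw [Icc_self, mem_singleton_iff] at hr'
    rw [hr']
    exact hlev
  refine (isIndexPair_and_levelDim_sub_of_isLevel (hD.mono hsub) (fun r hr => hKsymm r (hsub hr))
    (fun r hr => hKdom r (hsub hr)) (fun r hr => hKcompact r (hsub hr)) ?_
    (fun r hr => hDK r (hsub hr)) hl le_rfl).1
  rw [Icc_self]
  exact continuousOn_singleton _ _

end Main

end SpectralFlow

theorem mainTheorem6 {H : Type*} [NormedAddCommGroup H] [InnerProductSpace ℂ H]
    [CompleteSpace H] [TopologicalSpace.SeparableSpace H]
    (φ : ℝ → ℝ) (hφ : SpectralFlow.IsCutoff φ)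
    (a b : ℝ) (hab : a ≤ b)
    (D : ℝ → SpectralFlow.SF H)
    (hD : @ContinuousOn ℝ (SpectralFlow.SF H) _ (SpectralFlow.limitTopology φ) D (Set.Icc a b))
    (hDa : SpectralFlow.IsInvertible (D a).1.1)
    (hDb : SpectralFlow.IsInvertible (D b).1.1)
    (K : ℝ → H →ₗ.[ℂ] H)
    (hKsymm : ∀ t ∈ Set.Icc a b, (K t).IsFormalAdjoint (K t))
    (hKdom : ∀ t ∈ Set.Icc a b, (D t).1.1.domain ≤ (K t).domain)
    (hKcompact : ∀ t ∈ Set.Icc a b, IsCompactOperator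
      (SpectralFlow.boundedComp (K t) (SpectralFlow.resolv (D t).1.1 Complex.I)))
    (hKcont : ContinuousOn
      (fun t => SpectralFlow.boundedComp (K t) (SpectralFlow.resolv (D t).1.1 Complex.I))
      (Set.Icc a b))
    (hDK : ∀ t ∈ Set.Icc a b, SpectralFlow.IsInvertible ((D t).1.1 + K t)) :
    (∀ t ∈ Set.Icc a b, IsSelfAdjoint ((D t).1.1 + K t)) ∧
    SpectralFlow.IsIndexPair (SpectralFlow.nonnegProj (D a).1.1)
      (SpectralFlow.nonnegProj ((D a).1.1 + K a)) ∧
    SpectralFlow.IsIndexPair (SpectralFlow.nonnegProj (D b).1.1)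
      (SpectralFlow.nonnegProj ((D b).1.1 + K b)) ∧
    (∃! m : ℤ, SpectralFlow.HasSpectralFlow (fun t => (D t).1.1) a b m) ∧
    SpectralFlow.spfl (fun t => (D t).1.1) a b =
      SpectralFlow.pairIndex (SpectralFlow.nonnegProj (D b).1.1)
          (SpectralFlow.nonnegProj ((D b).1.1 + K b)) -
        SpectralFlow.pairIndex (SpectralFlow.nonnegProj (D a).1.1)
          (SpectralFlow.nonnegProj ((D a).1.1 + K a)) := by
  have hsf := SpectralFlow.exists_hasSpectralFlow hφ hab hD
  have huniq := fun m (hm : SpectralFlow.HasSpectralFlow (fun t => (D t).1.1) a b m) =>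
    SpectralFlow.eq_pairIndex_sub_of_hasSpectralFlow hD hKsymm hKdom hKcompact hKcont hDK hm
  refine ⟨fun t ht => SpectralFlow.isSelfAdjoint_add (D t).1.2 (hKsymm t ht) (hKdom t ht)
    (hDK t ht), SpectralFlow.isIndexPair_nonnegProj hφ hD hKsymm hKdom hKcompact hDK
    (left_mem_Icc.2 hab), SpectralFlow.isIndexPair_nonnegProj hφ hD hKsymm hKdom hKcompact hDK
    (right_mem_Icc.2 hab), ?_, ?_⟩
  · obtain ⟨m, hm⟩ := hsf
    exact ⟨m, hm, fun m' hm' => (huniq m' hm').trans (huniq m hm).symm⟩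
  · rw [SpectralFlow.spfl, dif_pos hsf]
    exact huniq _ hsf.choose_spec
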